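/- All vector spaces are over $\mathbb C$. A \emph{superalgebra} is a space $L=L_0\oplus L_1$ with a bilinear product satisfying $[L_i,L_j]\subseteq L_{i+j}$ ($i,j\in\mathbb Z/2$); isomorphisms are parity-preserving linear bijections respecting the products. It is a \emph{Leibniz superalgebra} if $[x,[y,z]]=[[x,y],z]-(-1)^{\alpha\beta}[[x,z],y]$ for all $x\in L$, $y\in L_\alpha$, $z\in L_\beta$. It is \emph{nilpotent} (\emph{solvable}) if the series $L^1=L$, $L^{k+1}=[L^k,L]$ (respectively $L^{(1)}=L$, $L^{(k+1)}=[L^{(k)},L^{(k)}]$) reaches $0$. A \emph{nilradical} of $L$ is a maximal element among the nilpotent two-sided graded ideals $N$ of $L$ with $[L,L]\subseteq N$. Let $n\ge 3$. Let $H=H(0,\dots,0)$ be the superalgebra with even basis $e_1,\dots,e_n$, odd basis $y_1,\dots,y_n$ and non-zero products $$[e_1,e_1]=e_3,\quad [e_i,e_1]=e_{i+1}\ (3\le i\le n-1),\quad [y_j,e_1]=y_{j+1}\ (1\le j\le n-1),$$ $$[e_1,y_1]=\tfrac12 y_2,\quad [e_i,y_1]=\tfrac12 y_i\ (3\le i\le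 n),\quad [y_1,y_1]=e_1,\quad [y_j,y_1]=e_{j+1}\ (2\le j\le n-1).$$ Consider the following superalgebras. They have the basis of $H$ together with additional even basis vectors ($x_1,x_2$ for $MH_1,MH_2$; a single vector $x$ for the others), the products of $H$, and the listed further products; all other products of basis vectors are zero. Let $(D_x)$ denote the products $$[e_1,x]=2e_1,\ \ [e_i,x]=2(i-1)e_i\ (3\le i\le n),\ \ [y_i,x]=(2i-1)y_i\ (1\le i\le n),\ \ [x,e_1]=-2e_1,\ \ [x,y_1]=-y_1,$$ and, for $a=(a_2,\dots,a_n)\in\mathbb C^{n-1}$, let $(P_{x,a})$ denote the products $$[e_1,x]=\sum_{k=3}^n a_{k-1}e_k,\quad [e_i,x]=\sum_{k=i+1}^n a_{k+1-i}e_k\ (3\le i\le n),\quad [y_i,x]=\sum_{k=i+1}^n a_{k+1-i}y_k\ (1\le i\le n).$$ \begin{itemize} \item $MH_1$: $(D_{x_1})$, $[e_2,x_2]=e_2$; \item $MH_2$: $(D_{x_1})$, $[e_2,x_2]=e_2$, $[x_2,e_2]=-e_2$; \item $H_1(b)$, $b\in\mathbb C\setminus\{0\}$: $(D_x)$, $[e_2,x]=be_2$,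 $[x,e_2]=-be_2$; \item $H_2(b)$, $b\in\mathbb C$: $(D_x)$, $[e_2,x]=be_2$; \item $H_3$: $(D_x)$, $[x,x]=e_2$; \item $H_4=H_4(a)$: $(P_{x,a})$, $[e_2,x]=e_2$; \item $H_5(\gamma)=H_5(\gamma;a)$, $\gamma\in\{0,1\}$: $(P_{x,a})$, $[e_2,x]=e_2$, $[x,e_2]=-e_2$, $[x,x]=\gamma e_2$. \end{itemize} \textbf{Theorem.} \begin{enumerate} \item Let $L$ be a non-nilpotent solvable Leibniz superalgebra with a nilradical $N$ isomorphic to $H$. Then either $\dim L/N=2$ and $L$ is isomorphic to $MH_1$ or $MH_2$, or $\dim L/N=1$ and $L$ is isomorphic to one of $H_1(b)$ with $b\ne0$, $H_2(b)$, $H_3$, $H_4(a)$, $H_5(0;a)$. In the last two cases $a$ can be chosen such that its first non-zero entry (if there is one) is $1$. \item Conversely, each of $MH_1$, $MH_2$, $H_1(b)$ with $b\neq0$, $H_2(b)$, $H_3$, $H_4(a)$, $H_5(0;a)$ is a non-nilpotent solvable Leibniz superalgebra with a nilradical isomorphic to $H$, of codimension $2$ for $MH_1,MH_2$ and of codimension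 $1$ for the others. \item The superalgebras $H_5(1;a)$ do not satisfy the Leibniz superidentity. \item The superalgebras $MH_1$, $MH_2$, $H_1(b)$ ($b\ne0$), $H_2(b)$, $H_3$, $H_4(a)$, $H_5(\gamma;a)$ ($\gamma\in\{0,1\}$) are pairwise non-isomorphic, up to scaling of the parameters $a$: two members of different families, or with different values of $b$ or of $\gamma$, are not isomorphic, and $H_4(a)\cong H_4(a')$ (respectively $H_5(\gamma;a)\cong H_5(\gamma;a')$) if and only if there is $t\in\mathbb C\setminus\{0\}$ with $a'_k=t^{k-1}a_k$ for all $2\le k\le n$. \end{enumerate} -/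

import Mathlib

/-- A complex superalgebra structure on the vector space `L`: a decomposition `L = L₀ ⊕ L₁`
together with a bilinear product which is compatible with the `ℤ/2`-grading. -/
structure SuperAlgebra (L : Type*) [AddCommGroup L] [Module ℂ L] where
  part : ZMod 2 → Submodule ℂ L
  isCompl : IsCompl (part 0) (part 1)
  bracket : L →ₗ[ℂ] L →ₗ[ℂ] L
  bracket_mem : ∀ (i j : ZMod 2) (x y : L), x ∈ part i → y ∈ part j → bracket x y ∈ part (i + j)

namespace SuperAlgebra

variable {L : Type*} [AddCommGroup L] [Module ℂ L]
variable {L' : Type*} [AddCommGroup L'] [Module ℂ L']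

/-- The Leibniz superidentity
`[x,[y,z]] = [[x,y],z] - (-1)^(αβ) [[x,z],y]` for `x ∈ L`, `y ∈ L_α`, `z ∈ L_β`. -/
def IsLeibniz (S : SuperAlgebra L) : Prop :=
  ∀ (α β : ZMod 2) (x y z : L), y ∈ S.part α → z ∈ S.part β →
    S.bracket x (S.bracket y z) =
      S.bracket (S.bracket x y) z - (-1 : ℂ) ^ (α.val * β.val) • S.bracket (S.bracket x z) y

/-- The lower central series: `L¹ = L`, `Lᵏ⁺¹ = [Lᵏ, L]` (numbered here from `0`). -/
def lowerCentral (S : SuperAlgebra L) : ℕ → Submodule ℂ L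
  | 0 => ⊤
  | k + 1 => Submodule.map₂ S.bracket (lowerCentral S k) ⊤

/-- The derived series: `L⁽¹⁾ = L`, `L⁽ᵏ⁺¹⁾ = [L⁽ᵏ⁾, L⁽ᵏ⁾]` (numbered here from `0`). -/
def derived (S : SuperAlgebra L) : ℕ → Submodule ℂ L
  | 0 => ⊤
  | k + 1 => Submodule.map₂ S.bracket (derived S k) (derived S k)

def IsNilpotent (S : SuperAlgebra L) : Prop := ∃ k, S.lowerCentral k = ⊥

def IsSolvable (S : SuperAlgebra L) : Prop := ∃ k, S.derived k = ⊥

/-- Two superalgebras are isomorphic if there is a parity preserving linear bijection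
between them which respects the products. -/
def Iso (S : SuperAlgebra L) (S' : SuperAlgebra L') : Prop :=
  ∃ φ : L ≃ₗ[ℂ] L', (∀ (i : ZMod 2) (x : L), x ∈ S.part i ↔ φ x ∈ S'.part i) ∧
    ∀ x y : L, φ (S.bracket x y) = S'.bracket (φ x) (φ y)

/-- A (two-sided, graded) ideal `I = (I ∩ L₀) ⊕ (I ∩ L₁)` of a superalgebra. -/
structure GradedIdeal (S : SuperAlgebra L) where
  carrier : Submodule ℂ L
  graded : carrier ≤ (carrier ⊓ S.part 0) ⊔ (carrier ⊓ S.part 1)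
  mul_mem_left : ∀ x y : L, y ∈ carrier → S.bracket x y ∈ carrier
  mul_mem_right : ∀ x y : L, x ∈ carrier → S.bracket x y ∈ carrier

/-- A graded ideal, regarded as a superalgebra with the restricted product and grading. -/
def ofIdeal (S : SuperAlgebra L) (I : S.GradedIdeal) : SuperAlgebra I.carrier where
  part i := (S.part i).comap I.carrier.subtype
  isCompl := by
    constructor
    · rw [Submodule.disjoint_def]
      intro x h0 h1
      exact Subtype.ext ((Submodule.disjoint_def.1 S.isCompl.disjoint) x h0 h1)
    · rw [codisjoint_iff, eq_top_iff]
      rintro ⟨x, hx⟩ -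
      obtain ⟨a, ha, b, hb, hab⟩ := Submodule.mem_sup.1 (I.graded hx)
      refine Submodule.mem_sup.2 ⟨⟨a, ha.1⟩, ha.2, ⟨b, hb.1⟩, hb.2, Subtype.ext hab⟩
  bracket := LinearMap.mk₂ ℂ
    (fun x y => ⟨S.bracket x y, I.mul_mem_left _ _ y.2⟩)
    (fun x x' y => Subtype.ext (by simp))
    (fun c x y => Subtype.ext (by simp))
    (fun x y y' => Subtype.ext (by simp))
    (fun c x y => Subtype.ext (by simp))
  bracket_mem i j x y hx hy := S.bracket_mem i j x y hx hy

/-- `N` is a nilradical of `L`: it is maximal among the nilpotent ideals of `L` which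
contain `[L, L]`. -/
def IsNilradical (S : SuperAlgebra L) (N : S.GradedIdeal) : Prop :=
  (S.ofIdeal N).IsNilpotent ∧ Submodule.map₂ S.bracket ⊤ ⊤ ≤ N.carrier ∧
    ∀ J : S.GradedIdeal, (S.ofIdeal J).IsNilpotent → Submodule.map₂ S.bracket ⊤ ⊤ ≤ J.carrier →
      N.carrier ≤ J.carrier → J.carrier = N.carrier

end SuperAlgebra

/-- Names of basis vectors: `e i`, `x k` (even) and `y j` (odd), with indices starting at `1`. -/
inductive HGen where
  | e (i : ℕ)
  | x (k : ℕ)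
  | y (j : ℕ)

def HGen.parity : HGen → ZMod 2
  | .e _ => 0
  | .x _ => 0
  | .y _ => 1

/-- Index set of the basis `e_1, …, e_n, x_1, …, x_c` (even), `y_1, …, y_n` (odd). -/
abbrev HIdx (n c : ℕ) := (Fin n ⊕ Fin c) ⊕ Fin n

def HIdx.name {n c : ℕ} : HIdx n c → HGen
  | .inl (.inl i) => .e (i + 1)
  | .inl (.inr k) => .x (k + 1)
  | .inr j => .y (j + 1)

/-- The vector space with basis `e_1, …, e_n, x_1, …, x_c, y_1, …, y_n`. -/
abbrev HVec (n c : ℕ) := HIdx n c → ℂ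

/-- The basis vector `e_i`, `1 ≤ i ≤ n` (and `0` for other `i`). -/
def eVec (n c i : ℕ) : HVec n c :=
  if h : 1 ≤ i ∧ i ≤ n then Pi.single (.inl (.inl ⟨i - 1, by omega⟩)) 1 else 0

/-- The basis vector `y_j`, `1 ≤ j ≤ n` (and `0` for other `j`). -/
def yVec (n c j : ℕ) : HVec n c :=
  if h : 1 ≤ j ∧ j ≤ n then Pi.single (.inr ⟨j - 1, by omega⟩) 1 else 0

/-- The span of the basis vectors of parity `i`. -/
def HVec.part (n c : ℕ) (i : ZMod 2) : Submodule ℂ (HVec n c) where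
  carrier := {v | ∀ k : HIdx n c, k.name.parity ≠ i → v k = 0}
  add_mem' hu hv k hk := by simp [hu k hk, hv k hk]
  zero_mem' k _ := rfl
  smul_mem' a v hv k hk := by simp [hv k hk]

theorem HVec.isCompl_part (n c : ℕ) : IsCompl (HVec.part n c 0) (HVec.part n c 1) := by
  constructor
  · rw [Submodule.disjoint_def]
    intro v h0 h1
    funext k
    by_cases hk : k.name.parity = 0
    · exact h1 k (by rw [hk]; decide)
    · exact h0 k hk
  · rw [codisjoint_iff, eq_top_iff]
    intro v _
    refine Submodule.mem_sup.2 ⟨fun k => if k.name.parity = 0 then v k else 0, ?_,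
      fun k => if k.name.parity = 0 then 0 else v k, ?_, ?_⟩
    · intro k hk
      simp [hk]
    · intro k hk
      have h : k.name.parity = 0 := by
        generalize k.name.parity = p at hk
        revert p; decide
      simp [h]
    · funext k
      by_cases hk : k.name.parity = 0 <;> simp [hk]

/-- A multiplication table respecting the parity of the basis vectors. -/
def TableGraded {n c : ℕ} (t : HGen → HGen → HVec n c) : Prop :=
  ∀ g h : HGen, t g h ∈ HVec.part n c (g.parity + h.parity)

/-- The bilinear product with a given multiplication table. -/
noncomputable def tableBracket {n c : ℕ} (t : HGen → HGen → HVec n c) :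
    HVec n c →ₗ[ℂ] HVec n c →ₗ[ℂ] HVec n c :=
  (Pi.basisFun ℂ (HIdx n c)).constr ℂ fun i =>
    (Pi.basisFun ℂ (HIdx n c)).constr ℂ fun j => t i.name j.name

theorem tableBracket_apply {n c : ℕ} (t : HGen → HGen → HVec n c) (u v : HVec n c) :
    tableBracket t u v = ∑ i, ∑ j, (u i * v j) • t i.name j.name := by
  simp [tableBracket, Module.Basis.constr_apply_fintype, Finset.smul_sum, smul_smul]

/-- The superalgebra with a given multiplication table. -/
noncomputable def ofTable {n c : ℕ} (t : HGen → HGen → HVec n c) (ht : TableGraded t) :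
    SuperAlgebra (HVec n c) where
  part := HVec.part n c
  isCompl := HVec.isCompl_part n c
  bracket := tableBracket t
  bracket_mem p q u v hu hv := by
    rw [tableBracket_apply]
    refine Submodule.sum_mem _ fun i _ => Submodule.sum_mem _ fun j _ => ?_
    by_cases hi : i.name.parity = p
    · by_cases hj : j.name.parity = q
      · subst hi hj
        exact Submodule.smul_mem _ _ (ht _ _)
      · simp [hv j hj]
    · simp [hu i hi]

/-- Products among the `e_i`, `y_j`; all products that are not listed are zero. -/
noncomputable def tableH0 (n c : ℕ) : HGen → HGen → HVec n c
  | .e i, .e j =>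
      if i = 1 ∧ j = 1 then eVec n c 3
      else if 3 ≤ i ∧ i + 1 ≤ n ∧ j = 1 then eVec n c (i + 1)
      else 0
  | .y j, .e i => if 1 ≤ j ∧ j + 1 ≤ n ∧ i = 1 then yVec n c (j + 1) else 0
  | .e i, .y j =>
      if i = 1 ∧ j = 1 then (1 / 2 : ℂ) • yVec n c 2
      else if 3 ≤ i ∧ i ≤ n ∧ j = 1 then (1 / 2 : ℂ) • yVec n c i
      else 0
  | .y i, .y j =>
      if i = 1 ∧ j = 1 then eVec n c 1
      else if 2 ≤ i ∧ i + 1 ≤ n ∧ j = 1 then eVec n c (i + 1)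
      else 0
  | _, _ => 0

/-- The products `[v, x]` in which `x` acts diagonally, except for `[e_2, x]`. -/
noncomputable def diagAct (n c : ℕ) : HGen → HVec n c
  | .e i => if i = 1 then (2 : ℂ) • eVec n c 1
      else if 3 ≤ i ∧ i ≤ n then (2 * ((i : ℂ) - 1)) • eVec n c i else 0
  | .y i => if 1 ≤ i ∧ i ≤ n then (2 * (i : ℂ) - 1) • yVec n c i else 0
  | .x _ => 0

/-- The products `[x, v]` that accompany the diagonal action: `[x, e_1] = -2 e_1`,
`[x, y_1] = - y_1`. -/
noncomputable def diagLeft (n c : ℕ) : HGen → HVec n c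
  | .e i => if i = 1 then (-2 : ℂ) • eVec n c 1 else 0
  | .y j => if j = 1 then -yVec n c 1 else 0
  | .x _ => 0

/-- The products `[v, x]` in which `x` acts nilpotently, with parameters `a_2, …, a_n`,
except for `[e_2, x]`. -/
noncomputable def nilAct (n c : ℕ) (a : ℕ → ℂ) : HGen → HVec n c
  | .e i => if i = 1 then ∑ k ∈ Finset.Icc 3 n, a (k - 1) • eVec n c k
      else if 3 ≤ i ∧ i ≤ n then ∑ k ∈ Finset.Icc (i + 1) n, a (k + 1 - i) • eVec n c k
      else 0
  | .y i => if 1 ≤ i ∧ i ≤ n then ∑ k ∈ Finset.Icc (i + 1) n, a (k + 1 - i) • yVec n c k else 0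
  | .x _ => 0

/-- `MH₁`. -/
noncomputable def tableMH1 (n : ℕ) : HGen → HGen → HVec n 2
  | .x 1, g => diagLeft n 2 g
  | .e 2, .x 2 => eVec n 2 2
  | g, .x 1 => diagAct n 2 g
  | g, h => tableH0 n 2 g h

/-- `MH₂`. -/
noncomputable def tableMH2 (n : ℕ) : HGen → HGen → HVec n 2
  | .x 1, g => diagLeft n 2 g
  | .e 2, .x 2 => eVec n 2 2
  | .x 2, .e 2 => -eVec n 2 2
  | g, .x 1 => diagAct n 2 g
  | g, h => tableH0 n 2 g h

/-- `H₁(b)`; here, as in the tables below, `x = x_1`. -/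
noncomputable def tableH1 (n : ℕ) (b : ℂ) : HGen → HGen → HVec n 1
  | .e 2, .x 1 => b • eVec n 1 2
  | .x 1, .e 2 => -b • eVec n 1 2
  | .x 1, g => diagLeft n 1 g
  | g, .x 1 => diagAct n 1 g
  | g, h => tableH0 n 1 g h

/-- `H₂(b)`. -/
noncomputable def tableH2 (n : ℕ) (b : ℂ) : HGen → HGen → HVec n 1
  | .e 2, .x 1 => b • eVec n 1 2
  | .x 1, g => diagLeft n 1 g
  | g, .x 1 => diagAct n 1 g
  | g, h => tableH0 n 1 g h

/-- `H₃`. -/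
noncomputable def tableH3 (n : ℕ) : HGen → HGen → HVec n 1
  | .x 1, .x 1 => eVec n 1 2
  | .x 1, g => diagLeft n 1 g
  | g, .x 1 => diagAct n 1 g
  | g, h => tableH0 n 1 g h

/-- `H₄` with the parameters `a = (a_2, …, a_n)`. -/
noncomputable def tableH4 (n : ℕ) (a : ℕ → ℂ) : HGen → HGen → HVec n 1
  | .e 2, .x 1 => eVec n 1 2
  | g, .x 1 => nilAct n 1 a g
  | g, h => tableH0 n 1 g h

/-- `H₅(γ)` with the parameters `a = (a_2, …, a_n)`. -/
noncomputable def tableH5 (n : ℕ) (γ : ℂ) (a : ℕ → ℂ) : HGen → HGen → HVec n 1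
  | .e 2, .x 1 => eVec n 1 2
  | .x 1, .e 2 => -eVec n 1 2
  | .x 1, .x 1 => γ • eVec n 1 2
  | g, .x 1 => nilAct n 1 a g
  | g, h => tableH0 n 1 g h

theorem eVec_mem (n c i : ℕ) : eVec n c i ∈ HVec.part n c 0 := by
  unfold eVec
  split_ifs
  · rintro ((k | k) | k) hk
    · simp [HIdx.name, HGen.parity] at hk
    · simp [HIdx.name, HGen.parity] at hk
    · simp
  · exact Submodule.zero_mem _

theorem yVec_mem (n c j : ℕ) : yVec n c j ∈ HVec.part n c 1 := by
  unfold yVec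
  split_ifs
  · rintro ((k | k) | k) hk
    · simp
    · simp
    · simp [HIdx.name, HGen.parity] at hk
  · exact Submodule.zero_mem _

theorem one_add_one_zmod : (1 + 1 : ZMod 2) = 0 := by decide

theorem tableH0_graded (n c : ℕ) : TableGraded (tableH0 n c) := by
  rintro (i | i | i) (j | j | j) <;>
    simp only [tableH0, HGen.parity, add_zero, zero_add, one_add_one_zmod, Submodule.zero_mem] <;>
    split_ifs <;>
    first
      | exact Submodule.zero_mem _
      | exact eVec_mem _ _ _
      | exact yVec_mem _ _ _
      | exact Submodule.smul_mem _ _ (yVec_mem _ _ _)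

theorem diagAct_mem (n c : ℕ) (g : HGen) : diagAct n c g ∈ HVec.part n c g.parity := by
  rcases g with i | i | i <;> simp only [diagAct, HGen.parity, Submodule.zero_mem] <;>
    split_ifs <;>
    first
      | exact Submodule.zero_mem _
      | exact Submodule.smul_mem _ _ (eVec_mem _ _ _)
      | exact Submodule.smul_mem _ _ (yVec_mem _ _ _)

theorem diagLeft_mem (n c : ℕ) (g : HGen) : diagLeft n c g ∈ HVec.part n c g.parity := by
  rcases g with i | i | i <;> simp only [diagLeft, HGen.parity, Submodule.zero_mem] <;>
    split_ifs <;>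
    first
      | exact Submodule.zero_mem _
      | exact Submodule.smul_mem _ _ (eVec_mem _ _ _)
      | exact Submodule.neg_mem _ (yVec_mem _ _ _)

theorem nilAct_mem (n c : ℕ) (a : ℕ → ℂ) (g : HGen) :
    nilAct n c a g ∈ HVec.part n c g.parity := by
  rcases g with i | i | i <;> simp only [nilAct, HGen.parity, Submodule.zero_mem] <;>
    split_ifs <;>
    first
      | exact Submodule.zero_mem _
      | exact Submodule.sum_mem _ fun _ _ => Submodule.smul_mem _ _ (eVec_mem _ _ _)
      | exact Submodule.sum_mem _ fun _ _ => Submodule.smul_mem _ _ (yVec_mem _ _ _)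

theorem tableMH1_graded (n : ℕ) : TableGraded (tableMH1 n) := by
  intro g h
  unfold tableMH1
  split
  · simpa [HGen.parity] using diagLeft_mem n 2 h
  · simpa [HGen.parity] using eVec_mem n 2 2
  · simpa [HGen.parity] using diagAct_mem n 2 g
  · exact tableH0_graded n 2 g h

theorem tableMH2_graded (n : ℕ) : TableGraded (tableMH2 n) := by
  intro g h
  unfold tableMH2
  split
  · simpa [HGen.parity] using diagLeft_mem n 2 h
  · simpa [HGen.parity] using eVec_mem n 2 2
  · simpa [HGen.parity] using eVec_mem n 2 2
  · simpa [HGen.parity] using diagAct_mem n 2 g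
  · exact tableH0_graded n 2 g h

theorem tableH1_graded (n : ℕ) (b : ℂ) : TableGraded (tableH1 n b) := by
  intro g h
  unfold tableH1
  split
  · simpa [HGen.parity] using Submodule.smul_mem _ b (eVec_mem n 1 2)
  · simpa [HGen.parity] using Submodule.smul_mem _ b (eVec_mem n 1 2)
  · simpa [HGen.parity] using diagLeft_mem n 1 h
  · simpa [HGen.parity] using diagAct_mem n 1 g
  · exact tableH0_graded n 1 g h

theorem tableH2_graded (n : ℕ) (b : ℂ) : TableGraded (tableH2 n b) := by
  intro g h
  unfold tableH2
  split
  · simpa [HGen.parity] using Submodule.smul_mem _ b (eVec_mem n 1 2)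
  · simpa [HGen.parity] using diagLeft_mem n 1 h
  · simpa [HGen.parity] using diagAct_mem n 1 g
  · exact tableH0_graded n 1 g h

theorem tableH3_graded (n : ℕ) : TableGraded (tableH3 n) := by
  intro g h
  unfold tableH3
  split
  · simpa [HGen.parity] using eVec_mem n 1 2
  · simpa [HGen.parity] using diagLeft_mem n 1 h
  · simpa [HGen.parity] using diagAct_mem n 1 g
  · exact tableH0_graded n 1 g h

theorem tableH4_graded (n : ℕ) (a : ℕ → ℂ) : TableGraded (tableH4 n a) := by
  intro g h
  unfold tableH4
  split
  · simpa [HGen.parity] using eVec_mem n 1 2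
  · simpa [HGen.parity] using nilAct_mem n 1 a g
  · exact tableH0_graded n 1 g h

theorem tableH5_graded (n : ℕ) (γ : ℂ) (a : ℕ → ℂ) : TableGraded (tableH5 n γ a) := by
  intro g h
  unfold tableH5
  split
  · simpa [HGen.parity] using eVec_mem n 1 2
  · simpa [HGen.parity] using eVec_mem n 1 2
  · simpa [HGen.parity] using Submodule.smul_mem _ γ (eVec_mem n 1 2)
  · simpa [HGen.parity] using nilAct_mem n 1 a g
  · exact tableH0_graded n 1 g h

/-- The split nilpotent superalgebra `H(0, …, 0)` with basis `e_1, …, e_n, y_1, …, y_n`. -/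
noncomputable def algH0 (n : ℕ) : SuperAlgebra (HVec n 0) := ofTable _ (tableH0_graded n 0)

/-- The members of the list. -/
inductive HLabel where
  | MH1
  | MH2
  | H1 (b : ℂ)
  | H2 (b : ℂ)
  | H3
  | H4 (a : ℕ → ℂ)
  | H5 (γ : ℂ) (a : ℕ → ℂ)

namespace HLabel

/-- The number of the additional basis vectors `x_k`. -/
def codim : HLabel → ℕ
  | MH1 => 2
  | MH2 => 2
  | _ => 1

/-- The superalgebra with a given label. -/
noncomputable def alg (n : ℕ) : (l : HLabel) → SuperAlgebra (HVec n l.codim)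
  | MH1 => ofTable _ (tableMH1_graded n)
  | MH2 => ofTable _ (tableMH2_graded n)
  | H1 b => ofTable _ (tableH1_graded n b)
  | H2 b => ofTable _ (tableH2_graded n b)
  | H3 => ofTable _ (tableH3_graded n)
  | H4 a => ofTable _ (tableH4_graded n a)
  | H5 γ a => ofTable _ (tableH5_graded n γ a)

/-- The restrictions on the parameters: `b ≠ 0` in `H₁(b)`, and `γ ∈ {0, 1}` in `H₅(γ)`. -/
def Admissible : HLabel → Prop
  | H1 b => b ≠ 0
  | H5 γ _ => γ = 0 ∨ γ = 1
  | _ => True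

/-- The first non-vanishing parameter among `a_2, …, a_n` (if there is one) is `1`. -/
def FirstIsOne (n : ℕ) (a : ℕ → ℂ) : Prop :=
  ∀ k, 2 ≤ k → k ≤ n → a k ≠ 0 → (∀ j, 2 ≤ j → j < k → a j = 0) → a k = 1

/-- In `H₄` and `H₅(γ)` the first non-vanishing parameter is `1`. -/
def Normalized (n : ℕ) : HLabel → Prop
  | H4 a => FirstIsOne n a
  | H5 _ a => FirstIsOne n a
  | _ => True

/-- `a'` arises from `a` by the scaling `a'_k = t^(k-1) a_k`, `2 ≤ k ≤ n`, with some `t ≠ 0`. -/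
def Rescaled (n : ℕ) (a a' : ℕ → ℂ) : Prop :=
  ∃ t : ℂ, t ≠ 0 ∧ ∀ k, 2 ≤ k → k ≤ n → a' k = t ^ (k - 1) * a k

/-- Two labels are the same, up to a scaling of the parameters `a_2, …, a_n`
in the families `H₄` and `H₅(γ)`. -/
def Same (n : ℕ) : HLabel → HLabel → Prop
  | MH1, MH1 => True
  | MH2, MH2 => True
  | H1 b, H1 b' => b = b'
  | H2 b, H2 b' => b = b'
  | H3, H3 => True
  | H4 a, H4 a' => Rescaled n a a'
  | H5 γ a, H5 γ' a' => γ = γ' ∧ Rescaled n a a'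
  | _, _ => False

end HLabel

/-! Write R_v for the right multiplication by v. Up to powers of ½, H is the direct sum of a chain
f_0 = y_1, f_{k+1} = [f_k, f_0] of length 2n - 1 and the line spanned by g = e_2. In any Leibniz
superalgebra L with nilradical N ≅ H, the identity forces R_{f_1} = 2 R_{f_0}² and R_{f_j} = 0 for j
≥ 2 on all of L (`bracket_f_one`, `bracket_f_ge`), so an extension is governed by the action of a
few even vectors on f_0 and g.

For even x, the products [f_0, x] = α f_0 + Σ a_j f_{2j} propagate along the chain to [f_k, x] =
(k+1)α f_k + Σ a_j f_{k+2j}, while [g, x] = β g and [x, g] = δ g. Maximality puts into N every odd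
element and every even element with α = β = 0 (`mem_of_homogeneous`), so (α, β) embeds L/N into ℂ².
If some α is non-zero, an odd eigenvector of R_x serves as new generator of the chain; this removes
a and makes x diagonal (`exists_diagonal`). If all α vanish, a shift by N gives [x, f_0] = 0
(`exists_shift`) and a survives. What remains is [x_i, x_j] = ε_ij g, subject to δ_l(δ_i + β_i) = 0
and `ε_identity`, in particular ε_ii δ_i = 0. Adding multiples of g to the x_i, or scaling g
(`shift`, `rescale`), leaves exactly the list.

Conversely these relations, together with α_i a_lj = 0, imply the superidentity (`isLeibniz`), and
the weights α, β show that no larger ideal is nilpotent. For H_5(1) one has ε δ = -1.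

For uniqueness, two chain bases of one algebra are compared. An odd element acts from the right
through its f_0-coordinate, so R_{f'_0} = p R_{f_0} with p ≠ 0. Then α is a linear form in the
x-coordinates, β and δ are too once g' is a multiple of g, and a_j = p^{2j} a'_j (`compare_one`).
The structure constant a_j is 2^j times the parameter a_{j+1}, so this is the scaling by t^{k-1}
with t = p^{-2}; square roots in ℂ give the converse. -/

/-! ### Chain bases and their coordinates -/

/-- The structure constants of an extension of the null-filiform superalgebra by vectors `x_i`
with weights `α_i`, `β_i`, `δ_i`, `ε_ij` and nilpotent parts `a_i`. -/
structure ChainParams (c : ℕ) where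
  α : Fin c → ℂ
  β : Fin c → ℂ
  δ : Fin c → ℂ
  ε : Fin c → Fin c → ℂ
  a : Fin c → ℕ → ℂ

/-- Of the 2n - 1 chain vectors n are odd and n - 1 even; the extra place is for g. -/
def chainFamily {L : Type*} (n : ℕ) {c : ℕ} (f : ℕ → L) (g : L) (x : Fin c → L) :
    (Fin (2 * n - 1) ⊕ Unit) ⊕ Fin c → L :=
  Sum.elim (Sum.elim (fun k => f k) (fun _ => g)) x

/-- The submodule `M` has the basis `f_0, …, f_{2n-2}, g, x_i`, where `f_{k+1} = [f_k, f_0]`, and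
the products of basis vectors are given by the structure constants `P`. -/
structure HasChain {L : Type*} [AddCommGroup L] [Module ℂ L] (S : SuperAlgebra L) (n : ℕ) {c : ℕ}
    (P : ChainParams c) (M : Submodule ℂ L) (f : ℕ → L) (g : L) (x : Fin c → L) : Prop where
  li : LinearIndependent ℂ (chainFamily n f g x)
  span_eq : Submodule.span ℂ (Set.range (chainFamily n f g x)) = M
  f_zero : ∀ k, 2 * n - 1 ≤ k → f k = 0
  f_odd : ∀ j, f (2 * j) ∈ S.part 1
  f_even : ∀ j, f (2 * j + 1) ∈ S.part 0
  g_mem : g ∈ S.part 0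
  x_mem : ∀ i, x i ∈ S.part 0
  f_f : ∀ k, S.bracket (f k) (f 0) = f (k + 1)
  g_f : S.bracket g (f 0) = 0
  x_f : ∀ i, S.bracket (x i) (f 0) = -P.α i • f 0
  -- Since f_1 = [f_0, f_0] with f_0 odd, the superidentity forces this and the next field.
  f_one : ∀ v ∈ M, S.bracket v (f 1) = (2 : ℂ) • S.bracket (S.bracket v (f 0)) (f 0)
  f_ge : ∀ v ∈ M, ∀ j, 2 ≤ j → S.bracket v (f j) = 0
  f_g : ∀ k, S.bracket (f k) g = 0
  g_g : S.bracket g g = 0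
  x_g : ∀ i, S.bracket (x i) g = P.δ i • g
  -- The factor k + 1 counts the copies of f_0 in f_k; only shifts by 2j occur because x_i is even.
  f_x : ∀ k i, S.bracket (f k) (x i) =
    ((k + 1) * P.α i) • f k + ∑ j ∈ Finset.Icc 1 (n - 1), P.a i j • f (k + 2 * j)
  g_x : ∀ i, S.bracket g (x i) = P.β i • g
  x_x : ∀ i j, S.bracket (x i) (x j) = P.ε i j • g

namespace HasChain

variable {L : Type*} [AddCommGroup L] [Module ℂ L] {S : SuperAlgebra L} {n c : ℕ}
  {P : ChainParams c} {M : Submodule ℂ L} {f : ℕ → L} {g : L} {x : Fin c → L}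

theorem family_mem (h : HasChain S n P M f g x) (i) : chainFamily n f g x i ∈ M := by
  rw [← h.span_eq]; exact Submodule.subset_span ⟨i, rfl⟩

theorem f_mem (h : HasChain S n P M f g x) (k : ℕ) : f k ∈ M := by
  by_cases hk : k < 2 * n - 1
  · exact h.family_mem (.inl (.inl ⟨k, hk⟩))
  · rw [h.f_zero k (by omega)]; exact M.zero_mem

theorem g_mem' (h : HasChain S n P M f g x) : g ∈ M := h.family_mem (.inl (.inr ()))

theorem x_mem' (h : HasChain S n P M f g x) (i : Fin c) : x i ∈ M := h.family_mem (.inr i)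

/-- Coordinates with respect to the chain basis, extended to the whole space. -/
noncomputable def coord (h : HasChain S n P M f g x) (i : (Fin (2 * n - 1) ⊕ Unit) ⊕ Fin c) :
    L →ₗ[ℂ] ℂ :=
  -- Only the values on M are meaningful. A form on all of L can be composed with the bracket.
  ((Finsupp.lapply i ∘ₗ h.li.repr : _ →ₗ[ℂ] ℂ).exists_extend).choose

theorem coord_family (h : HasChain S n P M f g x) (i j) :
    h.coord i (chainFamily n f g x j) = if j = i then 1 else 0 := by
  have h1 := ((Finsupp.lapply i ∘ₗ h.li.repr : _ →ₗ[ℂ] ℂ).exists_extend).choose_spec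
  have h2 := LinearMap.congr_fun h1 ⟨chainFamily n f g x j, Submodule.subset_span ⟨j, rfl⟩⟩
  have h3 := h.li.repr_eq_single j ⟨chainFamily n f g x j, Submodule.subset_span ⟨j, rfl⟩⟩ rfl
  simp only [LinearMap.comp_apply, Submodule.subtype_apply] at h2
  refine h2.trans ?_
  change (h.li.repr _) i = _
  rw [h3, Finsupp.single_apply]

/-- The value 0 for k out of range matches f_k = 0 there. -/
noncomputable def cf (h : HasChain S n P M f g x) (k : ℕ) : L →ₗ[ℂ] ℂ :=
  if hk : k < 2 * n - 1 then h.coord (.inl (.inl ⟨k, hk⟩)) else 0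

noncomputable def cg (h : HasChain S n P M f g x) : L →ₗ[ℂ] ℂ := h.coord (.inl (.inr ()))

noncomputable def cx (h : HasChain S n P M f g x) (i : Fin c) : L →ₗ[ℂ] ℂ := h.coord (.inr i)

@[simp] theorem cf_f (h : HasChain S n P M f g x) (i j : ℕ) :
    h.cf i (f j) = if j = i ∧ i < 2 * n - 1 then 1 else 0 := by
  by_cases hj : j < 2 * n - 1
  · by_cases hi : i < 2 * n - 1
    · have := h.coord_family (.inl (.inl ⟨i, hi⟩)) (.inl (.inl ⟨j, hj⟩))
      simp only [cf, hi, dif_pos, and_true]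
      refine this.trans ?_
      simp
    · simp [cf, hi]
  · rw [h.f_zero j (by omega), map_zero, if_neg (by omega)]

@[simp] theorem cf_g (h : HasChain S n P M f g x) (i : ℕ) : h.cf i g = 0 := by
  by_cases hi : i < 2 * n - 1
  · have := h.coord_family (.inl (.inl ⟨i, hi⟩)) (.inl (.inr ()))
    simp only [cf, hi, dif_pos]
    refine this.trans ?_
    simp
  · simp [cf, hi]

@[simp] theorem cf_x (h : HasChain S n P M f g x) (i : ℕ) (l : Fin c) : h.cf i (x l) = 0 := by
  by_cases hi : i < 2 * n - 1
  · have := h.coord_family (.inl (.inl ⟨i, hi⟩)) (.inr l)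
    simp only [cf, hi, dif_pos]
    refine this.trans ?_
    simp
  · simp [cf, hi]

@[simp] theorem cg_f (h : HasChain S n P M f g x) (j : ℕ) : h.cg (f j) = 0 := by
  by_cases hj : j < 2 * n - 1
  · exact (h.coord_family (.inl (.inr ())) (.inl (.inl ⟨j, hj⟩))).trans (by simp)
  · rw [h.f_zero j (by omega), map_zero]

@[simp] theorem cg_g (h : HasChain S n P M f g x) : h.cg g = 1 :=
  (h.coord_family (.inl (.inr ())) (.inl (.inr ()))).trans (by simp)

@[simp] theorem cg_x (h : HasChain S n P M f g x) (l : Fin c) : h.cg (x l) = 0 :=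
  (h.coord_family (.inl (.inr ())) (.inr l)).trans (by simp)

@[simp] theorem cx_f (h : HasChain S n P M f g x) (i : Fin c) (j : ℕ) : h.cx i (f j) = 0 := by
  by_cases hj : j < 2 * n - 1
  · exact (h.coord_family (.inr i) (.inl (.inl ⟨j, hj⟩))).trans (by simp)
  · rw [h.f_zero j (by omega), map_zero]

@[simp] theorem cx_g (h : HasChain S n P M f g x) (i : Fin c) : h.cx i g = 0 :=
  (h.coord_family (.inr i) (.inl (.inr ()))).trans (by simp)

@[simp] theorem cx_x (h : HasChain S n P M f g x) (i l : Fin c) :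
    h.cx i (x l) = if l = i then 1 else 0 :=
  (h.coord_family (.inr i) (.inr l)).trans (by simp)

/-- Linear maps which agree on the basis vectors agree on `M`. -/
theorem eqOn {V : Type*} [AddCommGroup V] [Module ℂ V] (h : HasChain S n P M f g x)
    {p q : L →ₗ[ℂ] V} (hf : ∀ k, k < 2 * n - 1 → p (f k) = q (f k)) (hg : p g = q g)
    (hx : ∀ i, p (x i) = q (x i)) {v : L} (hv : v ∈ M) : p v = q v := by
  rw [← h.span_eq] at hv
  refine LinearMap.eqOn_span' (f := p) (g := q) ?_ hv
  rintro _ ⟨(i | i) | i, rfl⟩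
  · exact hf i i.2
  · exact hg
  · exact hx i

/-- A submodule containing the basis vectors contains `M`. -/
theorem le_of_mem (h : HasChain S n P M f g x) {W : Submodule ℂ L}
    (hf : ∀ k, f k ∈ W) (hg : g ∈ W) (hx : ∀ i, x i ∈ W) : M ≤ W := by
  rw [← h.span_eq, Submodule.span_le]
  rintro _ ⟨(i | i) | i, rfl⟩
  · exact hf i
  · exact hg
  · exact hx i

theorem expand (h : HasChain S n P M f g x) {v : L} (hv : v ∈ M) :
    v = ∑ k ∈ Finset.range (2 * n - 1), h.cf k v • f k + h.cg v • g + ∑ i, h.cx i v • x i := by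
  have := h.eqOn (p := LinearMap.id)
    (q := ∑ k ∈ Finset.range (2 * n - 1), (h.cf k).smulRight (f k) + h.cg.smulRight g +
      ∑ i, (h.cx i).smulRight (x i)) ?_ ?_ ?_ hv
  · simpa [LinearMap.sum_apply] using this
  · intro k hk
    simp only [LinearMap.add_apply, LinearMap.sum_apply, LinearMap.smulRight_apply, LinearMap.id_apply,
      cf_f, cg_f, cx_f, zero_smul, Finset.sum_const_zero, add_zero]
    rw [Finset.sum_eq_single k]
    · simp [hk]
    · intro b _ hb; simp [hb.symm]
    · intro hk'; simp at hk'; omega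
  · simp [LinearMap.sum_apply]
  · intro i; simp [LinearMap.sum_apply]

end HasChain

/-! ### Parity and isomorphisms -/

theorem ZMod.two_cases (i : ZMod 2) : i = 0 ∨ i = 1 := by
  revert i; decide

namespace SuperAlgebra

variable {L : Type*} [AddCommGroup L] [Module ℂ L] {L' : Type*} [AddCommGroup L'] [Module ℂ L']
  {L'' : Type*} [AddCommGroup L''] [Module ℂ L'']
  {S : SuperAlgebra L} {S' : SuperAlgebra L'} {S'' : SuperAlgebra L''}

theorem Iso.symm (h : S.Iso S') : S'.Iso S := by
  obtain ⟨φ, h1, h2⟩ := h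
  refine ⟨φ.symm, fun i x => ?_, fun x y => ?_⟩
  · rw [h1, φ.apply_symm_apply]
  · apply φ.injective
    rw [h2]; simp

theorem Iso.trans (h : S.Iso S') (h' : S'.Iso S'') : S.Iso S'' := by
  obtain ⟨φ, h1, h2⟩ := h
  obtain ⟨ψ, h3, h4⟩ := h'
  exact ⟨φ.trans ψ, fun i x => (h1 i x).trans (h3 i _), fun x y => by simp [h2, h4]⟩

theorem eq_zero_of_mem_part (S : SuperAlgebra L) {v : L} (h0 : v ∈ S.part 0) (h1 : v ∈ S.part 1) :
    v = 0 :=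
  (Submodule.disjoint_def.1 S.isCompl.disjoint) v h0 h1

theorem exists_parts (S : SuperAlgebra L) (v : L) : ∃ a ∈ S.part 0, ∃ b ∈ S.part 1, a + b = v :=
  Submodule.mem_sup.1 (S.isCompl.sup_eq_top.symm ▸ Submodule.mem_top)

theorem bracket_even_even (S : SuperAlgebra L) {u v : L} (hu : u ∈ S.part 0) (hv : v ∈ S.part 0) :
    S.bracket u v ∈ S.part 0 := by simpa using S.bracket_mem 0 0 u v hu hv

theorem bracket_even_odd (S : SuperAlgebra L) {u v : L} (hu : u ∈ S.part 0) (hv : v ∈ S.part 1) :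
    S.bracket u v ∈ S.part 1 := by simpa using S.bracket_mem 0 1 u v hu hv

theorem bracket_odd_even (S : SuperAlgebra L) {u v : L} (hu : u ∈ S.part 1) (hv : v ∈ S.part 0) :
    S.bracket u v ∈ S.part 1 := by simpa using S.bracket_mem 1 0 u v hu hv

theorem bracket_odd_odd (S : SuperAlgebra L) {u v : L} (hu : u ∈ S.part 1) (hv : v ∈ S.part 1) :
    S.bracket u v ∈ S.part 0 := by
  have := S.bracket_mem 1 1 u v hu hv
  rwa [one_add_one_zmod] at this

@[simp] theorem coe_ofIdeal_bracket (S : SuperAlgebra L) (N : S.GradedIdeal) (u v : N.carrier) :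
    (((S.ofIdeal N).bracket u v : N.carrier) : L) = S.bracket u v := rfl

end SuperAlgebra

namespace HasChain

variable {L : Type*} [AddCommGroup L] [Module ℂ L] {S : SuperAlgebra L} {n c : ℕ}
  {P : ChainParams c} {M : Submodule ℂ L} {f : ℕ → L} {g : L} {x : Fin c → L}
  {L' : Type*} [AddCommGroup L'] [Module ℂ L'] {S' : SuperAlgebra L'}
  {f' : ℕ → L'} {g' : L'} {x' : Fin c → L'}

theorem span_even_le (h : HasChain S n P M f g x) :
    Submodule.span ℂ (insert g (Set.range (fun j => f (2 * j + 1)) ∪ Set.range x)) ≤ S.part 0 := by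
  rw [Submodule.span_le]
  rintro _ (rfl | ⟨j, rfl⟩ | ⟨j, rfl⟩)
  · exact h.g_mem
  · exact h.f_even j
  · exact h.x_mem j

theorem span_odd_le (h : HasChain S n P M f g x) :
    Submodule.span ℂ (Set.range (fun j => f (2 * j))) ≤ S.part 1 := by
  rw [Submodule.span_le]
  rintro _ ⟨j, rfl⟩
  exact h.f_odd j

theorem le_span_even_sup_span_odd (h : HasChain S n P M f g x) :
    M ≤ Submodule.span ℂ (insert g (Set.range (fun j => f (2 * j + 1)) ∪ Set.range x)) ⊔
      Submodule.span ℂ (Set.range (fun j => f (2 * j))) := by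
  refine h.le_of_mem (fun k => ?_) ?_ (fun i => ?_)
  · rcases Nat.even_or_odd' k with ⟨j, rfl | rfl⟩
    · exact Submodule.mem_sup_right (Submodule.subset_span ⟨j, rfl⟩)
    · exact Submodule.mem_sup_left (Submodule.subset_span (.inr (.inl ⟨j, rfl⟩)))
  · exact Submodule.mem_sup_left (Submodule.subset_span (.inl rfl))
  · exact Submodule.mem_sup_left (Submodule.subset_span (.inr (.inr ⟨i, rfl⟩)))

/-- Split v along the two spans. The odd summand is v minus an even vector, hence even as well as
odd, hence zero. -/
theorem mem_span_even (h : HasChain S n P M f g x) {v : L} (hv : v ∈ M) (h0 : v ∈ S.part 0) :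
    v ∈ Submodule.span ℂ (insert g (Set.range (fun j => f (2 * j + 1)) ∪ Set.range x)) := by
  obtain ⟨a, ha, b, hb, rfl⟩ := Submodule.mem_sup.1 (h.le_span_even_sup_span_odd hv)
  have : b = 0 := by
    refine S.eq_zero_of_mem_part ?_ (h.span_odd_le hb)
    simpa using (S.part 0).sub_mem h0 (h.span_even_le ha)
  simpa [this] using ha

theorem mem_span_odd (h : HasChain S n P M f g x) {v : L} (hv : v ∈ M) (h1 : v ∈ S.part 1) :
    v ∈ Submodule.span ℂ (Set.range (fun j => f (2 * j))) := by
  obtain ⟨a, ha, b, hb, rfl⟩ := Submodule.mem_sup.1 (h.le_span_even_sup_span_odd hv)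
  have : a = 0 := by
    refine S.eq_zero_of_mem_part (h.span_even_le ha) ?_
    simpa using (S.part 1).sub_mem h1 (h.span_odd_le hb)
  simpa [this] using hb

/-- Linear maps which agree on the even basis vectors agree on the even part. -/
theorem eqOn_even {V : Type*} [AddCommGroup V] [Module ℂ V] (h : HasChain S n P M f g x)
    {p q : L →ₗ[ℂ] V} (hf : ∀ j, p (f (2 * j + 1)) = q (f (2 * j + 1))) (hg : p g = q g)
    (hx : ∀ i, p (x i) = q (x i)) {v : L} (hv : v ∈ M) (h0 : v ∈ S.part 0) : p v = q v := by
  refine LinearMap.eqOn_span' (f := p) (g := q) ?_ (h.mem_span_even hv h0)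
  rintro _ (rfl | ⟨j, rfl⟩ | ⟨j, rfl⟩)
  · exact hg
  · exact hf j
  · exact hx j

/-- Linear maps which agree on the odd basis vectors agree on the odd part. -/
theorem eqOn_odd {V : Type*} [AddCommGroup V] [Module ℂ V] (h : HasChain S n P M f g x)
    {p q : L →ₗ[ℂ] V} (hf : ∀ j, p (f (2 * j)) = q (f (2 * j))) {v : L} (hv : v ∈ M)
    (h1 : v ∈ S.part 1) : p v = q v := by
  refine LinearMap.eqOn_span' (f := p) (g := q) ?_ (h.mem_span_odd hv h1)
  rintro _ ⟨j, rfl⟩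
  exact hf j

theorem cx_of_odd (h : HasChain S n P M f g x) {v : L} (hv : v ∈ M) (h1 : v ∈ S.part 1)
    (i : Fin c) : h.cx i v = 0 :=
  h.eqOn_odd (p := h.cx i) (q := 0) (fun i => by simp) hv h1

theorem expand_even (h : HasChain S n P M f g x) {v : L} (hv : v ∈ M) (h0 : v ∈ S.part 0) :
    v = ∑ j ∈ Finset.range (n - 1), h.cf (2 * j + 1) v • f (2 * j + 1) + h.cg v • g +
      ∑ i, h.cx i v • x i := by
  have := h.eqOn_even (p := LinearMap.id)
    (q := ∑ j ∈ Finset.range (n - 1), (h.cf (2 * j + 1)).smulRight (f (2 * j + 1)) +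
      h.cg.smulRight g + ∑ i, (h.cx i).smulRight (x i)) ?_ ?_ ?_ hv h0
  · simpa [LinearMap.sum_apply] using this
  · intro k
    simp only [LinearMap.add_apply, LinearMap.sum_apply, LinearMap.smulRight_apply, LinearMap.id_apply,
      cf_f, cg_f, cx_f, zero_smul, Finset.sum_const_zero, add_zero]
    by_cases hk : k < n - 1
    · rw [Finset.sum_eq_single k]
      · rw [if_pos (by omega), one_smul]
      · intro b _ hb; rw [if_neg (by omega), zero_smul]
      · intro hk'; simp at hk'; omega
    · rw [h.f_zero _ (by omega), Finset.sum_eq_zero]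
      intro b hb
      rw [Finset.mem_range] at hb
      rw [if_neg (by omega), zero_smul]
  · simp [LinearMap.sum_apply]
  · intro i; simp [LinearMap.sum_apply]

theorem expand_odd (h : HasChain S n P M f g x) {v : L} (hv : v ∈ M) (h1 : v ∈ S.part 1) :
    v = ∑ j ∈ Finset.range n, h.cf (2 * j) v • f (2 * j) := by
  have := h.eqOn_odd (p := LinearMap.id)
    (q := ∑ j ∈ Finset.range n, (h.cf (2 * j)).smulRight (f (2 * j))) ?_ hv h1
  · simpa [LinearMap.sum_apply] using this
  · intro k
    simp only [LinearMap.sum_apply, LinearMap.smulRight_apply, LinearMap.id_apply, cf_f]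
    by_cases hk : k < n
    · rw [Finset.sum_eq_single k]
      · rw [if_pos (by omega), one_smul]
      · intro b _ hb; rw [if_neg (by omega), zero_smul]
      · intro hk'; simp at hk'; omega
    · rw [h.f_zero _ (by omega), Finset.sum_eq_zero]
      intro b hb
      rw [Finset.mem_range] at hb
      rw [if_neg (by omega), zero_smul]

/-- The image of a chain basis under an injective homomorphism. -/
theorem map (h : HasChain S n P M f g x) (φ : L →ₗ[ℂ] L') (hφ : Function.Injective φ)
    (hp : ∀ i v, v ∈ S.part i → φ v ∈ S'.part i)
    (hb : ∀ u v, φ (S.bracket u v) = S'.bracket (φ u) (φ v)) :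
    HasChain S' n P (M.map φ) (fun k => φ (f k)) (φ g) (fun i => φ (x i)) := by
  have hc : chainFamily n (fun k => φ (f k)) (φ g) (fun i => φ (x i)) =
      φ ∘ chainFamily n f g x := by
    funext i
    rcases i with (i | i) | i <;> rfl
  constructor
  · rw [hc]; exact h.li.map' φ (LinearMap.ker_eq_bot.2 hφ)
  · rw [hc, Set.range_comp, Submodule.span_image, h.span_eq]
  · intro k hk; simp [h.f_zero k hk]
  · exact fun j => hp _ _ (h.f_odd j)
  · exact fun j => hp _ _ (h.f_even j)
  · exact hp _ _ h.g_mem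
  · exact fun j => hp _ _ (h.x_mem j)
  · intro k; rw [← hb, h.f_f]
  · rw [← hb, h.g_f, map_zero]
  · intro i; rw [← hb, h.x_f, map_smul]
  · rintro _ ⟨v, hv, rfl⟩
    rw [← hb, h.f_one v hv, map_smul, hb, hb]
  · rintro _ ⟨v, hv, rfl⟩ j hj
    rw [← hb, h.f_ge v hv j hj, map_zero]
  · intro k; rw [← hb, h.f_g, map_zero]
  · rw [← hb, h.g_g, map_zero]
  · intro i; rw [← hb, h.x_g, map_smul]
  · intro k i; rw [← hb, h.f_x]; simp
  · intro i; rw [← hb, h.g_x, map_smul]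
  · intro i j; rw [← hb, h.x_x, map_smul]

/-- Turns a question about isomorphism into the comparison of two chain bases of a single algebra,
its own and the transported one. -/
theorem exists_of_iso (h : HasChain S n P ⊤ f g x) (e : S.Iso S') :
    ∃ f' g' x', HasChain S' n P ⊤ f' g' x' := by
  obtain ⟨φ, h1, h2⟩ := e
  have := h.map (S' := S') (φ : L →ₗ[ℂ] L') φ.injective (fun i v => (h1 i v).1) h2
  rw [Submodule.map_top, LinearEquiv.range] at this
  exact ⟨_, _, _, this⟩

/-- A homomorphism of superalgebras generated by the images of a chain basis. -/
theorem bracket_map (h : HasChain S n P ⊤ f g x) (h' : HasChain S' n P ⊤ f' g' x')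
    (φ : L →ₗ[ℂ] L') (hf : ∀ k, φ (f k) = f' k) (hg : φ g = g') (hx : ∀ i, φ (x i) = x' i)
    (u v : L) : φ (S.bracket u v) = S'.bracket (φ u) (φ v) := by
  -- R_{f_0} comes first because `f_one` expresses R_{f_1} through it.
  have h0 : ∀ u, φ (S.bracket u (f 0)) = S'.bracket (φ u) (f' 0) := by
    intro u
    refine h.eqOn (p := φ ∘ₗ S.bracket.flip (f 0)) (q := S'.bracket.flip (f' 0) ∘ₗ φ)
      (fun k _ => ?_) ?_ (fun i => ?_) (Submodule.mem_top (x := u))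
    · simp [h.f_f, h'.f_f, hf]
    · simp [h.g_f, h'.g_f, hg]
    · simp [h.x_f, h'.x_f, hf, hx]
  refine h.eqOn (p := φ ∘ₗ S.bracket u) (q := S'.bracket (φ u) ∘ₗ φ)
      (fun k _ => ?_) ?_ (fun i => ?_) (Submodule.mem_top (x := v))
  · simp only [LinearMap.comp_apply, hf]
    rcases k with _ | _ | k
    · exact h0 u
    · simp [h.f_one u Submodule.mem_top, h'.f_one (φ u) Submodule.mem_top, h0]
    · rw [h.f_ge u Submodule.mem_top _ (by omega), h'.f_ge (φ u) Submodule.mem_top _ (by omega),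
        map_zero]
  · refine h.eqOn (p := φ ∘ₗ S.bracket.flip g) (q := S'.bracket.flip (φ g) ∘ₗ φ)
      (fun k _ => ?_) ?_ (fun i => ?_) (Submodule.mem_top (x := u))
    · simp [h.f_g, h'.f_g, hf, hg]
    · simp [h.g_g, h'.g_g, hg]
    · simp [h.x_g, h'.x_g, hg, hx]
  · refine h.eqOn (p := φ ∘ₗ S.bracket.flip (x i)) (q := S'.bracket.flip (φ (x i)) ∘ₗ φ)
      (fun k _ => ?_) ?_ (fun j => ?_) (Submodule.mem_top (x := u))
    · simp [h.f_x, h'.f_x, hf, hx]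
    · simp [h.g_x, h'.g_x, hg, hx]
    · simp [h.x_x, h'.x_x, hg, hx]

theorem part_map (h : HasChain S n P ⊤ f g x) (h' : HasChain S' n P ⊤ f' g' x')
    (φ : L →ₗ[ℂ] L') (hf : ∀ k, φ (f k) = f' k) (hg : φ g = g') (hx : ∀ i, φ (x i) = x' i)
    (i : ZMod 2) (v : L) (hv : v ∈ S.part i) : φ v ∈ S'.part i := by
  rcases ZMod.two_cases i with rfl | rfl
  · rw [h.expand_even Submodule.mem_top hv]
    simp only [map_add, map_sum, map_smul, hf, hg, hx]
    refine add_mem (add_mem (sum_mem fun j _ => ?_) ?_) (sum_mem fun j _ => ?_)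
    · exact Submodule.smul_mem _ _ (h'.f_even j)
    · exact Submodule.smul_mem _ _ h'.g_mem
    · exact Submodule.smul_mem _ _ (h'.x_mem j)
  · rw [h.expand_odd Submodule.mem_top hv]
    simp only [map_sum, map_smul, hf]
    exact sum_mem fun j _ => Submodule.smul_mem _ _ (h'.f_odd j)

/-- Superalgebras with chain bases with the same structure constants are isomorphic. -/
theorem iso (h : HasChain S n P ⊤ f g x) (h' : HasChain S' n P ⊤ f' g' x') : S.Iso S' := by
  let b := Module.Basis.mk h.li h.span_eq.ge
  let b' := Module.Basis.mk h'.li h'.span_eq.ge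
  let φ := b.equiv b' (Equiv.refl _)
  have hb : ∀ i, b i = chainFamily n f g x i := fun i => Module.Basis.mk_apply _ _ i
  have hb' : ∀ i, b' i = chainFamily n f' g' x' i := fun i => Module.Basis.mk_apply _ _ i
  have hφ : ∀ i, φ (chainFamily n f g x i) = chainFamily n f' g' x' i := by
    intro i
    rw [← hb, ← hb']
    exact b.equiv_apply i b' (Equiv.refl _)
  have hf : ∀ k, φ (f k) = f' k := by
    intro k
    by_cases hk : k < 2 * n - 1
    · exact hφ (.inl (.inl ⟨k, hk⟩))
    · rw [h.f_zero k (by omega), h'.f_zero k (by omega), map_zero]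
  have hg : φ g = g' := hφ (.inl (.inr ()))
  have hx : ∀ i, φ (x i) = x' i := fun i => hφ (.inr i)
  refine ⟨φ, fun i v => ⟨h.part_map h' φ hf hg hx i v, fun hv => ?_⟩,
    h.bracket_map h' φ hf hg hx⟩
  have := h'.part_map h (φ.symm : L' →ₗ[ℂ] L) (fun k => by simp [← hf]) (by simp [← hg])
    (fun k => by simp [← hx]) i _ hv
  simpa using this

/-- The basis vectors of a graded ideal, regarded as elements of the ideal. -/
theorem toIdeal {N : S.GradedIdeal} (h : HasChain S n P N.carrier f g x) :
    HasChain (S.ofIdeal N) n P ⊤ (fun k => ⟨f k, h.f_mem k⟩) ⟨g, h.g_mem'⟩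
      (fun i => ⟨x i, h.x_mem' i⟩) := by
  have hc : N.carrier.subtype ∘ chainFamily n (fun k => ⟨f k, h.f_mem k⟩) ⟨g, h.g_mem'⟩
      (fun i => ⟨x i, h.x_mem' i⟩) = chainFamily n f g x := by
    funext i
    rcases i with (i | i) | i <;> rfl
  constructor
  · refine LinearIndependent.of_comp N.carrier.subtype ?_
    rw [hc]; exact h.li
  · apply Submodule.map_injective_of_injective N.carrier.injective_subtype
    rw [← Submodule.span_image, ← Set.range_comp, hc, h.span_eq, Submodule.map_top,
      Submodule.range_subtype]
  · intro k hk; exact Subtype.ext (h.f_zero k hk)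
  · exact h.f_odd
  · exact h.f_even
  · exact h.g_mem
  · exact h.x_mem
  · exact fun k => Subtype.ext (h.f_f k)
  · exact Subtype.ext h.g_f
  · exact fun i => Subtype.ext (h.x_f i)
  · exact fun v _ => Subtype.ext (h.f_one v v.2)
  · exact fun v _ j hj => Subtype.ext (h.f_ge v v.2 j hj)
  · exact fun k => Subtype.ext (h.f_g k)
  · exact Subtype.ext h.g_g
  · exact fun i => Subtype.ext (h.x_g i)
  · exact fun k i => Subtype.ext (by simp [h.f_x])
  · exact fun i => Subtype.ext (h.g_x i)
  · exact fun i j => Subtype.ext (h.x_x i j)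

theorem ofIdeal {N : S.GradedIdeal} {f : ℕ → N.carrier} {g : N.carrier} {x : Fin c → N.carrier}
    (h : HasChain (S.ofIdeal N) n P ⊤ f g x) :
    HasChain S n P N.carrier (fun k => (f k : L)) g (fun i => (x i : L)) := by
  have := h.map (S' := S) N.carrier.subtype N.carrier.injective_subtype (fun i v hv => hv)
    (fun u v => rfl)
  rw [Submodule.map_top, Submodule.range_subtype] at this
  exact this

theorem finrank_eq (h : HasChain S n P M f g x) : Module.finrank ℂ M = 2 * n - 1 + 1 + c := by
  rw [← h.span_eq, finrank_span_eq_card h.li]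
  simp

theorem finite (h : HasChain S n P M f g x) : Module.Finite ℂ M := by
  rw [← h.span_eq]
  exact Module.Finite.span_of_finite ℂ (Set.finite_range _)

end HasChain

/-! ### From multiplication tables to chain bases -/

/-- The basis vector `x_{k+1}`. -/
def xVec (n c : ℕ) (k : Fin c) : HVec n c := Pi.single (.inl (.inr k)) 1

/-- The even chain `e_1, e_3, e_4, …`. -/
def evenVec (n c j : ℕ) : HVec n c := if j = 0 then eVec n c 1 else eVec n c (j + 2)

/-- The chain generated by `y_1`. -/
noncomputable def chainVec (n c k : ℕ) : HVec n c :=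
  -- Each product of an even chain vector with y_1 contributes a factor ½, that is, one factor for
  -- every two steps.
  (1 / 2 : ℂ) ^ (k / 2) • if k % 2 = 0 then yVec n c (k / 2 + 1) else evenVec n c (k / 2)

section

variable {n c : ℕ}

theorem chainVec_even (j : ℕ) : chainVec n c (2 * j) = (1 / 2 : ℂ) ^ j • yVec n c (j + 1) := by
  simp [chainVec]

theorem chainVec_odd (j : ℕ) : chainVec n c (2 * j + 1) = (1 / 2 : ℂ) ^ j • evenVec n c j := by
  have h1 : (2 * j + 1) / 2 = j := by omega
  have h2 : (2 * j + 1) % 2 ≠ 0 := by omega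
  simp [chainVec, h1]

theorem eVec_zero {i : ℕ} (h : n < i) : eVec n c i = 0 := dif_neg (by omega)

theorem yVec_zero {i : ℕ} (h : n < i) : yVec n c i = 0 := dif_neg (by omega)

theorem evenVec_zero {j : ℕ} (hn : 3 ≤ n) (h : n ≤ j + 1) : evenVec n c j = 0 := by
  rw [evenVec, if_neg (by omega), eVec_zero (by omega)]

theorem evenVec_mem (j : ℕ) : evenVec n c j ∈ HVec.part n c 0 := by
  unfold evenVec; split_ifs <;> exact eVec_mem _ _ _

theorem xVec_mem (k : Fin c) : xVec n c k ∈ HVec.part n c 0 := by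
  rintro ((i | i) | i) hk
  · simp [HIdx.name, HGen.parity] at hk
  · simp [HIdx.name, HGen.parity] at hk
  · simp [xVec]

theorem tableBracket_single (t : HGen → HGen → HVec n c) (i j : HIdx n c) :
    tableBracket t (Pi.single i 1) (Pi.single j 1) = t i.name j.name := by
  simp only [tableBracket, ← Pi.basisFun_apply, Module.Basis.constr_basis]

theorem eVec_eq {i : ℕ} (h : 1 ≤ i) (h' : i ≤ n) :
    ∃ k : HIdx n c, k.name = .e i ∧ eVec n c i = Pi.single k 1 :=
  ⟨.inl (.inl ⟨i - 1, by omega⟩), by simp [HIdx.name, Nat.sub_add_cancel h], dif_pos ⟨h, h'⟩⟩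

theorem yVec_eq {i : ℕ} (h : 1 ≤ i) (h' : i ≤ n) :
    ∃ k : HIdx n c, k.name = .y i ∧ yVec n c i = Pi.single k 1 :=
  ⟨.inr ⟨i - 1, by omega⟩, by simp [HIdx.name, Nat.sub_add_cancel h], dif_pos ⟨h, h'⟩⟩

theorem xVec_eq (i : Fin c) :
    ∃ k : HIdx n c, k.name = .x (i + 1) ∧ xVec n c i = Pi.single k 1 :=
  ⟨.inl (.inr i), rfl, rfl⟩

theorem tableBracket_of_eq {t : HGen → HGen → HVec n c} {u v : HVec n c} {p q : HGen}
    (hu : ∃ k : HIdx n c, k.name = p ∧ u = Pi.single k 1)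
    (hv : ∃ k : HIdx n c, k.name = q ∧ v = Pi.single k 1) : tableBracket t u v = t p q := by
  obtain ⟨i, rfl, rfl⟩ := hu
  obtain ⟨j, rfl, rfl⟩ := hv
  exact tableBracket_single t i j

theorem evenVec_eq (hn : 3 ≤ n) {j : ℕ} (h : j + 1 < n) : ∃ k : HIdx n c,
    k.name = .e (if j = 0 then 1 else j + 2) ∧ evenVec n c j = Pi.single k 1 := by
  unfold evenVec
  split_ifs
  · exact eVec_eq (by omega) (by omega)
  · exact eVec_eq (by omega) (by omega)

/-- The vector e_2 is taken out of the e_i since it plays the role of g; the others form the single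
sequence `evenVec`. -/
theorem HVec.ext_basis (hn : 3 ≤ n) {V : Type*} [AddCommGroup V] [Module ℂ V]
    {p q : HVec n c →ₗ[ℂ] V}
    (hy : ∀ j, j < n → p (yVec n c (j + 1)) = q (yVec n c (j + 1)))
    (he : ∀ j, j + 1 < n → p (evenVec n c j) = q (evenVec n c j))
    (hg : p (eVec n c 2) = q (eVec n c 2)) (hx : ∀ i, p (xVec n c i) = q (xVec n c i)) :
    p = q := by
  refine (Pi.basisFun ℂ (HIdx n c)).ext ?_
  rintro ((⟨i, hi⟩ | i) | ⟨i, hi⟩)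
  · have h1 : (Pi.basisFun ℂ (HIdx n c)) (.inl (.inl ⟨i, hi⟩)) = eVec n c (i + 1) := by
      rw [eVec, dif_pos (by omega)]; simp
    rw [h1]
    rcases i with _ | _ | i
    · simpa [evenVec] using he 0 (by omega)
    · exact hg
    · simpa [evenVec] using he (i + 1) (by omega)
  · simpa [xVec] using hx i
  · have h1 : (Pi.basisFun ℂ (HIdx n c)) (.inr ⟨i, hi⟩) = yVec n c (i + 1) := by
      rw [yVec, dif_pos (by omega)]; simp
    rw [h1]
    exact hy i hi

theorem span_chainFamily (hn : 3 ≤ n) :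
    Submodule.span ℂ (Set.range (chainFamily n (chainVec n c) (eVec n c 2) (xVec n c))) = ⊤ := by
  set W := Submodule.span ℂ (Set.range (chainFamily n (chainVec n c) (eVec n c 2) (xVec n c)))
  have hf : ∀ k, k < 2 * n - 1 → chainVec n c k ∈ W := fun k hk =>
    Submodule.subset_span ⟨.inl (.inl ⟨k, hk⟩), rfl⟩
  have key : ∀ (j : ℕ) (v : HVec n c), (1 / 2 : ℂ) ^ j • v ∈ W → v ∈ W := by
    intro j v hv
    have := W.smul_mem ((2 : ℂ) ^ j) hv
    rwa [smul_smul, ← mul_pow, mul_one_div_cancel two_ne_zero, one_pow, one_smul] at this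
  -- W is the whole space once its quotient map vanishes on the basis.
  have : W.mkQ = 0 := by
    refine HVec.ext_basis hn (fun j hj => ?_) (fun j hj => ?_) ?_ (fun i => ?_) <;>
      simp only [LinearMap.zero_apply, Submodule.mkQ_apply, Submodule.Quotient.mk_eq_zero]
    · refine key j _ ?_
      rw [← chainVec_even]
      exact hf _ (by omega)
    · refine key j _ ?_
      rw [← chainVec_odd]
      exact hf _ (by omega)
    · exact Submodule.subset_span ⟨.inl (.inr ()), rfl⟩
    · exact Submodule.subset_span ⟨.inr i, rfl⟩
  rw [← Submodule.ker_mkQ W, this, LinearMap.ker_zero]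

/-- A step from place j to place j + s changes the normalising power of ½ by s. This is the origin
of the factor 2^s in the relation between the structure constant a_s and the parameter a_{s+1}. -/
theorem half_pow_mul (j s : ℕ) : (1 / 2 : ℂ) ^ j = 2 ^ s * (1 / 2 : ℂ) ^ (j + s) := by
  rw [pow_add, mul_left_comm, ← mul_pow]
  norm_num

/-- A table which extends the table of `H(0, …, 0)` defines a superalgebra with a chain basis. -/
theorem ofTable_hasChain (hn : 3 ≤ n) {P : ChainParams c} {t : HGen → HGen → HVec n c}
    (ht : TableGraded t) (A : Fin c → ℕ → ℂ) (hA : ∀ i s, P.a i s = 2 ^ s * A i (s + 1))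
    (hee : ∀ i j, t (.e i) (.e j) = tableH0 n c (.e i) (.e j))
    (hey : ∀ i j, t (.e i) (.y j) = tableH0 n c (.e i) (.y j))
    (hye : ∀ i j, t (.y i) (.e j) = tableH0 n c (.y i) (.e j))
    (hyy : ∀ i j, t (.y i) (.y j) = tableH0 n c (.y i) (.y j))
    (hyx : ∀ (i : ℕ) (k : Fin c), 1 ≤ i → i ≤ n → t (.y i) (.x (k + 1)) =
      ((2 * i - 1) * P.α k) • yVec n c i +
        ∑ l ∈ Finset.Icc (i + 1) n, A k (l + 1 - i) • yVec n c l)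
    (he1x : ∀ (k : Fin c), t (.e 1) (.x (k + 1)) =
      (2 * P.α k) • eVec n c 1 + ∑ l ∈ Finset.Icc 3 n, A k (l - 1) • eVec n c l)
    (heix : ∀ (i : ℕ) (k : Fin c), 3 ≤ i → i ≤ n → t (.e i) (.x (k + 1)) =
      (2 * (i - 1) * P.α k) • eVec n c i +
        ∑ l ∈ Finset.Icc (i + 1) n, A k (l + 1 - i) • eVec n c l)
    (he2x : ∀ (k : Fin c), t (.e 2) (.x (k + 1)) = P.β k • eVec n c 2)
    (hxe1 : ∀ (k : Fin c), t (.x (k + 1)) (.e 1) = (-2 * P.α k) • eVec n c 1)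
    (hxe2 : ∀ (k : Fin c), t (.x (k + 1)) (.e 2) = P.δ k • eVec n c 2)
    (hxe : ∀ (i : ℕ) (k : Fin c), 3 ≤ i → t (.x (k + 1)) (.e i) = 0)
    (hxy1 : ∀ (k : Fin c), t (.x (k + 1)) (.y 1) = -P.α k • yVec n c 1)
    (hxy : ∀ (i : ℕ) (k : Fin c), 2 ≤ i → t (.x (k + 1)) (.y i) = 0)
    (hxx : ∀ (k l : Fin c), t (.x (k + 1)) (.x (l + 1)) = P.ε k l • eVec n c 2) :
    HasChain (ofTable t ht) n P ⊤ (chainVec n c) (eVec n c 2) (xVec n c) := by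
  have f0 : chainVec n c 0 = yVec n c 1 := by simpa using chainVec_even (n := n) (c := c) 0
  have f1 : chainVec n c 1 = evenVec n c 0 := by simpa using chainVec_odd (n := n) (c := c) 0
  have y1 := yVec_eq (n := n) (c := c) (i := 1) (by omega) (by omega)
  have e1 := evenVec_eq (n := n) (c := c) hn (j := 0) (by omega)
  have e2 := eVec_eq (n := n) (c := c) (i := 2) (by omega) (by omega)
  have xe := fun i => xVec_eq (n := n) (c := c) i
  have yb : ∀ j, j < n → _ := fun j hj => yVec_eq (n := n) (c := c) (i := j + 1) (by omega) (by omega)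
  have eb : ∀ j, j + 1 < n → _ := fun j hj => evenVec_eq (n := n) (c := c) hn hj
  have hYY : ∀ j, tableBracket t (yVec n c (j + 1)) (yVec n c 1) = evenVec n c j := by
    intro j
    rcases lt_or_ge j n with hj | hj
    · rw [tableBracket_of_eq (yb j hj) y1, hyy, tableH0, evenVec]
      rcases j with _ | j
      · simp
      · rcases lt_or_ge (j + 2) n with h | h
        · simp [show j + 1 + 1 + 1 ≤ n by omega]
        · simp [show ¬ (j + 1 + 1 + 1 ≤ n) by omega, eVec_zero (show n < j + 1 + 2 by omega)]
    · rw [yVec_zero (by omega), evenVec_zero hn (by omega), map_zero, LinearMap.zero_apply]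
  have hEY : ∀ j, tableBracket t (evenVec n c j) (yVec n c 1) =
      (1 / 2 : ℂ) • yVec n c (j + 2) := by
    intro j
    rcases lt_or_ge (j + 1) n with hj | hj
    · rw [tableBracket_of_eq (eb j hj) y1, hey, tableH0]
      rcases j with _ | j
      · simp
      · simp [show j + 1 + 2 ≤ n by omega]
    · rw [yVec_zero (i := j + 2) (by omega), evenVec_zero hn (by omega), map_zero,
        LinearMap.zero_apply, smul_zero]
  have hYE : ∀ j, tableBracket t (yVec n c (j + 1)) (evenVec n c 0) = yVec n c (j + 2) := by
    intro j
    rcases lt_or_ge j n with hj | hj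
    · rw [tableBracket_of_eq (yb j hj) e1, hye, tableH0]
      rcases lt_or_ge (j + 1) n with h | h
      · simp [show j + 1 + 1 ≤ n by omega]
      · simp [show ¬ (j + 1 + 1 ≤ n) by omega, yVec_zero (show n < j + 2 by omega)]
    · rw [yVec_zero (by omega), yVec_zero (by omega), map_zero, LinearMap.zero_apply]
  have hEE : ∀ j, tableBracket t (evenVec n c j) (evenVec n c 0) = evenVec n c (j + 1) := by
    intro j
    rcases lt_or_ge (j + 1) n with hj | hj
    · rw [tableBracket_of_eq (eb j hj) e1, hee, tableH0, evenVec]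
      rcases j with _ | j
      · simp
      · rcases lt_or_ge (j + 3) n with h | h
        · simp [show j + 1 + 2 + 1 ≤ n by omega]
        · simp [show ¬ (j + 1 + 2 + 1 ≤ n) by omega, eVec_zero (show n < j + 1 + 1 + 2 by omega)]
    · rw [evenVec_zero (j := j) hn (by omega), evenVec_zero (j := j + 1) hn (by omega), map_zero,
        LinearMap.zero_apply]
  have hgY : tableBracket t (eVec n c 2) (yVec n c 1) = 0 := by
    rw [tableBracket_of_eq e2 y1, hey, tableH0]; simp
  have hgE : tableBracket t (eVec n c 2) (evenVec n c 0) = 0 := by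
    rw [tableBracket_of_eq e2 e1, hee, tableH0]; simp
  have hxY : ∀ i, tableBracket t (xVec n c i) (yVec n c 1) = -P.α i • yVec n c 1 := by
    intro i
    rw [tableBracket_of_eq (xe i) y1, hxy1]
  have hxE : ∀ i, tableBracket t (xVec n c i) (evenVec n c 0) =
      (-2 * P.α i) • evenVec n c 0 := by
    intro i
    rw [tableBracket_of_eq (xe i) e1]
    simpa [evenVec] using hxe1 i
  have hvY : ∀ j, (tableBracket t).flip (yVec n c (j + 2)) = 0 := by
    intro j
    rcases lt_or_ge (j + 1) n with hj | hj
    · refine HVec.ext_basis hn (fun i hi => ?_) (fun i hi => ?_) ?_ (fun i => ?_) <;>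
        simp only [LinearMap.flip_apply, LinearMap.zero_apply]
      · rw [tableBracket_of_eq (yb i hi) (yb _ hj), hyy, tableH0]; simp
      · rw [tableBracket_of_eq (eb i hi) (yb _ hj), hey, tableH0]; simp
      · rw [tableBracket_of_eq e2 (yb _ hj), hey, tableH0]; simp
      · rw [tableBracket_of_eq (xe i) (yb _ hj), hxy _ _ (by omega)]
    · rw [yVec_zero (by omega), map_zero]
  have hvE : ∀ j, (tableBracket t).flip (evenVec n c (j + 1)) = 0 := by
    intro j
    rcases lt_or_ge (j + 2) n with hj | hj
    · refine HVec.ext_basis hn (fun i hi => ?_) (fun i hi => ?_) ?_ (fun i => ?_) <;>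
        simp only [LinearMap.flip_apply, LinearMap.zero_apply]
      · rw [tableBracket_of_eq (yb i hi) (eb _ hj), hye, tableH0]; simp
      · rw [tableBracket_of_eq (eb i hi) (eb _ hj), hee, tableH0]; simp
      · rw [tableBracket_of_eq e2 (eb _ hj), hee, tableH0]; simp
      · rw [tableBracket_of_eq (xe i) (eb _ hj), if_neg (by omega), hxe _ _ (by omega)]
    · rw [evenVec_zero hn (by omega), map_zero]
  have hYx : ∀ j i, tableBracket t (yVec n c (j + 1)) (xVec n c i) =
      ((2 * j + 1) * P.α i) • yVec n c (j + 1) +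
        ∑ s ∈ Finset.Icc 1 (n - 1), A i (s + 1) • yVec n c (j + s + 1) := by
    intro j i
    rcases lt_or_ge j n with hj | hj
    · rw [tableBracket_of_eq (yb j hj) (xe i), hyx _ _ (by omega) (by omega)]
      congr 1
      · congr 1; push_cast; ring
      -- The range may be enlarged because y_l = 0 for l > n; then l = s + j + 1.
      · have hsub : Finset.Icc (j + 1 + 1) n ⊆ Finset.Icc (1 + (j + 1)) (n - 1 + (j + 1)) :=
          Finset.Icc_subset_Icc (by omega) (by omega)
        rw [Finset.sum_subset hsub (fun l hl hl' => ?_),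
          ← Finset.map_add_right_Icc, Finset.sum_map]
        · refine Finset.sum_congr rfl fun s _ => ?_
          simp only [addRightEmbedding_apply]
          congr 2 <;> omega
        · rw [Finset.mem_Icc] at hl hl'
          rw [yVec_zero (by omega), smul_zero]
    · rw [yVec_zero (by omega), map_zero, LinearMap.zero_apply, smul_zero, zero_add,
        Finset.sum_eq_zero]
      intro s _
      rw [yVec_zero (by omega), smul_zero]
  have hEx : ∀ j i, tableBracket t (evenVec n c j) (xVec n c i) =
      ((2 * j + 2) * P.α i) • evenVec n c j +
        ∑ s ∈ Finset.Icc 1 (n - 1), A i (s + 1) • evenVec n c (j + s) := by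
    intro j i
    rcases lt_or_ge (j + 1) n with hj | hj
    · rw [tableBracket_of_eq (eb j hj) (xe i)]
      rcases j with _ | j
      · rw [if_pos rfl, he1x]
        congr 1
        · simp [evenVec]
        -- The gap between e_1 and e_3 makes the substitution l = s + 2, so that l - 1 = s + 1.
        · have hsub : Finset.Icc 3 n ⊆ Finset.Icc (1 + 2) (n - 1 + 2) :=
            Finset.Icc_subset_Icc (by omega) (by omega)
          rw [Finset.sum_subset hsub (fun l hl hl' => ?_),
            ← Finset.map_add_right_Icc, Finset.sum_map]
          · refine Finset.sum_congr rfl fun s hs => ?_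
            rw [Finset.mem_Icc] at hs
            simp only [addRightEmbedding_apply, evenVec]
            rw [if_neg (by omega)]
            congr 2; omega
          · rw [Finset.mem_Icc] at hl hl'
            rw [eVec_zero (by omega), smul_zero]
      · rw [if_neg (by omega), heix _ _ (by omega) (by omega)]
        congr 1
        · simp only [evenVec, Nat.add_eq_zero_iff, one_ne_zero, and_false, if_false]
          congr 1; push_cast; ring
        · have hsub : Finset.Icc (j + 1 + 2 + 1) n ⊆
              Finset.Icc (1 + (j + 3)) (n - 1 + (j + 3)) :=
            Finset.Icc_subset_Icc (by omega) (by omega)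
          rw [Finset.sum_subset hsub (fun l hl hl' => ?_),
            ← Finset.map_add_right_Icc, Finset.sum_map]
          · refine Finset.sum_congr rfl fun s hs => ?_
            simp only [addRightEmbedding_apply, evenVec]
            rw [if_neg (by omega)]
            congr 2 <;> omega
          · rw [Finset.mem_Icc] at hl hl'
            rw [eVec_zero (by omega), smul_zero]
    · rw [evenVec_zero hn (by omega), map_zero, LinearMap.zero_apply, smul_zero, zero_add,
        Finset.sum_eq_zero]
      intro s _
      rw [evenVec_zero hn (by omega), smul_zero]
  have hYg : ∀ j, tableBracket t (yVec n c (j + 1)) (eVec n c 2) = 0 := by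
    intro j
    rcases lt_or_ge j n with hj | hj
    · rw [tableBracket_of_eq (yb j hj) e2, hye, tableH0]; simp
    · rw [yVec_zero (by omega), map_zero, LinearMap.zero_apply]
  have hEg : ∀ j, tableBracket t (evenVec n c j) (eVec n c 2) = 0 := by
    intro j
    rcases lt_or_ge (j + 1) n with hj | hj
    · rw [tableBracket_of_eq (eb j hj) e2, hee, tableH0]; simp
    · rw [evenVec_zero hn (by omega), map_zero, LinearMap.zero_apply]
  have hb : (ofTable t ht).bracket = tableBracket t := rfl
  constructor
  · refine linearIndependent_of_top_le_span_of_card_eq_finrank (span_chainFamily hn).ge ?_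
    simp only [Fintype.card_sum, Fintype.card_fin, Fintype.card_unit, Module.finrank_fintype_fun_eq_card]
    omega
  · exact span_chainFamily hn
  · intro k hk
    rcases Nat.even_or_odd' k with ⟨j, rfl | rfl⟩
    · rw [chainVec_even, yVec_zero (by omega), smul_zero]
    · rw [chainVec_odd, evenVec_zero hn (by omega), smul_zero]
  · intro j
    rw [chainVec_even]
    exact Submodule.smul_mem _ _ (yVec_mem _ _ _)
  · intro j
    rw [chainVec_odd]
    exact Submodule.smul_mem _ _ (evenVec_mem _)
  · exact eVec_mem _ _ _
  · exact fun i => xVec_mem i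
  · intro k
    rw [hb, f0]
    rcases Nat.even_or_odd' k with ⟨j, rfl | rfl⟩
    · rw [chainVec_even, chainVec_odd, map_smul, LinearMap.smul_apply, hYY]
    · rw [show 2 * j + 1 + 1 = 2 * (j + 1) by ring, chainVec_even, chainVec_odd, map_smul,
        LinearMap.smul_apply, hEY, smul_smul, pow_succ]
  · rw [hb, f0, hgY]
  · intro i
    rw [hb, f0, hxY]
  · intro v _
    rw [hb, f0, f1]
    refine LinearMap.congr_fun (f := (tableBracket t).flip (evenVec n c 0))
      (g := (2 : ℂ) • (tableBracket t).flip (yVec n c 1) ∘ₗ (tableBracket t).flip (yVec n c 1)) ?_ v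
    refine HVec.ext_basis hn (fun j _ => ?_) (fun j _ => ?_) ?_ (fun i => ?_) <;>
      simp only [LinearMap.flip_apply, LinearMap.smul_apply, LinearMap.comp_apply]
    · rw [hYE, hYY, hEY, smul_smul]; norm_num
    · rw [hEE, hEY, map_smul, LinearMap.smul_apply, hYY, smul_smul]; norm_num
    · rw [hgE, hgY, map_zero, LinearMap.zero_apply, smul_zero]
    · rw [hxE, hxY, map_smul, LinearMap.smul_apply, hYY, smul_smul]; ring_nf
  · intro v _ k hk
    rw [hb]
    rcases Nat.even_or_odd' k with ⟨j, rfl | rfl⟩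
    · obtain ⟨j, rfl⟩ : ∃ i, j = i + 1 := ⟨j - 1, by omega⟩
      rw [chainVec_even, map_smul]
      have := LinearMap.congr_fun (hvY j) v
      simp only [LinearMap.flip_apply, LinearMap.zero_apply] at this
      rw [this, smul_zero]
    · obtain ⟨j, rfl⟩ : ∃ i, j = i + 1 := ⟨j - 1, by omega⟩
      rw [chainVec_odd, map_smul]
      have := LinearMap.congr_fun (hvE j) v
      simp only [LinearMap.flip_apply, LinearMap.zero_apply] at this
      rw [this, smul_zero]
  · intro k
    rw [hb]
    rcases Nat.even_or_odd' k with ⟨j, rfl | rfl⟩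
    · rw [chainVec_even, map_smul, LinearMap.smul_apply, hYg, smul_zero]
    · rw [chainVec_odd, map_smul, LinearMap.smul_apply, hEg, smul_zero]
  · rw [hb, tableBracket_of_eq e2 e2, hee, tableH0]; simp
  · intro i
    rw [hb, tableBracket_of_eq (xe i) e2, hxe2]
  · intro k i
    rw [hb]
    rcases Nat.even_or_odd' k with ⟨j, rfl | rfl⟩
    · rw [chainVec_even, map_smul, LinearMap.smul_apply, hYx, smul_add, Finset.smul_sum]
      congr 1
      · rw [smul_comm]; push_cast; rfl
      · refine Finset.sum_congr rfl fun s _ => ?_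
        rw [show 2 * j + 2 * s = 2 * (j + s) by ring, chainVec_even, hA, smul_smul, smul_smul,
          half_pow_mul j s]
        congr 1; ring
    · rw [chainVec_odd, map_smul, LinearMap.smul_apply, hEx, smul_add, Finset.smul_sum]
      congr 1
      · rw [smul_comm]; push_cast; ring_nf
      · refine Finset.sum_congr rfl fun s _ => ?_
        rw [show 2 * j + 1 + 2 * s = 2 * (j + s) + 1 by ring, chainVec_odd, hA, smul_smul,
          smul_smul, half_pow_mul j s]
        congr 1; ring
  · intro i
    rw [hb, tableBracket_of_eq e2 (xe i), he2x]
  · intro i j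
    rw [hb, tableBracket_of_eq (xe i) (xe j), hxx]

end

namespace HLabel

/-- The structure constants of a member of the list. -/
noncomputable def params : (l : HLabel) → ChainParams l.codim
  | MH1 => ⟨![1, 0], ![0, 1], ![0, 0], fun _ _ => 0, fun _ _ => 0⟩
  | MH2 => ⟨![1, 0], ![0, 1], ![0, -1], fun _ _ => 0, fun _ _ => 0⟩
  | H1 b => ⟨fun _ => 1, fun _ => b, fun _ => -b, fun _ _ => 0, fun _ _ => 0⟩
  | H2 b => ⟨fun _ => 1, fun _ => b, fun _ => 0, fun _ _ => 0, fun _ _ => 0⟩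
  | H3 => ⟨fun _ => 1, fun _ => 0, fun _ => 0, fun _ _ => 1, fun _ _ => 0⟩
  | H4 a => ⟨fun _ => 0, fun _ => 1, fun _ => 0, fun _ _ => 0, fun _ s => 2 ^ s * a (s + 1)⟩
  | H5 γ a => ⟨fun _ => 0, fun _ => 1, fun _ => -1, fun _ _ => γ, fun _ s => 2 ^ s * a (s + 1)⟩

theorem hasChain {n : ℕ} (hn : 3 ≤ n) (l : HLabel) :
    HasChain (l.alg n) n l.params ⊤ (chainVec n l.codim) (eVec n l.codim 2) (xVec n l.codim) := by
  cases l
  case' MH1 =>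
    have key := ofTable_hasChain (c := 2) (P := MH1.params) hn (tableMH1_graded n) (fun _ _ => 0)
  case' MH2 =>
    have key := ofTable_hasChain (c := 2) (P := MH2.params) hn (tableMH2_graded n) (fun _ _ => 0)
  case' H1 b =>
    have key := ofTable_hasChain (c := 1) (P := (H1 b).params) hn (tableH1_graded n b) (fun _ _ => 0)
  case' H2 b =>
    have key := ofTable_hasChain (c := 1) (P := (H2 b).params) hn (tableH2_graded n b) (fun _ _ => 0)
  case' H3 =>
    have key := ofTable_hasChain (c := 1) (P := H3.params) hn (tableH3_graded n) (fun _ _ => 0)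
  case' H4 a =>
    have key := ofTable_hasChain (c := 1) (P := (H4 a).params) hn (tableH4_graded n a) (fun _ => a)
  case' H5 γ a =>
    have key := ofTable_hasChain (c := 1) (P := (H5 γ a).params) hn (tableH5_graded n γ a) (fun _ => a)
  all_goals
    refine key (fun i s => by simp [params]) (fun i j => ?_) (fun i j => ?_) (fun i j => ?_)
      (fun i j => ?_) (fun i k h h' => ?_) (fun k => ?_) (fun i k h h' => ?_) (fun k => ?_)
      (fun k => ?_) (fun k => ?_) (fun i k h => ?_) (fun k => ?_) (fun i k h => ?_) (fun k l => ?_)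
  all_goals clear key
  all_goals first
    | rfl
    | (rcases i with _ | _ | _ | i <;> rfl)
    | (fin_cases k <;> fin_cases l <;> simp [tableMH1, tableMH2, tableH1, tableH2, tableH3, tableH4,
          tableH5, params, diagAct, diagLeft, nilAct, tableH0, *])
    | (have h1 : i ≠ 1 := by omega
       fin_cases k <;> simp [tableMH1, tableMH2, tableH1, tableH2, tableH3, tableH4,
          tableH5, params, diagAct, diagLeft, nilAct, tableH0, *]; done)
    | (fin_cases k <;> simp [tableMH1, tableMH2, tableH1, tableH2, tableH3, tableH4,
          tableH5, params, diagAct, diagLeft, nilAct, tableH0, *]; done)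
    | (have h1 : i ≠ 1 := by omega
       have h2 : i ≠ 2 := by omega
       fin_cases k <;> simp [tableMH1, tableMH2, tableH1, tableH2, tableH4,
          tableH5, params, diagAct, diagLeft, nilAct, tableH0, *])

end HLabel

/-- For c = 0 the constants are functions on an empty type. With `default`, a chain basis of N just
says that N has the products of H. -/
instance : Inhabited (ChainParams 0) := ⟨⟨0, 0, 0, 0, 0⟩⟩

theorem algH0_hasChain {n : ℕ} (hn : 3 ≤ n) :
    HasChain (algH0 n) n default ⊤ (chainVec n 0) (eVec n 0 2) (xVec n 0) := by
  refine ofTable_hasChain hn (tableH0_graded n 0) (fun _ _ => 0) (fun i => i.elim0)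
    (fun i j => rfl) (fun i j => rfl) (fun i j => rfl) (fun i j => rfl) (fun i k => k.elim0)
    (fun k => k.elim0) (fun i k => k.elim0) (fun k => k.elim0) (fun k => k.elim0)
    (fun k => k.elim0) (fun i k => k.elim0) (fun k => k.elim0) (fun i k => k.elim0)
    (fun k => k.elim0)

/-! ### Nilpotent ideals and solvability -/

namespace SuperAlgebra

variable {L : Type*} [AddCommGroup L] [Module ℂ L] {S : SuperAlgebra L}

/-- An ideal with a filtration whose degree is raised by multiplication is nilpotent. -/
theorem isNilpotent_of_filtration {J : S.GradedIdeal} {G : ℕ → Submodule ℂ L}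
    (h0 : J.carrier ≤ G 0) (hs : ∀ k, ∀ v ∈ G k, ∀ w ∈ J.carrier, S.bracket v w ∈ G (k + 1))
    {K : ℕ} (hK : G K = ⊥) : (S.ofIdeal J).IsNilpotent := by
  have key : ∀ k, (S.ofIdeal J).lowerCentral k ≤ (G k).comap J.carrier.subtype := by
    intro k
    induction k with
    | zero => exact fun v _ => h0 v.2
    | succ k ih => exact Submodule.map₂_le.2 fun v hv w _ => hs k v (ih hv) w w.2
  refine ⟨K, eq_bot_iff.2 fun v hv => ?_⟩
  have := key K hv
  rw [hK] at this
  exact Subtype.ext ((Submodule.mem_bot ℂ).1 this)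

/-- An ideal in which a right multiplication has an eigenvector modulo the kernel of a linear form
is not nilpotent. -/
theorem not_isNilpotent_of_eigen {J : S.GradedIdeal} {N : Submodule ℂ L} (ξ : L →ₗ[ℂ] ℂ) {v w : L}
    (hv : v ∈ J.carrier) (hw : w ∈ J.carrier) (hwN : w ∈ N) (hξ : ξ w ≠ 0) {s : ℂ} (hs : s ≠ 0)
    (hN : ∀ u ∈ N, S.bracket u v ∈ N ∧ ξ (S.bracket u v) = s * ξ u) :
    ¬ (S.ofIdeal J).IsNilpotent := by
  rintro ⟨K, hK⟩
  have key : ∀ k, ∃ u ∈ (S.ofIdeal J).lowerCentral k, (u : L) ∈ N ∧ ξ u ≠ 0 := by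
    intro k
    induction k with
    | zero => exact ⟨⟨w, hw⟩, Submodule.mem_top, hwN, hξ⟩
    | succ k ih =>
      obtain ⟨u, hu, huN, hu0⟩ := ih
      refine ⟨(S.ofIdeal J).bracket u ⟨v, hv⟩, Submodule.apply_mem_map₂ _ hu Submodule.mem_top,
        (hN u huN).1, ?_⟩
      rw [coe_ofIdeal_bracket, (hN u huN).2]
      exact mul_ne_zero hs hu0
  obtain ⟨u, hu, -, hu0⟩ := key K
  rw [hK, Submodule.mem_bot] at hu
  exact hu0 (by rw [hu]; exact map_zero ξ)

/-- Because [L, L] ⊆ N, the derived series of L runs, from its second term on, inside the lower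
central series of N. -/
theorem isSolvable_of_isNilpotent_ideal {N : S.GradedIdeal} (h : (S.ofIdeal N).IsNilpotent)
    (hN : Submodule.map₂ S.bracket ⊤ ⊤ ≤ N.carrier) : S.IsSolvable := by
  obtain ⟨K, hK⟩ := h
  have key : ∀ k, S.derived (k + 1) ≤ ((S.ofIdeal N).lowerCentral k).map N.carrier.subtype := by
    intro k
    induction k with
    | zero =>
      refine hN.trans fun v hv => ⟨⟨v, hv⟩, Submodule.mem_top, rfl⟩
    | succ k ih =>
      refine Submodule.map₂_le.2 fun u hu v hv => ?_
      obtain ⟨u, hu', rfl⟩ := ih hu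
      obtain ⟨v, -, rfl⟩ := ih hv
      exact ⟨(S.ofIdeal N).bracket u v, Submodule.apply_mem_map₂ _ hu' Submodule.mem_top, rfl⟩
  refine ⟨K + 1, eq_bot_iff.2 ((key K).trans ?_)⟩
  rw [hK, Submodule.map_bot]

theorem IsNilpotent.ofIdeal (h : S.IsNilpotent) (J : S.GradedIdeal) :
    (S.ofIdeal J).IsNilpotent := by
  obtain ⟨K, hK⟩ := h
  refine isNilpotent_of_filtration (G := S.lowerCentral) le_top (fun k v hv w _ => ?_) hK
  exact Submodule.apply_mem_map₂ _ hv Submodule.mem_top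

/-- The whole superalgebra as an ideal. -/
def topIdeal (S : SuperAlgebra L) : S.GradedIdeal where
  carrier := ⊤
  graded := by simp [S.isCompl.sup_eq_top]
  mul_mem_left _ _ _ := Submodule.mem_top
  mul_mem_right _ _ _ := Submodule.mem_top

/-- Otherwise L itself would be a nilpotent ideal containing N and [L, L], against maximality. -/
theorem IsNilradical.not_isNilpotent {N : S.GradedIdeal} (h : S.IsNilradical N)
    (hN : N.carrier ≠ ⊤) : ¬ S.IsNilpotent := fun hS =>
  hN (h.2.2 S.topIdeal (hS.ofIdeal _) le_top le_top).symm

theorem isNilpotent_of_ideal_eq_top {N : S.GradedIdeal} (h : (S.ofIdeal N).IsNilpotent)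
    (hN : N.carrier = ⊤) : S.IsNilpotent := by
  obtain ⟨K, hK⟩ := h
  have key : ∀ k, S.lowerCentral k ≤ ((S.ofIdeal N).lowerCentral k).map N.carrier.subtype := by
    intro k
    induction k with
    | zero => exact fun v _ => ⟨⟨v, hN ▸ Submodule.mem_top⟩, Submodule.mem_top, rfl⟩
    | succ k ih =>
      refine Submodule.map₂_le.2 fun u hu v hv => ?_
      obtain ⟨u, hu', rfl⟩ := ih hu
      exact ⟨(S.ofIdeal N).bracket u ⟨v, hN ▸ Submodule.mem_top⟩,
        Submodule.apply_mem_map₂ _ hu' Submodule.mem_top, rfl⟩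
  refine ⟨K, eq_bot_iff.2 ((key K).trans ?_)⟩
  rw [hK, Submodule.map_bot]

end SuperAlgebra

/-! ### The Leibniz superidentity in terms of the structure constants -/

namespace HasChain

variable {L : Type*} [AddCommGroup L] [Module ℂ L] {S : SuperAlgebra L} {n c : ℕ}
  {P : ChainParams c} {M : Submodule ℂ L} {f : ℕ → L} {g : L} {x : Fin c → L}

theorem bracket_g (h : HasChain S n P M f g x) {v : L} (hv : v ∈ M) :
    S.bracket v g = (∑ i, P.δ i * h.cx i v) • g := by
  have := h.eqOn (p := S.bracket.flip g) (q := (∑ i, P.δ i • h.cx i).smulRight g)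
    (fun k _ => ?_) ?_ (fun i => ?_) hv
  · simpa [LinearMap.sum_apply] using this
  · simp [h.f_g, LinearMap.sum_apply]
  · simp [h.g_g, LinearMap.sum_apply]
  · simp [h.x_g, LinearMap.sum_apply]

theorem g_bracket_f (h : HasChain S n P M f g x) (k : ℕ) : S.bracket g (f k) = 0 := by
  rcases k with _ | _ | k
  · exact h.g_f
  · rw [h.f_one g h.g_mem', h.g_f, map_zero, LinearMap.zero_apply, smul_zero]
  · exact h.f_ge g h.g_mem' _ (by omega)

theorem f_bracket_one (h : HasChain S n P M f g x) (k : ℕ) :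
    S.bracket (f k) (f 1) = (2 : ℂ) • f (k + 2) := by
  rw [h.f_one _ (h.f_mem k), h.f_f, h.f_f]

theorem x_bracket_one (h : HasChain S n P M f g x) (i : Fin c) :
    S.bracket (x i) (f 1) = (-2 * P.α i) • f 1 := by
  rw [h.f_one _ (h.x_mem' i), h.x_f, map_smul, LinearMap.smul_apply, h.f_f, smul_smul]
  congr 1; ring

/-- No product of basis vectors involves an x_i. Hence the f_k and g span an ideal containing all
products. -/
theorem cx_bracket (h : HasChain S n P M f g x) (i : Fin c) {u v : L} (hu : u ∈ M) (hv : v ∈ M) :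
    h.cx i (S.bracket u v) = 0 := by
  have h0 : ∀ {u}, u ∈ M → h.cx i (S.bracket u (f 0)) = 0 := fun {u} hu =>
    h.eqOn (p := h.cx i ∘ₗ S.bracket.flip (f 0)) (q := 0) (fun k _ => by simp [h.f_f])
      (by simp [h.g_f]) (fun i => by simp [h.x_f]) hu
  have h1 : ∀ {u}, u ∈ M → h.cx i (S.bracket u (f 1)) = 0 := fun {u} hu =>
    h.eqOn (p := h.cx i ∘ₗ S.bracket.flip (f 1)) (q := 0) (fun k _ => by simp [h.f_bracket_one])
      (by simp [h.g_bracket_f]) (fun i => by simp [h.x_bracket_one]) hu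
  refine h.eqOn (p := h.cx i ∘ₗ S.bracket u) (q := 0) (fun k _ => ?_) ?_ (fun j => ?_) hv
  · rcases k with _ | _ | k
    · exact h0 hu
    · exact h1 hu
    · simp [h.f_ge u hu]
  · simp [h.bracket_g hu]
  · exact h.eqOn (p := h.cx i ∘ₗ S.bracket.flip (x j)) (q := 0) (fun k _ => by simp [h.f_x])
      (by simp [h.g_x]) (fun l => by simp [h.x_x]) hu

theorem bracket_bracket_g (h : HasChain S n P M f g x) {u v : L} (hu : u ∈ M) (hv : v ∈ M)
    (hm : S.bracket u v ∈ M) : S.bracket (S.bracket u v) g = 0 := by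
  rw [h.bracket_g hm]; simp [h.cx_bracket _ hu hv]

/-- The commutator of the right multiplications by `f 0` and by `x i`. -/
theorem comm_x (h : HasChain S n P M f g x) (h1 : ∀ i l j, P.α i * P.a l j = 0) {v : L}
    (hv : v ∈ M) (i : Fin c) : S.bracket (S.bracket v (f 0)) (x i) =
      S.bracket (S.bracket v (x i)) (f 0) + P.α i • S.bracket v (f 0) := by
  refine h.eqOn (p := S.bracket.flip (x i) ∘ₗ S.bracket.flip (f 0))
    (q := S.bracket.flip (f 0) ∘ₗ S.bracket.flip (x i) + P.α i • S.bracket.flip (f 0))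
    (fun k _ => ?_) ?_ (fun l => ?_) hv <;>
    simp only [LinearMap.add_apply, LinearMap.comp_apply, LinearMap.flip_apply,
      LinearMap.smul_apply]
  · simp only [h.f_f, h.f_x, map_add, map_sum, map_smul, LinearMap.add_apply, LinearMap.sum_apply,
      LinearMap.smul_apply]
    rw [add_right_comm, ← add_smul]
    congr 1
    · congr 1; push_cast; ring
    · exact Finset.sum_congr rfl fun j _ => by rw [add_right_comm]
  · simp [h.g_f, h.g_x]
  · simp only [h.x_f, h.x_x, map_smul, LinearMap.smul_apply, h.g_f, smul_zero, zero_add, h.f_x,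
      smul_add, Finset.smul_sum, smul_smul]
    -- The product [[x_l, f_0], x_i] contributes terms with coefficient -α_l a_ij, which vanish by
    -- `h1`.
    rw [Finset.sum_eq_zero]
    · simp [mul_comm]
    · intro j _
      rw [neg_mul, h1, neg_zero, zero_smul]

/-- The right multiplications by the vectors `x i` commute up to the multiplication by `g`. -/
theorem comm_xx (h : HasChain S n P M f g x) (h1 : ∀ i l j, P.α i * P.a l j = 0)
    (h3 : ∀ i j l, P.ε i j * P.δ l = P.ε l i * P.β j - P.ε l j * P.β i) {v : L}
    (hv : v ∈ M) (i j : Fin c) : P.ε i j • S.bracket v g =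
      S.bracket (S.bracket v (x i)) (x j) - S.bracket (S.bracket v (x j)) (x i) := by
  refine h.eqOn (p := P.ε i j • S.bracket.flip g)
    (q := S.bracket.flip (x j) ∘ₗ S.bracket.flip (x i) -
      S.bracket.flip (x i) ∘ₗ S.bracket.flip (x j)) (fun k _ => ?_) ?_ (fun l => ?_) hv <;>
    simp only [LinearMap.sub_apply, LinearMap.comp_apply, LinearMap.flip_apply,
      LinearMap.smul_apply]
  · have key : ∀ i j, S.bracket (S.bracket (f k) (x i)) (x j) =
        ((k + 1) ^ 2 * (P.α i * P.α j)) • f k +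
          ∑ s ∈ Finset.Icc 1 (n - 1), ∑ t ∈ Finset.Icc 1 (n - 1),
            (P.a i s * P.a j t) • f (k + 2 * s + 2 * t) := by
      intro i j
      simp only [h.f_x, map_add, map_sum, map_smul, LinearMap.add_apply, LinearMap.sum_apply,
        LinearMap.smul_apply, smul_add, Finset.smul_sum, smul_smul, Finset.sum_add_distrib]
      have e1 : ∀ s, (k + 1) * P.α i * P.a j s = 0 := fun s => by rw [mul_assoc, h1, mul_zero]
      have e2 : ∀ s : ℕ, P.a i s * (((k + 2 * s : ℕ) + 1) * P.α j) = 0 := fun s => by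
        rw [mul_comm, mul_assoc, h1, mul_zero]
      simp only [e1, e2, zero_smul, Finset.sum_const_zero, add_zero, zero_add]
      congr 2; ring
    rw [key, key, h.f_g, smul_zero, mul_comm (P.α j), Finset.sum_comm, sub_eq_zero.2]
    congr 1
    refine Finset.sum_congr rfl fun s _ => Finset.sum_congr rfl fun t _ => ?_
    rw [mul_comm, add_right_comm]
  · simp [h.g_g, h.g_x, smul_smul, mul_comm]
  · simp only [h.x_x, h.x_g, map_smul, LinearMap.smul_apply, h.g_x, smul_smul, ← sub_smul, h3]

/-- The identity says that R_{[y,z]} is a supercommutator of R_y and R_z, so y and z may be taken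
from the basis while v stays arbitrary. The maps R_{f_k} are expressed by R_{f_0}, and R_g has image
in ℂg. This leaves the pairs (f_0, x_i), settled by `comm_x`, the pairs (x_i, x_j), settled by
`comm_xx`, and the pairs with g, where `h2` enters. -/
theorem isLeibniz (h : HasChain S n P ⊤ f g x) (h1 : ∀ i l j, P.α i * P.a l j = 0)
    (h2 : ∀ i l, P.δ l * (P.δ i + P.β i) = 0)
    (h3 : ∀ i j l, P.ε i j * P.δ l = P.ε l i * P.β j - P.ε l j * P.β i) : S.IsLeibniz := by
  have ht : ∀ v : L, v ∈ (⊤ : Submodule ℂ L) := fun v => Submodule.mem_top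
  have hR1 : ∀ v, S.bracket v (f 1) = (2 : ℂ) • S.bracket (S.bracket v (f 0)) (f 0) :=
    fun v => h.f_one v (ht v)
  have hR2 : ∀ v k, S.bracket v (f (k + 2)) = 0 := fun v k => h.f_ge v (ht v) _ (by omega)
  have hg : ∀ u v, S.bracket (S.bracket u v) g = 0 := fun u v =>
    h.bracket_bracket_g (ht u) (ht v) (ht _)
  have hgf : ∀ v k, S.bracket (S.bracket v g) (f k) = 0 := fun v k => by
    rw [h.bracket_g (ht v), map_smul, LinearMap.smul_apply, h.g_bracket_f, smul_zero]
  have hgx : ∀ v i, S.bracket (S.bracket v g) (x i) = P.β i • S.bracket v g := fun v i => by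
    rw [h.bracket_g (ht v), map_smul, LinearMap.smul_apply, h.g_x, smul_comm]
  -- Here [v, g] = (Σ δ_l c_l) g with c_l the x_l-coordinates of v, and δ_l(δ_i + β_i) = 0.
  have hgg : ∀ v i, P.δ i • S.bracket v g = -(P.β i • S.bracket v g) := fun v i => by
    rw [eq_neg_iff_add_eq_zero, ← add_smul, h.bracket_g (ht v), smul_smul, Finset.mul_sum,
      Finset.sum_eq_zero, zero_smul]
    intro l _
    rw [← mul_assoc, mul_comm _ (P.δ l), h2, zero_mul]
  have hc : ∀ v i, S.bracket (S.bracket v (f 0)) (x i) =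
      S.bracket (S.bracket v (x i)) (f 0) + P.α i • S.bracket v (f 0) :=
    fun v i => h.comm_x h1 (ht v) i
  have hfx : ∀ v k i, S.bracket v (S.bracket (f k) (x i)) =
      S.bracket (S.bracket v (f k)) (x i) - S.bracket (S.bracket v (x i)) (f k) := by
    intro v k i
    -- The terms f_{k+2j} with j ≥ 1 have zero right multiplication, so only the diagonal term acts.
    have h0 : S.bracket v (S.bracket (f k) (x i)) = ((k + 1) * P.α i) • S.bracket v (f k) := by
      rw [h.f_x, map_add, map_smul, map_sum, Finset.sum_eq_zero, add_zero]
      intro j hj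
      rw [Finset.mem_Icc] at hj
      rw [map_smul, h.f_ge v (ht v) _ (by omega), smul_zero]
    rw [h0]
    rcases k with _ | _ | k
    · rw [hc]; simp
    · simp only [zero_add, hR1, hc, map_smul, map_add, LinearMap.smul_apply, LinearMap.add_apply]
      module
    · simp [hR2]
  have hxf : ∀ v k i, S.bracket v (S.bracket (x i) (f k)) =
      S.bracket (S.bracket v (x i)) (f k) - S.bracket (S.bracket v (f k)) (x i) := by
    intro v k i
    have h0 : S.bracket v (S.bracket (x i) (f k)) = (-(k + 1) * P.α i) • S.bracket v (f k) := by
      rcases k with _ | _ | k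
      · rw [h.x_f, map_smul]; simp
      · rw [h.x_bracket_one, map_smul]; congr 1; push_cast; ring
      · simp [hR2]
    have h4 := hfx v k i
    rw [h.f_x, map_add, map_smul, map_sum, Finset.sum_eq_zero, add_zero] at h4
    · rw [← neg_sub, ← h4, h0, neg_mul, neg_smul]
    · intro j hj
      rw [Finset.mem_Icc] at hj
      rw [map_smul, h.f_ge v (ht v) _ (by omega), smul_zero]
  -- The pair k = l = 0 is excluded: f_0 is odd, and there the identity carries the plus sign.
  have hff : ∀ v k l, (1 ≤ k ∨ 1 ≤ l) → S.bracket v (S.bracket (f k) (f l)) =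
      S.bracket (S.bracket v (f k)) (f l) - S.bracket (S.bracket v (f l)) (f k) := by
    intro v k l hkl
    rcases k with _ | _ | k
    · rcases l with _ | _ | l
      · omega
      · rw [h.f_bracket_one, map_smul, hR2, hR1, hR1]; simp
      · simp [hR2]
    · rcases l with _ | _ | l
      · simp [hR1, h.f_f, hR2]
      · simp [hR1, h.f_f, hR2]
      · simp [hR2]
    · rcases l with _ | _ | l
      · simp [h.f_f, hR2]
      · simp [h.f_bracket_one, hR2]
      · simp [hR2]
  intro p q v y z hy hz
  rcases ZMod.two_cases p with rfl | rfl <;> rcases ZMod.two_cases q with rfl | rfl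
  · simp only [ZMod.val_zero, mul_zero, pow_zero, one_smul]
    refine h.eqOn_even (p := S.bracket v ∘ₗ S.bracket y)
      (q := S.bracket (S.bracket v y) - S.bracket.flip y ∘ₗ S.bracket v)
      (fun k => ?_) ?_ (fun i => ?_) (ht z) hz <;>
    simp only [LinearMap.comp_apply, LinearMap.sub_apply, LinearMap.flip_apply]
    · refine h.eqOn_even (p := S.bracket v ∘ₗ S.bracket.flip (f (2 * k + 1)))
        (q := S.bracket.flip (f (2 * k + 1)) ∘ₗ S.bracket v -
          S.bracket (S.bracket v (f (2 * k + 1)))) (fun l => ?_) ?_ (fun l => ?_) (ht y) hy <;>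
      simp only [LinearMap.comp_apply, LinearMap.sub_apply, LinearMap.flip_apply]
      · exact hff v _ _ (by omega)
      · rw [h.g_bracket_f, hgf, hg, map_zero, sub_zero]
      · exact hxf v _ _
    · refine h.eqOn_even (p := S.bracket v ∘ₗ S.bracket.flip g)
        (q := S.bracket.flip g ∘ₗ S.bracket v -
          S.bracket (S.bracket v g)) (fun l => ?_) ?_ (fun l => ?_) (ht y) hy <;>
      simp only [LinearMap.comp_apply, LinearMap.sub_apply, LinearMap.flip_apply]
      · rw [h.f_g, hgf, hg, map_zero, sub_zero]
      · rw [h.g_g, hg, map_zero, sub_zero]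
      · rw [h.x_g, hg, hgx, map_smul, hgg, zero_sub]
    · refine h.eqOn_even (p := S.bracket v ∘ₗ S.bracket.flip (x i))
        (q := S.bracket.flip (x i) ∘ₗ S.bracket v -
          S.bracket (S.bracket v (x i))) (fun l => ?_) ?_ (fun l => ?_) (ht y) hy <;>
      simp only [LinearMap.comp_apply, LinearMap.sub_apply, LinearMap.flip_apply]
      · exact hfx v _ _
      · rw [h.g_x, hgx, hg, map_smul, sub_zero]
      · rw [h.x_x, map_smul, h.comm_xx h1 h3 (ht v)]
  · simp only [ZMod.val_zero, zero_mul, pow_zero, one_smul]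
    refine h.eqOn_odd (p := S.bracket v ∘ₗ S.bracket y)
      (q := S.bracket (S.bracket v y) - S.bracket.flip y ∘ₗ S.bracket v)
      (fun k => ?_) (ht z) hz
    simp only [LinearMap.comp_apply, LinearMap.sub_apply, LinearMap.flip_apply]
    refine h.eqOn_even (p := S.bracket v ∘ₗ S.bracket.flip (f (2 * k)))
        (q := S.bracket.flip (f (2 * k)) ∘ₗ S.bracket v -
          S.bracket (S.bracket v (f (2 * k)))) (fun l => ?_) ?_ (fun l => ?_) (ht y) hy <;>
      simp only [LinearMap.comp_apply, LinearMap.sub_apply, LinearMap.flip_apply]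
    · exact hff v _ _ (by omega)
    · rw [h.g_bracket_f, hgf, hg, map_zero, sub_zero]
    · exact hxf v _ _
  · simp only [ZMod.val_zero, mul_zero, pow_zero, one_smul]
    refine h.eqOn_even (p := S.bracket v ∘ₗ S.bracket y)
      (q := S.bracket (S.bracket v y) - S.bracket.flip y ∘ₗ S.bracket v)
      (fun k => ?_) ?_ (fun i => ?_) (ht z) hz <;>
    simp only [LinearMap.comp_apply, LinearMap.sub_apply, LinearMap.flip_apply]
    · refine h.eqOn_odd (p := S.bracket v ∘ₗ S.bracket.flip (f (2 * k + 1)))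
        (q := S.bracket.flip (f (2 * k + 1)) ∘ₗ S.bracket v -
          S.bracket (S.bracket v (f (2 * k + 1)))) (fun l => ?_) (ht y) hy
      exact hff v _ _ (by omega)
    · refine h.eqOn_odd (p := S.bracket v ∘ₗ S.bracket.flip g)
        (q := S.bracket.flip g ∘ₗ S.bracket v -
          S.bracket (S.bracket v g)) (fun l => ?_) (ht y) hy
      simp only [LinearMap.comp_apply, LinearMap.sub_apply, LinearMap.flip_apply]
      rw [h.f_g, hgf, hg, map_zero, sub_zero]
    · refine h.eqOn_odd (p := S.bracket v ∘ₗ S.bracket.flip (x i))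
        (q := S.bracket.flip (x i) ∘ₗ S.bracket v -
          S.bracket (S.bracket v (x i))) (fun l => ?_) (ht y) hy
      exact hfx v _ _
  · simp only [ZMod.val_one, mul_one, pow_one]
    refine h.eqOn_odd (p := S.bracket v ∘ₗ S.bracket y)
      (q := S.bracket (S.bracket v y) - (-1 : ℂ) • S.bracket.flip y ∘ₗ S.bracket v)
      (fun k => ?_) (ht z) hz
    refine h.eqOn_odd (p := S.bracket v ∘ₗ S.bracket.flip (f (2 * k)))
        (q := S.bracket.flip (f (2 * k)) ∘ₗ S.bracket v -
          (-1 : ℂ) • S.bracket (S.bracket v (f (2 * k)))) (fun l => ?_) (ht y) hy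
    simp only [LinearMap.comp_apply, LinearMap.sub_apply, LinearMap.flip_apply,
      LinearMap.smul_apply]
    -- Since R_{f_{2i}} = 0 for i ≥ 1, only y = z = f_0 is substantial, and that case is [v, f_1] =
    -- 2[[v, f_0], f_0].
    rcases l with _ | l
    · rcases k with _ | k
      · rw [mul_zero, h.f_f, hR1]; module
      · rw [mul_add, hR2, hR2, hR2]; simp
    · have e1 : ∀ v, S.bracket v (f (2 * (l + 1))) = 0 := fun v => hR2 v (2 * l)
      have e2 : ∀ v, S.bracket v (f (2 * (l + 1) + 1)) = 0 := fun v => hR2 v (2 * l + 1)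
      rcases k with _ | k
      · rw [mul_zero, h.f_f, e2, e1, e1]; simp
      · have e3 : ∀ v, S.bracket v (f (2 * (k + 1))) = 0 := fun v => hR2 v (2 * k)
        rw [e3, e3, e1]; simp

end HasChain

/-! ### The nilradical of a superalgebra with a chain basis -/

/-- The span of the vectors `f_j`, `j ≥ k`. -/
def chainTail {L : Type*} [AddCommGroup L] [Module ℂ L] (f : ℕ → L) (k : ℕ) : Submodule ℂ L :=
  Submodule.span ℂ (f '' Set.Ici k)

section

variable {L : Type*} [AddCommGroup L] [Module ℂ L] {f : ℕ → L}

theorem mem_chainTail {k j : ℕ} (h : k ≤ j) : f j ∈ chainTail f k :=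
  Submodule.subset_span ⟨j, h, rfl⟩

theorem chainTail_le {k : ℕ} {W : Submodule ℂ L} (h : ∀ j, k ≤ j → f j ∈ W) :
    chainTail f k ≤ W := by
  refine Submodule.span_le.2 ?_
  rintro _ ⟨j, hj, rfl⟩
  exact h j hj

theorem chainTail_anti {k l : ℕ} (h : k ≤ l) : chainTail f l ≤ chainTail f k :=
  chainTail_le fun _ hj => mem_chainTail (h.trans hj)

end

namespace HasChain

variable {L : Type*} [AddCommGroup L] [Module ℂ L] {S : SuperAlgebra L} {n c : ℕ}
  {P : ChainParams c} {M : Submodule ℂ L} {f : ℕ → L} {g : L} {x : Fin c → L}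

theorem chainTail_eq_bot (h : HasChain S n P M f g x) : chainTail f (2 * n - 1) = ⊥ := by
  refine eq_bot_iff.2 (chainTail_le fun j hj => ?_)
  rw [h.f_zero j hj]; exact Submodule.zero_mem _

/-- Right multiplication by J descends one step in the sequence J, M, ⟨g⟩ + tail_1, tail_1, tail_2,
…. The level with g is needed because [f_0, w] may have a g-component when w is odd. -/
theorem isNilpotent_of_lowering {P : ChainParams 0} {x : Fin 0 → L} {J : S.GradedIdeal}
    (h : HasChain S n P M f g x)
    (hJ : ∀ v ∈ J.carrier, ∀ w ∈ J.carrier, S.bracket v w ∈ M)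
    (h0 : ∀ w ∈ J.carrier, S.bracket (f 0) w ∈ Submodule.span ℂ {g} ⊔ chainTail f 1)
    (hg : ∀ w ∈ J.carrier, S.bracket g w ∈ chainTail f 1)
    (hk : ∀ k, ∀ w ∈ J.carrier, S.bracket (f (k + 1)) w ∈ chainTail f (k + 2)) :
    (S.ofIdeal J).IsNilpotent := by
  have tail : ∀ w ∈ J.carrier, ∀ k,
      chainTail f (k + 1) ≤ (chainTail f (k + 2)).comap (S.bracket.flip w) := by
    intro w hw k
    refine chainTail_le fun j hj => ?_
    obtain ⟨j, rfl⟩ : ∃ i, j = i + 1 := ⟨j - 1, by omega⟩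
    exact chainTail_anti (by omega) (hk j w hw)
  refine SuperAlgebra.isNilpotent_of_filtration (G := fun k => match k with
    | 0 => J.carrier
    | 1 => M
    | 2 => Submodule.span ℂ {g} ⊔ chainTail f 1
    -- This K falls under the last pattern and gives the tail from 2n + 1 on, which is zero.
    | k + 3 => chainTail f (k + 1)) le_rfl ?_ (K := 2 * n + 1 + 2) ?_
  · rintro (_ | _ | _ | k) v hv w hw
    · exact hJ v hv w hw
    · refine h.le_of_mem (W := (Submodule.span ℂ {g} ⊔ chainTail f 1).comap (S.bracket.flip w))
        (fun k => ?_) (Submodule.mem_sup_right (hg w hw)) (fun i => i.elim0) hv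
      rcases k with _ | k
      · exact h0 w hw
      · exact Submodule.mem_sup_right (chainTail_anti (by omega) (hk k w hw))
    · have : Submodule.span ℂ {g} ⊔ chainTail f 1 ≤ (chainTail f 1).comap (S.bracket.flip w) := by
        refine sup_le ?_ ((tail w hw 0).trans (Submodule.comap_mono (chainTail_anti (by omega))))
        rw [Submodule.span_singleton_le_iff_mem]
        exact hg w hw
      exact this hv
    · exact tail w hw k hv
  · exact eq_bot_iff.2 (le_trans (chainTail_anti (by omega)) h.chainTail_eq_bot.le)

/-- The ideal spanned by the vectors `f_k` and `g`. -/
noncomputable def nilIdeal (h : HasChain S n P ⊤ f g x) : S.GradedIdeal where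
  carrier := ⨅ i, LinearMap.ker (h.cx i)
  graded := by
    intro v hv
    obtain ⟨a, ha, b, hb, rfl⟩ := S.exists_parts v
    have h1 : ∀ i, h.cx i b = 0 := h.cx_of_odd Submodule.mem_top hb
    simp only [Submodule.mem_iInf, LinearMap.mem_ker, map_add, h1, add_zero] at hv
    exact Submodule.mem_sup.2 ⟨a, ⟨by simpa using hv, ha⟩, b, ⟨by simpa using h1, hb⟩, rfl⟩
  mul_mem_left u v _ := by simp [h.cx_bracket _ Submodule.mem_top Submodule.mem_top]
  mul_mem_right u v _ := by simp [h.cx_bracket _ Submodule.mem_top Submodule.mem_top]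

theorem mem_nilIdeal (h : HasChain S n P ⊤ f g x) {v : L} :
    v ∈ h.nilIdeal.carrier ↔ ∀ i, h.cx i v = 0 := by
  simp [nilIdeal]

theorem bracket_mem_nilIdeal (h : HasChain S n P ⊤ f g x) (u v : L) :
    S.bracket u v ∈ h.nilIdeal.carrier :=
  h.mem_nilIdeal.2 fun i => h.cx_bracket i Submodule.mem_top Submodule.mem_top

theorem nilIdeal_hasChain (h : HasChain S n P ⊤ f g x) :
    HasChain S n default h.nilIdeal.carrier f g Fin.elim0 where
  li := by
    have hc : chainFamily n f g Fin.elim0 =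
        chainFamily n f g x ∘ (Sum.map id Fin.elim0 : (Fin (2 * n - 1) ⊕ Unit) ⊕ Fin 0 → _) := by
      funext i
      rcases i with i | i
      · rfl
      · exact i.elim0
    rw [hc]
    refine h.li.comp _ ?_
    rintro (a | a) (b | b) hab
    · simpa using hab
    · exact b.elim0
    · exact a.elim0
    · exact a.elim0
  span_eq := by
    refine le_antisymm (Submodule.span_le.2 ?_) fun v hv => ?_
    · rintro _ ⟨(i | i) | i, rfl⟩
      · exact h.mem_nilIdeal.2 fun j => h.cx_f j i
      · exact h.mem_nilIdeal.2 fun j => h.cx_g j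
      · exact i.elim0
    · rw [h.expand (Submodule.mem_top (x := v))]
      simp only [h.mem_nilIdeal.1 hv, zero_smul, Finset.sum_const_zero, add_zero]
      refine add_mem (sum_mem fun k hk => Submodule.smul_mem _ _ (Submodule.subset_span ?_))
        (Submodule.smul_mem _ _ (Submodule.subset_span ?_))
      · exact ⟨.inl (.inl ⟨k, Finset.mem_range.1 hk⟩), rfl⟩
      · exact ⟨.inl (.inr ()), rfl⟩
  f_zero := h.f_zero
  f_odd := h.f_odd
  f_even := h.f_even
  g_mem := h.g_mem
  x_mem i := i.elim0
  f_f := h.f_f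
  g_f := h.g_f
  x_f i := i.elim0
  f_one v _ := h.f_one v Submodule.mem_top
  f_ge v _ := h.f_ge v Submodule.mem_top
  f_g := h.f_g
  g_g := h.g_g
  x_g i := i.elim0
  f_x _ i := i.elim0
  g_x i := i.elim0
  x_x i := i.elim0

theorem finrank_quotient (h : HasChain S n P ⊤ f g x) {P' : ChainParams 0} {N : Submodule ℂ L}
    {f' : ℕ → L} {g' : L} {x' : Fin 0 → L} (h' : HasChain S n P' N f' g' x') :
    Module.finrank ℂ (L ⧸ N) = c := by
  have h1 := h.finrank_eq
  have h2 := h'.finrank_eq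
  have := h.finite
  rw [finrank_top] at h1
  have : Module.Finite ℂ L := Module.Finite.equiv (Submodule.topEquiv (R := ℂ) (M := L))
  have h3 := N.finrank_quotient_add_finrank
  omega

theorem f_bracket_mem (h : HasChain S n P M f g x) {P' : ChainParams 0} {N : Submodule ℂ L}
    {x' : Fin 0 → L} (h' : HasChain S n P' N f g x') (k : ℕ) {w : L} (hw : w ∈ N) :
    S.bracket (f k) w ∈ chainTail f (k + 1) := by
  refine h'.le_of_mem (W := (chainTail f (k + 1)).comap (S.bracket (f k))) (fun j => ?_) ?_
    (fun i => i.elim0) hw <;> rw [Submodule.mem_comap]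
  · rcases j with _ | _ | j
    · rw [h.f_f]; exact mem_chainTail le_rfl
    · rw [h.f_bracket_one]; exact Submodule.smul_mem _ _ (mem_chainTail (by omega))
    · rw [h.f_ge _ (h.f_mem k) _ (by omega)]; exact Submodule.zero_mem _
  · rw [h.f_g]; exact Submodule.zero_mem _

theorem isNilpotent_nilIdeal (h : HasChain S n P ⊤ f g x) :
    (S.ofIdeal h.nilIdeal).IsNilpotent := by
  have h' := h.nilIdeal_hasChain
  refine h'.isNilpotent_of_lowering (fun v _ w _ => h.bracket_mem_nilIdeal v w)
    (fun w hw => Submodule.mem_sup_right (h'.f_bracket_mem h' 0 hw)) (fun w hw => ?_)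
    (fun k w hw => h'.f_bracket_mem h' (k + 1) hw)
  have : S.bracket g w = 0 := h'.eqOn (p := S.bracket g) (q := 0)
    (fun k _ => h'.g_bracket_f k) h'.g_g (fun i => i.elim0) hw
  rw [this]
  exact Submodule.zero_mem _

/-- On the ideal, R_v multiplies the f_0-coordinate by the α-weight of v, and in `cg_bracket` the
g-coordinate by its β-weight. A non-zero weight obstructs nilpotency. -/
theorem cf_zero_bracket (h : HasChain S n P ⊤ f g x) {u : L}
    (hu : u ∈ h.nilIdeal.carrier) (v : L) :
    h.cf 0 (S.bracket u v) = (∑ i, P.α i * h.cx i v) * h.cf 0 u := by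
  refine h.nilIdeal_hasChain.eqOn (p := h.cf 0 ∘ₗ S.bracket.flip v)
    (q := (∑ i, P.α i * h.cx i v) • h.cf 0) (fun k _ => ?_) ?_ (fun i => i.elim0) hu
  · obtain ⟨s, hs⟩ : ∃ s, h.cf 0 (f k) = s := ⟨_, rfl⟩
    have := h.eqOn (p := h.cf 0 ∘ₗ S.bracket (f k))
      (q := s • ∑ i, P.α i • h.cx i) (fun j _ => ?_) ?_ (fun i => ?_)
      (Submodule.mem_top (x := v))
    · simp only [LinearMap.comp_apply, LinearMap.flip_apply, LinearMap.smul_apply, hs]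
      simpa [LinearMap.sum_apply, mul_comm] using this
    · rcases j with _ | _ | j
      · simp [h.f_f, LinearMap.sum_apply]
      · simp [h.f_bracket_one, LinearMap.sum_apply]
      · simp [h.f_ge _ (h.f_mem k), LinearMap.sum_apply]
    · simp [h.f_g, LinearMap.sum_apply]
    · rw [← hs]
      simp only [LinearMap.comp_apply, h.f_x, map_add, map_smul, map_sum, cf_f, smul_eq_mul,
        LinearMap.smul_apply, LinearMap.sum_apply, cx_x]
      rw [Finset.sum_eq_zero fun j hj => ?_]
      · rcases k with _ | k <;> simp
      · rw [Finset.mem_Icc] at hj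
        rw [if_neg (by omega), mul_zero]
  · have := h.eqOn (p := h.cf 0 ∘ₗ S.bracket g) (q := 0) (fun j _ => ?_) ?_ (fun i => ?_)
      (Submodule.mem_top (x := v))
    · simpa using this
    · simp [h.g_bracket_f]
    · simp [h.g_g]
    · simp [h.g_x]

theorem cg_bracket (h : HasChain S n P ⊤ f g x) {u : L} (hu : u ∈ h.nilIdeal.carrier) (v : L) :
    h.cg (S.bracket u v) = (∑ i, P.β i * h.cx i v) * h.cg u := by
  refine h.nilIdeal_hasChain.eqOn (p := h.cg ∘ₗ S.bracket.flip v)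
    (q := (∑ i, P.β i * h.cx i v) • h.cg) (fun k _ => ?_) ?_ (fun i => i.elim0) hu
  · have := h.eqOn (p := h.cg ∘ₗ S.bracket (f k)) (q := 0) (fun j _ => ?_) ?_ (fun i => ?_)
      (Submodule.mem_top (x := v))
    · simpa using this
    · rcases j with _ | _ | j
      · simp [h.f_f]
      · simp [h.f_bracket_one]
      · simp [h.f_ge _ (h.f_mem k)]
    · simp [h.f_g]
    · simp [h.f_x]
  · have := h.eqOn (p := h.cg ∘ₗ S.bracket g) (q := ∑ i, P.β i • h.cx i) (fun j _ => ?_) ?_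
      (fun i => ?_) (Submodule.mem_top (x := v))
    · simpa [LinearMap.sum_apply] using this
    · simp [h.g_bracket_f, LinearMap.sum_apply]
    · simp [h.g_g, LinearMap.sum_apply]
    · simp [h.g_x, LinearMap.sum_apply]

/-- If v lies in a larger nilpotent ideal, both of its weights vanish, since otherwise R_v has a
non-zero eigenvalue on the coordinate of f_0 or of g. Then `hP` makes all x-coordinates of v zero.
-/
theorem isNilradical_nilIdeal (h : HasChain S n P ⊤ f g x) (hn : 1 ≤ n)
    (hP : ∀ r : Fin c → ℂ, ∑ i, P.α i * r i = 0 → ∑ i, P.β i * r i = 0 → r = 0) :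
    S.IsNilradical h.nilIdeal := by
  refine ⟨h.isNilpotent_nilIdeal, Submodule.map₂_le.2 fun u _ v _ => h.bracket_mem_nilIdeal u v,
    fun J hJ _ hN => le_antisymm (fun v hv => ?_) hN⟩
  have hf : f 0 ∈ h.nilIdeal.carrier := h.nilIdeal_hasChain.f_mem 0
  have hg : g ∈ h.nilIdeal.carrier := h.nilIdeal_hasChain.g_mem'
  have h1 : ∑ i, P.α i * h.cx i v = 0 := by
    by_contra hα
    refine SuperAlgebra.not_isNilpotent_of_eigen (h.cf 0) hv (hN hf) hf ?_ hα
      (fun u hu => ⟨h.bracket_mem_nilIdeal u v, h.cf_zero_bracket hu v⟩) hJ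
    rw [cf_f, if_pos (by omega)]
    exact one_ne_zero
  have h2 : ∑ i, P.β i * h.cx i v = 0 := by
    by_contra hβ
    refine SuperAlgebra.not_isNilpotent_of_eigen h.cg hv (hN hg) hg ?_ hβ
      (fun u hu => ⟨h.bracket_mem_nilIdeal u v, h.cg_bracket hu v⟩) hJ
    rw [cg_g]
    exact one_ne_zero
  exact h.mem_nilIdeal.2 (congrFun (hP _ h1 h2))

/-- For even x the Leibniz identity with y = z = x gives [x, [x, x]] = 0, and this product is ε δ g.
-/
theorem ε_mul_δ (h : HasChain S n P ⊤ f g x) (hS : S.IsLeibniz) (i : Fin c) :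
    P.ε i i * P.δ i = 0 := by
  have h1 := hS 0 0 (x i) _ _ (h.x_mem i) (h.x_mem i)
  rw [h.x_x, map_smul, h.x_g] at h1
  simpa using congrArg h.cg h1

end HasChain

/-! ### The listed superalgebras have the required properties -/

namespace HLabel

theorem isLeibniz {n : ℕ} (hn : 3 ≤ n) {l : HLabel} (hl : l.Admissible) (h5 : ∀ a, l ≠ .H5 1 a) :
    (l.alg n).IsLeibniz := by
  refine (l.hasChain hn).isLeibniz (fun i j k => ?_) (fun i j => ?_) (fun i j k => ?_)
  · cases l <;> simp [params]
  · cases l with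
    | MH1 | MH2 => revert i j; simp [params, codim, Fin.forall_fin_two]
    | _ => simp [params]
  · cases l with
    | MH1 | MH2 => simp [params]
    | H5 γ a =>
      have : γ = 0 := hl.resolve_right fun h => h5 a (by rw [h])
      simp [params, this]
    | _ => simp [params]

/-- Supplies the hypothesis of `isNilradical_nilIdeal`: the two weights separate the span of the
x_i. -/
theorem params_injective (l : HLabel) (r : Fin l.codim → ℂ)
    (h1 : ∑ i, l.params.α i * r i = 0) (h2 : ∑ i, l.params.β i * r i = 0) : r = 0 := by
  have key2 : ∀ r : Fin 2 → ℂ, ∑ i, (![1, 0] i : ℂ) * r i = 0 → ∑ i, (![0, 1] i : ℂ) * r i = 0 →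
      r = 0 := by
    intro r h1 h2
    rw [Fin.sum_univ_two] at h1 h2
    funext i
    fin_cases i
    · simpa using h1
    · simpa using h2
  have key1 : ∀ (s t : ℂ) (r : Fin 1 → ℂ), s = 1 ∨ t = 1 → ∑ i, s * r i = 0 → ∑ i, t * r i = 0 →
      r = 0 := by
    intro s t r hst h1 h2
    rw [Fin.sum_univ_one] at h1 h2
    funext i
    fin_cases i
    rcases hst with rfl | rfl
    · simpa using h1
    · simpa using h2
  cases l with
  | MH1 | MH2 => exact key2 r h1 h2
  | H1 | H2 | H3 => exact key1 _ _ r (.inl rfl) h1 h2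
  | H4 | H5 => exact key1 _ _ r (.inr rfl) h1 h2

theorem codim_pos (l : HLabel) : 0 < l.codim := by cases l <;> simp [codim]

theorem exists_nilradical {n : ℕ} (hn : 3 ≤ n) (l : HLabel) :
    (l.alg n).IsSolvable ∧ ¬ (l.alg n).IsNilpotent ∧
      ∃ N : (l.alg n).GradedIdeal, (l.alg n).IsNilradical N ∧
        ((l.alg n).ofIdeal N).Iso (algH0 n) ∧
        Module.finrank ℂ (HVec n l.codim ⧸ N.carrier) = l.codim := by
  have h := l.hasChain hn
  have hN := h.isNilradical_nilIdeal (by omega) l.params_injective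
  refine ⟨SuperAlgebra.isSolvable_of_isNilpotent_ideal hN.1 hN.2.1, hN.not_isNilpotent ?_,
    h.nilIdeal, hN, h.nilIdeal_hasChain.toIdeal.iso (algH0_hasChain hn),
    h.finrank_quotient h.nilIdeal_hasChain⟩
  intro ht
  have h1 : xVec n l.codim ⟨0, l.codim_pos⟩ ∈ h.nilIdeal.carrier := by
    rw [ht]; exact Submodule.mem_top
  simpa using h.mem_nilIdeal.1 h1 ⟨0, l.codim_pos⟩

/-- Here ε = 1 and δ = -1, against ε δ = 0. -/
theorem H5_one_not_isLeibniz {n : ℕ} (hn : 3 ≤ n) (a : ℕ → ℂ) :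
    ¬ (HLabel.alg n (.H5 1 a)).IsLeibniz := by
  intro hL
  have h := ((HLabel.H5 1 a).hasChain hn).ε_mul_δ (c := 1) hL 0
  simp [params] at h

end HLabel

/-! ### Comparison of two chain bases -/

namespace HasChain

variable {L : Type*} [AddCommGroup L] [Module ℂ L] {S : SuperAlgebra L} {n c : ℕ}
  {P P' : ChainParams c} {M : Submodule ℂ L} {f f' : ℕ → L} {g g' : L} {x x' : Fin c → L}

theorem f_ne_zero (h : HasChain S n P M f g x) {k : ℕ} (hk : k < 2 * n - 1) : f k ≠ 0 := by
  intro h0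
  have := h.cf_f k k
  rw [h0, map_zero, if_pos ⟨rfl, hk⟩] at this
  exact zero_ne_one this

theorem g_ne_zero (h : HasChain S n P M f g x) : g ≠ 0 :=
  fun h0 => zero_ne_one ((map_zero h.cg).symm.trans ((congrArg h.cg h0.symm).trans h.cg_g))

/-- Rescaling of a chain basis. -/
theorem rescale (h : HasChain S n P M f g x) {s q : ℂ} (hs : s ≠ 0) (hq : q ≠ 0)
    (hα : P'.α = P.α) (hβ : P'.β = P.β) (hδ : P'.δ = P.δ) (hε : ∀ i j, P.ε i j = P'.ε i j * q)
    (ha : ∀ i j, 1 ≤ j → j < n → P.a i j = s ^ (2 * j) * P'.a i j) :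
    HasChain S n P' M (fun k => s ^ (k + 1) • f k) (q • g) x where
  li := by
    have hc : chainFamily n (fun k => s ^ (k + 1) • f k) (q • g) x =
        (Sum.elim (Sum.elim (fun k => Units.mk0 s hs ^ ((k : ℕ) + 1)) (fun _ => Units.mk0 q hq))
          (fun _ => 1) : (Fin (2 * n - 1) ⊕ Unit) ⊕ Fin c → ℂˣ) • chainFamily n f g x := by
      funext i
      rcases i with (i | i) | i
      · simp [chainFamily, Units.smul_def]
      · simp [chainFamily, Units.smul_def]
      · simp [chainFamily]
    rw [hc]
    exact h.li.units_smul _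
  span_eq := by
    refine le_antisymm (Submodule.span_le.2 ?_) ?_
    · rintro _ ⟨(i | i) | i, rfl⟩
      · exact M.smul_mem _ (h.f_mem i)
      · exact M.smul_mem _ h.g_mem'
      · exact h.x_mem' i
    · set W := Submodule.span ℂ (Set.range (chainFamily n (fun k => s ^ (k + 1) • f k) (q • g) x))
      refine h.le_of_mem (fun k => ?_) ?_ (fun i => Submodule.subset_span ⟨.inr i, rfl⟩)
      · by_cases hk : k < 2 * n - 1
        · have : s ^ (k + 1) • f k ∈ W := Submodule.subset_span ⟨.inl (.inl ⟨k, hk⟩), rfl⟩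
          exact (W.smul_mem_iff (pow_ne_zero _ hs)).1 this
        · rw [h.f_zero k (by omega)]; exact W.zero_mem
      · have : q • g ∈ W := Submodule.subset_span ⟨.inl (.inr ()), rfl⟩
        exact (W.smul_mem_iff hq).1 this
  f_zero k hk := by rw [h.f_zero k hk, smul_zero]
  f_odd j := Submodule.smul_mem _ _ (h.f_odd j)
  f_even j := Submodule.smul_mem _ _ (h.f_even j)
  g_mem := Submodule.smul_mem _ _ h.g_mem
  x_mem := h.x_mem
  f_f k := by
    rw [map_smul, map_smul, LinearMap.smul_apply, h.f_f, smul_smul]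
    congr 1; ring
  g_f := by rw [map_smul, map_smul, LinearMap.smul_apply, h.g_f, smul_zero, smul_zero]
  x_f i := by rw [map_smul, h.x_f, hα, smul_comm]
  f_one v hv := by
    simp only [map_smul, h.f_one v hv, LinearMap.smul_apply, smul_smul]
    congr 1; ring
  f_ge v hv j hj := by rw [map_smul, h.f_ge v hv j hj, smul_zero]
  f_g k := by rw [map_smul, map_smul, LinearMap.smul_apply, h.f_g, smul_zero, smul_zero]
  g_g := by rw [map_smul, map_smul, LinearMap.smul_apply, h.g_g, smul_zero, smul_zero]
  x_g i := by rw [map_smul, h.x_g, hδ, smul_comm]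
  f_x k i := by
    rw [map_smul, LinearMap.smul_apply, h.f_x, hα, smul_add, smul_comm, Finset.smul_sum]
    congr 1
    refine Finset.sum_congr rfl fun j hj => ?_
    rw [Finset.mem_Icc] at hj
    rw [ha i j (by omega) (by omega), smul_smul, smul_smul]
    congr 1; ring
  g_x i := by rw [map_smul, LinearMap.smul_apply, h.g_x, hβ, smul_comm]
  x_x i j := by rw [h.x_x, hε, smul_smul]

/-- All f_{2j} with j ≥ 1 have zero right multiplication, so an odd element acts through its
f_0-coordinate. In particular any other odd generator acts as a multiple of f_0. -/
theorem bracket_odd (h : HasChain S n P M f g x) {v w : L} (hv : v ∈ M) (hwM : w ∈ M)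
    (hw : w ∈ S.part 1) : S.bracket v w = h.cf 0 w • S.bracket v (f 0) := by
  refine h.eqOn_odd (p := S.bracket v) (q := (h.cf 0).smulRight (S.bracket v (f 0)))
    (fun k => ?_) hwM hw
  rcases k with _ | k
  · by_cases hn : 0 < 2 * n - 1
    · simp [hn]
    · rw [h.f_zero _ (by omega)]; simp
  · rw [h.f_ge v hv _ (by omega)]; simp

theorem cf_succ_bracket (h : HasChain S n P M f g x) {k : ℕ} (hk : k + 1 < 2 * n - 1) {v : L}
    (hv : v ∈ M) : h.cf (k + 1) (S.bracket v (f 0)) = h.cf k v := by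
  refine h.eqOn (p := h.cf (k + 1) ∘ₗ S.bracket.flip (f 0)) (q := h.cf k)
    (fun j _ => ?_) ?_ (fun i => ?_) hv <;>
    simp only [LinearMap.comp_apply, LinearMap.flip_apply]
  · rw [h.f_f, cf_f, cf_f]
    congr 1
    simp only [Nat.add_right_cancel_iff, hk, and_true, eq_iff_iff]
    exact ⟨fun hj => ⟨hj, by omega⟩, fun hj => hj.1⟩
  · rw [h.g_f, map_zero, cf_g]
  · rw [h.x_f, map_smul, cf_x, cf_f, if_neg (by omega), smul_zero]

theorem cf_zero_bracket_f (h : HasChain S n P M f g x) (hn : 1 ≤ n) {v : L} (hv : v ∈ M) :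
    h.cf 0 (S.bracket v (f 0)) = -∑ i, P.α i * h.cx i v := by
  have := h.eqOn (p := h.cf 0 ∘ₗ S.bracket.flip (f 0)) (q := -∑ i, P.α i • h.cx i)
    (fun j _ => ?_) ?_ (fun i => ?_) hv
  · simpa [LinearMap.sum_apply] using this
  · simp [h.f_f, LinearMap.sum_apply]
  · simp [h.g_f, LinearMap.sum_apply]
  · have : 1 < 2 * n := by omega
    simp [h.x_f, LinearMap.sum_apply, this]

/-- Even elements which are annihilated by the right multiplication by `f 0`. -/
theorem eq_of_bracket_f_eq_zero (h : HasChain S n P M f g x) (hn : 1 ≤ n) {w : L}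
    (hwM : w ∈ M) (hw : w ∈ S.part 0) (h0 : S.bracket w (f 0) = 0) :
    w = h.cg w • g + ∑ i, h.cx i w • x i ∧ ∑ i, P.α i * h.cx i w = 0 := by
  constructor
  · conv_lhs => rw [h.expand_even hwM hw]
    rw [Finset.sum_eq_zero, zero_add]
    intro j hj
    rw [Finset.mem_range] at hj
    rw [← h.cf_succ_bracket (by omega) hwM, h0, map_zero, zero_smul]
  · have := h.cf_zero_bracket_f hn hwM
    rw [h0, map_zero] at this
    exact neg_eq_zero.1 this.symm

/-- The g-coordinate of a product sees only the g- and x-coordinates of the factors. Evaluated on a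
second chain basis, the formula reads off its β, δ and ε. -/
theorem cg_bracket_eq (h : HasChain S n P ⊤ f g x) (u v : L) :
    h.cg (S.bracket u v) = h.cg u * ∑ i, P.β i * h.cx i v + (∑ i, P.δ i * h.cx i u) * h.cg v +
      ∑ i, ∑ j, P.ε i j * h.cx i u * h.cx j v := by
  have := h.eqOn (p := h.cg ∘ₗ S.bracket u) (q := h.cg u • ∑ i, P.β i • h.cx i +
    (∑ i, P.δ i * h.cx i u) • h.cg + ∑ i, ∑ j, (P.ε i j * h.cx i u) • h.cx j)
    (fun j _ => ?_) ?_ (fun i => ?_) (Submodule.mem_top (x := v))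
  · simpa [LinearMap.sum_apply, Finset.mul_sum] using this
  · have h1 : ∀ u, h.cg (S.bracket u (f 0)) = 0 := fun u =>
      h.eqOn (p := h.cg ∘ₗ S.bracket.flip (f 0)) (q := 0) (fun k _ => by simp [h.f_f])
        (by simp [h.g_f]) (fun i => by simp [h.x_f]) (Submodule.mem_top (x := u))
    have h2 : h.cg (S.bracket u (f j)) = 0 := by
      rcases j with _ | _ | j
      · exact h1 u
      · rw [h.f_one u Submodule.mem_top, map_smul, h1, smul_zero]
      · rw [h.f_ge u Submodule.mem_top _ (by omega), map_zero]
    simp [h2, LinearMap.sum_apply]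
  · rw [LinearMap.comp_apply, h.bracket_g Submodule.mem_top]
    simp [LinearMap.sum_apply]
  · have := h.eqOn (p := h.cg ∘ₗ S.bracket.flip (x i)) (q := P.β i • h.cg +
      ∑ l, P.ε l i • h.cx l) (fun k _ => ?_) ?_ (fun l => ?_) (Submodule.mem_top (x := u))
    · simp only [LinearMap.comp_apply, LinearMap.flip_apply] at this ⊢
      rw [this]
      simp [LinearMap.sum_apply, mul_comm]
    · simp [h.f_x, LinearMap.sum_apply]
    · simp [h.g_x, LinearMap.sum_apply]
    · simp [h.x_x, LinearMap.sum_apply]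

theorem bracket_odd_g (h : HasChain S n P ⊤ f g x) {w : L} (hw : w ∈ S.part 1) :
    S.bracket w g = 0 := by
  rw [h.bracket_g Submodule.mem_top]
  simp [h.cx_of_odd Submodule.mem_top hw]

/-- Otherwise R_{f'_0} = 0 and f'_1 = [f'_0, f'_0] would vanish. -/
theorem cf_zero_ne_zero (h : HasChain S n P ⊤ f g x) (h' : HasChain S n P' ⊤ f' g' x') (hn : 2 ≤ n)
    : h.cf 0 (f' 0) ≠ 0 := by
  intro h0
  refine h'.f_ne_zero (k := 1) (by omega) ?_
  have h1 := h'.f_odd 0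
  rw [mul_zero] at h1
  rw [← h'.f_f 0, h.bracket_odd Submodule.mem_top Submodule.mem_top h1, h0, zero_smul]

theorem bracket_f_eq (h : HasChain S n P ⊤ f g x) (h' : HasChain S n P' ⊤ f' g' x')
    (v : L) : S.bracket v (f' 0) = h.cf 0 (f' 0) • S.bracket v (f 0) :=
  h.bracket_odd Submodule.mem_top Submodule.mem_top (by simpa using h'.f_odd 0)

theorem α_eq (h : HasChain S n P ⊤ f g x) (h' : HasChain S n P' ⊤ f' g' x') (hn : 2 ≤ n)
    (i : Fin c) : P'.α i = ∑ l, P.α l * h.cx l (x' i) := by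
  have hN : ∀ k, f' k ∈ h.nilIdeal.carrier := by
    intro k
    rcases k with _ | k
    · exact h.mem_nilIdeal.2 (h.cx_of_odd Submodule.mem_top (by simpa using h'.f_odd 0))
    · rw [← h'.f_f]; exact h.bracket_mem_nilIdeal _ _
  -- Each f'_{k+1} is a multiple of [f'_k, f_0], and f_0 has α-weight zero.
  have h1 : ∀ k, h.cf 0 (f' (k + 1)) = 0 := by
    intro k
    rw [← h'.f_f, h.bracket_f_eq h', map_smul, h.cf_zero_bracket (hN k)]
    simp
  have h2 := h.cf_zero_bracket (hN 0) (x' i)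
  rw [h'.f_x, map_add, map_smul, map_sum, Finset.sum_eq_zero, add_zero] at h2
  · refine mul_right_cancel₀ (h.cf_zero_ne_zero h' hn) ?_
    simpa using h2
  · intro j hj
    rw [Finset.mem_Icc] at hj
    rw [map_smul, show 0 + 2 * j = 2 * j - 1 + 1 by omega, h1, smul_zero]

theorem g_bracket_f_eq_zero (h : HasChain S n P ⊤ f g x) (h' : HasChain S n P' ⊤ f' g' x') (hn : 2 ≤ n)
    : S.bracket g' (f 0) = 0 := by
  have := h.bracket_f_eq h' g'
  rw [h'.g_f] at this
  exact (smul_eq_zero.1 this.symm).resolve_left (h.cf_zero_ne_zero h' hn)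

theorem α_cx_g (h : HasChain S n P ⊤ f g x) (h' : HasChain S n P' ⊤ f' g' x') (hn : 2 ≤ n)
    : ∑ i, P.α i * h.cx i g' = 0 :=
  (h.eq_of_bracket_f_eq_zero (by omega) Submodule.mem_top h'.g_mem (h.g_bracket_f_eq_zero h' hn)).2

theorem g_eq (h : HasChain S n P ⊤ f g x) (h' : HasChain S n P' ⊤ f' g' x') (hn : 2 ≤ n)
    (hx : ∀ i, h.cx i g' = 0) : g' = h.cg g' • g := by
  have := (h.eq_of_bracket_f_eq_zero (by omega) Submodule.mem_top h'.g_mem (h.g_bracket_f_eq_zero h' hn)).1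
  simpa [hx] using this

/-- If β'_i ≠ 0, then g' is a multiple of the product [g', x'_i], and products have no
x-coordinates. -/
theorem cx_g_of_β (h : HasChain S n P ⊤ f g x) (h' : HasChain S n P' ⊤ f' g' x')
    {i : Fin c} (hi : P'.β i ≠ 0) (l : Fin c) : h.cx l g' = 0 := by
  have h1 := h.cx_bracket l (Submodule.mem_top (x := g')) (Submodule.mem_top (x := x' i))
  rw [h'.g_x, map_smul] at h1
  exact (smul_eq_zero.1 h1).resolve_left hi

theorem cg_g_ne_zero (h : HasChain S n P ⊤ f g x) (h' : HasChain S n P' ⊤ f' g' x') (hn : 2 ≤ n)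
    (hx : ∀ i, h.cx i g' = 0) : h.cg g' ≠ 0 := by
  intro h0
  refine h'.g_ne_zero ?_
  rw [h.g_eq h' hn hx, h0, zero_smul]

theorem β_eq (h : HasChain S n P ⊤ f g x) (h' : HasChain S n P' ⊤ f' g' x') (hn : 2 ≤ n)
    (hx : ∀ i, h.cx i g' = 0) (i : Fin c) : P'.β i = ∑ l, P.β l * h.cx l (x' i) := by
  have h1 := h.cg_bracket_eq g' (x' i)
  rw [h'.g_x, map_smul] at h1
  refine mul_right_cancel₀ (h.cg_g_ne_zero h' hn hx) ?_
  simpa [hx, mul_comm] using h1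

theorem δ_eq (h : HasChain S n P ⊤ f g x) (h' : HasChain S n P' ⊤ f' g' x') (hn : 2 ≤ n)
    (hx : ∀ i, h.cx i g' = 0) (i : Fin c) : P'.δ i = ∑ l, P.δ l * h.cx l (x' i) := by
  have h1 := h.cg_bracket_eq (x' i) g'
  rw [h'.x_g, map_smul] at h1
  refine mul_right_cancel₀ (h.cg_g_ne_zero h' hn hx) ?_
  simpa [hx, mul_comm] using h1

end HasChain

namespace HasChain

variable {L : Type*} [AddCommGroup L] [Module ℂ L] {S : SuperAlgebra L} {n c : ℕ}
  {P P' : ChainParams c} {M : Submodule ℂ L} {f f' : ℕ → L} {g g' : L} {x x' : Fin c → L}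

theorem pow_bracket_f (h : HasChain S n P M f g x) (i k : ℕ) :
    (S.bracket.flip (f 0) ^ i) (f k) = f (k + i) := by
  induction i with
  | zero => rfl
  | succ i ih =>
    rw [pow_succ', Module.End.mul_apply, ih, LinearMap.flip_apply, h.f_f]; rfl

theorem f_eq_pow (h : HasChain S n P ⊤ f g x) (h' : HasChain S n P' ⊤ f' g' x') (k : ℕ) :
    f' k = h.cf 0 (f' 0) ^ k • (S.bracket.flip (f 0) ^ k) (f' 0) := by
  induction k with
  | zero => simp
  | succ k ih =>
    rw [← h'.f_f, h.bracket_f_eq h', pow_succ' (S.bracket.flip (f 0)), Module.End.mul_apply,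
      LinearMap.flip_apply]
    conv_lhs => rw [ih]
    rw [map_smul, LinearMap.smul_apply, smul_smul, pow_succ']

/-- When α_i = 0, R_{x_i} is a polynomial in R_{f_0} on the odd part, a form independent of the
chosen generator. -/
theorem bracket_x_of_odd (h : HasChain S n P ⊤ f g x) {i : Fin c} (hα : P.α i = 0) {w : L}
    (hw : w ∈ S.part 1) : S.bracket w (x i) =
      ∑ j ∈ Finset.Icc 1 (n - 1), P.a i j • (S.bracket.flip (f 0) ^ (2 * j)) w := by
  have := h.eqOn_odd (p := S.bracket.flip (x i))
    (q := ∑ j ∈ Finset.Icc 1 (n - 1), P.a i j • S.bracket.flip (f 0) ^ (2 * j))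
    (fun k => ?_) Submodule.mem_top hw
  · simpa [LinearMap.sum_apply] using this
  · simp [LinearMap.sum_apply, h.f_x, hα, h.pow_bracket_f]

/-- Compute [f'_0, x'] twice: as Σ a'_j f'_{2j}, and as Σ a_j R_{f_0}^{2j} f'_0 with R_{f_0} = p⁻¹
R_{f'_0}. Comparing coefficients gives a_j = p^{2j} a'_j. -/
theorem a_eq {P P' : ChainParams 1} {x x' : Fin 1 → L} (h : HasChain S n P ⊤ f g x)
    (h' : HasChain S n P' ⊤ f' g' x') (hn : 2 ≤ n) (hα : P.α 0 = 0) (hα' : P'.α 0 = 0)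
    (hx : h.cx 0 (x' 0) = 1) {j : ℕ} (hj : 1 ≤ j) (hjn : j < n) :
    P.a 0 j = h.cf 0 (f' 0) ^ (2 * j) * P'.a 0 j := by
  set p := h.cf 0 (f' 0) with hp
  have hp0 : p ≠ 0 := h.cf_zero_ne_zero h' hn
  have h1 : f' 0 ∈ S.part 1 := by simpa using h'.f_odd 0
  have h2 : S.bracket (x' 0) (f 0) = 0 := by
    have := h.bracket_f_eq h' (x' 0)
    rw [h'.x_f, hα', neg_zero, zero_smul] at this
    exact (smul_eq_zero.1 this.symm).resolve_left hp0
  -- Being killed by R_{f_0}, x' differs from x by a multiple of g, which does not act on odd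
  -- elements from the right.
  have h3 := (h.eq_of_bracket_f_eq_zero (by omega) Submodule.mem_top (h'.x_mem 0) h2).1
  rw [Fin.sum_univ_one, hx, one_smul] at h3
  have h4 : S.bracket (f' 0) (x' 0) = S.bracket (f' 0) (x 0) := by
    rw [h3, map_add, map_smul, h.bracket_odd_g h1, smul_zero, zero_add]
  rw [h'.f_x, hα', h.bracket_x_of_odd hα h1] at h4
  have h5 : ∀ k, (S.bracket.flip (f 0) ^ k) (f' 0) = (p ^ k)⁻¹ • f' k := fun k => by
    rw [h.f_eq_pow h' k, smul_smul, inv_mul_cancel₀ (pow_ne_zero _ hp0), one_smul]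
  simp only [h5] at h4
  have h6 := congrArg (h'.cf (2 * j)) h4
  simp only [mul_zero, zero_smul, zero_add, map_sum, map_smul, cf_f, smul_eq_mul] at h6
  rw [Finset.sum_eq_single j, Finset.sum_eq_single j, if_pos (by omega)] at h6
  · rw [mul_one, mul_one] at h6
    rw [h6, mul_left_comm, mul_inv_cancel₀ (pow_ne_zero _ hp0), mul_one]
  · intro b _ hb; rw [if_neg (by omega)]; ring
  · intro hb; rw [Finset.mem_Icc] at hb; omega
  · intro b _ hb; rw [if_neg (by omega)]; ring
  · intro hb; rw [Finset.mem_Icc] at hb; omega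

/-- The structure constants in the case of codimension one are unique up to scaling. -/
theorem compare_one {P P' : ChainParams 1} {x x' : Fin 1 → L} (h : HasChain S n P ⊤ f g x)
    (h' : HasChain S n P' ⊤ f' g' x') (hn : 2 ≤ n)
    (hP : P.α 0 = 1 ∨ P.α 0 = 0 ∧ P.β 0 = 1) (hP' : P'.α 0 = 1 ∨ P'.α 0 = 0 ∧ P'.β 0 = 1) :
    P'.α 0 = P.α 0 ∧ P'.β 0 = P.β 0 ∧ P'.δ 0 = P.δ 0 ∧
      (∃ q w : ℂ, q ≠ 0 ∧ P'.ε 0 0 * q = (P.β 0 + P.δ 0) * w + P.ε 0 0) ∧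
      (P.α 0 = 0 → ∃ p : ℂ, p ≠ 0 ∧ ∀ j, 1 ≤ j → j < n → P.a 0 j = p ^ (2 * j) * P'.a 0 j) := by
  have h1 := h.α_eq h' hn 0
  have h2 := h'.α_eq h hn 0
  rw [Fin.sum_univ_one] at h1 h2
  -- Each of α, α' is a multiple of the other, so they vanish together; a non-zero value is
  -- normalised to 1.
  have hα : P'.α 0 = P.α 0 := by
    rcases hP with hP | hP <;> rcases hP' with hP' | hP'
    · rw [hP, hP']
    · rw [hP'.1, zero_mul] at h2; rw [hP'.1, h2]
    · rw [hP.1, zero_mul] at h1; rw [hP.1, h1]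
    · rw [hP.1, hP'.1]
  -- For α = 1 this is `α_cx_g`; for α = 0 the normalisation gives β' = 1, and g' is a product.
  have hg : ∀ i, h.cx i g' = 0 := by
    intro i
    fin_cases i
    rcases hP with hP | hP
    · have := h.α_cx_g h' hn
      rw [Fin.sum_univ_one, hP, one_mul] at this
      exact this
    · have : P'.α 0 ≠ 1 := by rw [hα, hP.1]; exact zero_ne_one
      exact h.cx_g_of_β h' (i := 0) (by rw [(hP'.resolve_left this).2]; exact one_ne_zero) 0
  have h3 := h.β_eq h' hn hg 0
  have h4 := h.δ_eq h' hn hg 0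
  rw [Fin.sum_univ_one] at h3 h4
  have hs : h.cx 0 (x' 0) = 1 := by
    rcases hP with hP | hP
    · rw [hα, hP, one_mul] at h1; exact h1.symm
    · have : P'.α 0 ≠ 1 := by rw [hα, hP.1]; exact zero_ne_one
      rw [(hP'.resolve_left this).2, hP.2, one_mul] at h3; exact h3.symm
  rw [hs, mul_one] at h3 h4
  refine ⟨hα, h3, h4, ⟨h.cg g', h.cg (x' 0), h.cg_g_ne_zero h' hn hg, ?_⟩, fun h0 =>
    ⟨_, h.cf_zero_ne_zero h' hn, fun j hj hjn => h.a_eq h' hn h0 (hα.trans h0) hs hj hjn⟩⟩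
  -- Since x' has x-coordinate 1, the g-coordinate of [x', x'] is (β + δ)w + ε, with w the
  -- g-coordinate of x'.
  have h5 := h.cg_bracket_eq (x' 0) (x' 0)
  rw [h'.x_x, map_smul] at h5
  simp only [Fin.sum_univ_one, hs, smul_eq_mul] at h5
  rw [h5]; ring

end HasChain

/-! ### Isomorphisms between members of the list -/

namespace HLabel

theorem codim_eq {n : ℕ} (hn : 3 ≤ n) {l l' : HLabel} (e : (l.alg n).Iso (l'.alg n)) :
    l.codim = l'.codim := by
  obtain ⟨f, g, x, h⟩ := (l.hasChain hn).exists_of_iso e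
  have h1 := h.finrank_eq
  rw [(l'.hasChain hn).finrank_eq] at h1
  omega

/-- As a linear form in the x-coordinates, δ is zero for MH₁ but not for MH₂. -/
theorem not_iso_MH {n : ℕ} (hn : 3 ≤ n) : ¬ (alg n MH1).Iso (alg n MH2) := by
  intro e
  obtain ⟨f, g, x, h⟩ := (MH1.hasChain hn).exists_of_iso e
  have h' := MH2.hasChain hn
  have hβ : MH2.params.β (1 : Fin 2) ≠ 0 := one_ne_zero
  have := h.δ_eq h' (by omega) (h.cx_g_of_β h' hβ) (1 : Fin 2)
  have h0 : ∀ i : Fin 2, MH1.params.δ i = 0 := by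
    intro i; fin_cases i <;> rfl
  rw [Finset.sum_eq_zero] at this
  · simp [params] at this
  · intro l _
    exact mul_eq_zero_of_left (h0 l) _

theorem Rescaled.symm {n : ℕ} {a a' : ℕ → ℂ} (h : Rescaled n a a') : Rescaled n a' a := by
  obtain ⟨t, ht, h⟩ := h
  refine ⟨t⁻¹, inv_ne_zero ht, fun k hk hkn => ?_⟩
  rw [h k hk hkn, ← mul_assoc, ← mul_pow, inv_mul_cancel₀ ht, one_pow, one_mul]

/-- The factor p^{2j} at index j = k - 1 is (p²)^{k-1}, so p² is the scaling factor from a' to a. -/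
theorem Rescaled.of_params {n : ℕ} {a a' : ℕ → ℂ} {p : ℂ} (hp : p ≠ 0)
    (h : ∀ j, 1 ≤ j → j < n → (2 : ℂ) ^ j * a (j + 1) = p ^ (2 * j) * (2 ^ j * a' (j + 1))) :
    Rescaled n a a' := by
  refine Rescaled.symm ⟨p ^ 2, pow_ne_zero _ hp, fun k hk hkn => ?_⟩
  have h1 := h (k - 1) (by omega) (by omega)
  rw [mul_left_comm, Nat.sub_add_cancel (by omega : 1 ≤ k)] at h1
  rw [← pow_mul]
  exact mul_left_cancel₀ (pow_ne_zero _ two_ne_zero) h1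

/-- The codimension is an invariant. In codimension one α, β, δ are invariants too; ε is one up to a
non-zero factor when β + δ = 0, as in H₁, H₂(0), H₃ and H₅; and a is one up to scaling when α = 0.
-/
theorem same_of_iso {n : ℕ} (hn : 3 ≤ n) {l l' : HLabel} (hl : l.Admissible)
    (hl' : l'.Admissible) (e : (l.alg n).Iso (l'.alg n)) : Same n l l' := by
  have hc := codim_eq hn e
  by_cases h2 : l.codim = 2
  · have h2' := hc.symm.trans h2
    cases l <;> simp only [codim, OfNat.one_ne_ofNat] at h2 <;>
      cases l' <;> simp only [codim, OfNat.one_ne_ofNat] at h2'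
    · trivial
    · exact not_iso_MH hn e
    · exact not_iso_MH hn e.symm
    · trivial
  obtain ⟨f, g, x, h⟩ := (l.hasChain hn).exists_of_iso e
  have h' := l'.hasChain hn
  cases l <;> cases l' <;> simp only [codim, OfNat.one_ne_ofNat, not_true_eq_false] at h2 hc <;>
    obtain ⟨e1, e2, e3, ⟨q, w, hq, e4⟩, e5⟩ := HasChain.compare_one h h' (by omega)
      (by simp [params]) (by simp [params]) <;>
    simp [params] at e1 e2 e3 e4 e5
  · exact e2.symm
  · exact hl e3
  · exact hl e3
  · exact hl' e3
  · exact e2.symm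
  -- H₂(b) against H₃: b = 0, and the relation for ε reads q = 0.
  · exact hq (by rw [e4, ← e2, zero_mul])
  · trivial
  · obtain ⟨p, hp, hj⟩ := e5
    exact Rescaled.of_params hp hj
  · obtain ⟨p, hp, hj⟩ := e5
    refine ⟨?_, Rescaled.of_params hp hj⟩
    rcases hl with hl | hl <;> rcases hl' with hl' | hl' <;> simp [hl, hl', hq] at e4 ⊢

/-- Replacing f_0 by a multiple s f_0 changes the parameters through powers of s², so a square root
of the scaling factor is needed. -/
theorem Rescaled.exists_params {n : ℕ} {a a' : ℕ → ℂ} (h : Rescaled n a a') : ∃ s : ℂ, s ≠ 0 ∧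
    ∀ j, 1 ≤ j → j < n → (2 : ℂ) ^ j * a (j + 1) = s ^ (2 * j) * (2 ^ j * a' (j + 1)) := by
  obtain ⟨t, ht, h⟩ := h.symm
  obtain ⟨s, hs⟩ := IsAlgClosed.exists_pow_nat_eq t (n := 2) two_pos
  refine ⟨s, fun h0 => ht (by rw [← hs, h0, zero_pow two_ne_zero]), fun j hj hjn => ?_⟩
  rw [h (j + 1) (by omega) (by omega), pow_mul, hs, Nat.add_sub_cancel]
  ring

theorem iso_of_same {n : ℕ} (hn : 3 ≤ n) {l l' : HLabel} (h : Same n l l') :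
    (l.alg n).Iso (l'.alg n) := by
  cases l with
  | H4 a =>
    rcases l' with _ | _ | _ | _ | _ | a' | _ <;> try exact h.elim
    obtain ⟨s, hs, ha⟩ := Rescaled.exists_params h
    refine (((H4 a).hasChain hn).rescale (P' := (H4 a').params) hs one_ne_zero rfl rfl rfl (fun i j => ?_)
      (fun i j hj hjn => ha j hj hjn)).iso (hasChain hn _)
    simp [params]
  | H5 γ a =>
    rcases l' with _ | _ | _ | _ | _ | _ | ⟨γ', a'⟩ <;> try exact h.elim
    obtain ⟨rfl, h⟩ := h
    obtain ⟨s, hs, ha⟩ := Rescaled.exists_params h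
    refine (((H5 γ a).hasChain hn).rescale (P' := (H5 γ a').params) hs one_ne_zero rfl rfl rfl (fun i j => ?_)
      (fun i j hj hjn => ha j hj hjn)).iso (hasChain hn _)
    simp [params]
  | _ =>
    cases l' <;> first
      | exact h.elim
      | (obtain rfl := h; exact (hasChain hn _).iso (hasChain hn _))
      | exact (hasChain hn _).iso (hasChain hn _)

/-- If a_m is the first non-zero entry, scale by an (m-1)-st root of its inverse. -/
theorem exists_rescaled_firstIsOne (n : ℕ) (a : ℕ → ℂ) :
    ∃ a', Rescaled n a a' ∧ FirstIsOne n a' := by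
  by_cases h : ∃ k, 2 ≤ k ∧ k ≤ n ∧ a k ≠ 0
  · classical
    obtain ⟨h2, hn, h0⟩ := Nat.find_spec h
    set m := Nat.find h with hm
    obtain ⟨t, ht⟩ := IsAlgClosed.exists_pow_nat_eq (a m)⁻¹ (n := m - 1) (by omega)
    have ht0 : t ≠ 0 := by
      intro h1
      rw [h1, zero_pow (by omega)] at ht
      exact inv_ne_zero h0 ht.symm
    refine ⟨fun k => t ^ (k - 1) * a k, ⟨t, ht0, fun k _ _ => rfl⟩, fun k hk hkn hk0 hlt => ?_⟩
    have h1 : a k ≠ 0 := right_ne_zero_of_mul hk0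
    have h3 : m = k := by
      refine le_antisymm (Nat.find_le ⟨hk, hkn, h1⟩) (not_lt.1 fun hlt' => ?_)
      exact mul_ne_zero (pow_ne_zero _ ht0) h0 (hlt m h2 hlt')
    rw [← h3]
    change t ^ (m - 1) * a m = 1
    rw [ht, inv_mul_cancel₀ h0]
  · push Not at h
    exact ⟨a, ⟨1, one_ne_zero, fun k _ _ => by simp⟩, fun k hk hkn hk0 => absurd (h k hk hkn) hk0⟩

theorem exists_normalized {n : ℕ} (hn : 3 ≤ n) (l : HLabel) (hl : l.Admissible)
    (h5 : ∀ a, l ≠ .H5 1 a) : ∃ l' : HLabel, l'.Admissible ∧ l'.Normalized n ∧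
      (∀ a, l' ≠ .H5 1 a) ∧ l.codim = l'.codim ∧ (l.alg n).Iso (l'.alg n) := by
  cases l with
  | H4 a =>
    obtain ⟨a', h, h'⟩ := exists_rescaled_firstIsOne n a
    exact ⟨H4 a', trivial, h', by simp, rfl, iso_of_same hn h⟩
  | H5 γ a =>
    obtain ⟨a', h, h'⟩ := exists_rescaled_firstIsOne n a
    refine ⟨H5 γ a', hl, h', fun b hb => ?_, rfl, iso_of_same hn ⟨rfl, h⟩⟩
    exact h5 a (by rw [HLabel.H5.injEq] at hb; rw [hb.1])
  | _ => exact ⟨_, hl, trivial, h5, rfl, (hasChain hn _).iso (hasChain hn _)⟩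

end HLabel

/-! ### Forms of the superidentity and changes of the chain basis -/

namespace SuperAlgebra

variable {L : Type*} [AddCommGroup L] [Module ℂ L] {S : SuperAlgebra L}

namespace IsLeibniz

/-- One even right argument makes the sign trivial, so the other need not be homogeneous. -/
theorem even_right (hS : S.IsLeibniz) (u v : L) {w : L} (hw : w ∈ S.part 0) :
    S.bracket u (S.bracket v w) =
      S.bracket (S.bracket u v) w - S.bracket (S.bracket u w) v := by
  obtain ⟨a, ha, b, hb, rfl⟩ := S.exists_parts v
  have h1 := hS 0 0 u a w ha hw
  have h2 := hS 1 0 u b w hb hw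
  simp only [ZMod.val_zero, mul_zero, pow_zero, one_smul] at h1 h2
  simp only [map_add, LinearMap.add_apply, h1, h2]
  abel

theorem even_mid (hS : S.IsLeibniz) (u : L) {v : L} (hv : v ∈ S.part 0) (w : L) :
    S.bracket u (S.bracket v w) =
      S.bracket (S.bracket u v) w - S.bracket (S.bracket u w) v := by
  obtain ⟨a, ha, b, hb, rfl⟩ := S.exists_parts w
  have h1 := hS 0 0 u v a hv ha
  have h2 := hS 0 1 u v b hv hb
  simp only [ZMod.val_zero, zero_mul, pow_zero, one_smul] at h1 h2
  simp only [map_add, LinearMap.add_apply, h1, h2]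
  abel

theorem odd_odd (hS : S.IsLeibniz) (u : L) {v w : L} (hv : v ∈ S.part 1) (hw : w ∈ S.part 1) :
    S.bracket u (S.bracket v w) =
      S.bracket (S.bracket u v) w + S.bracket (S.bracket u w) v := by
  have h1 := hS 1 1 u v w hv hw
  simp only [ZMod.val_one, mul_one, pow_one] at h1
  rw [h1]; module

end IsLeibniz

end SuperAlgebra

namespace HasChain

variable {L : Type*} [AddCommGroup L] [Module ℂ L] {S : SuperAlgebra L} {n c : ℕ}
  {P P' : ChainParams c} {M : Submodule ℂ L} {f f' : ℕ → L} {g g' : L} {x x' : Fin c → L}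

/-- The family has exactly dim M members, so after a change of basis only the span has to be
checked. -/
theorem li_of_span_eq (h : HasChain S n P M f g x)
    (hs : Submodule.span ℂ (Set.range (chainFamily n f' g' x')) = M) :
    LinearIndependent ℂ (chainFamily n f' g' x') := by
  rw [linearIndependent_iff_card_eq_finrank_span, Set.finrank, hs, h.finrank_eq]
  simp

/-- Adding multiples of `g` to the vectors `x i`. -/
theorem shift (h : HasChain S n P M f g x) (u : Fin c → ℂ)
    (hα : P'.α = P.α) (hβ : P'.β = P.β) (hδ : P'.δ = P.δ) (ha : P'.a = P.a)
    (hε : ∀ i j, P'.ε i j = P.ε i j + u i * P.β j + u j * P.δ i) :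
    HasChain S n P' M f g (fun i => x i + u i • g) := by
  have hs : Submodule.span ℂ (Set.range (chainFamily n f g (fun i => x i + u i • g))) = M := by
    refine le_antisymm (Submodule.span_le.2 ?_) ?_
    · rintro _ ⟨(i | i) | i, rfl⟩
      · exact h.f_mem i
      · exact h.g_mem'
      · exact M.add_mem (h.x_mem' i) (M.smul_mem _ h.g_mem')
    · set W := Submodule.span ℂ (Set.range (chainFamily n f g (fun i => x i + u i • g)))
      have hg : g ∈ W := Submodule.subset_span ⟨.inl (.inr ()), rfl⟩
      refine h.le_of_mem (fun k => ?_) hg (fun i => ?_)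
      · by_cases hk : k < 2 * n - 1
        · exact Submodule.subset_span ⟨.inl (.inl ⟨k, hk⟩), rfl⟩
        · rw [h.f_zero k (by omega)]; exact W.zero_mem
      · have : x i + u i • g ∈ W := Submodule.subset_span ⟨.inr i, rfl⟩
        exact (W.add_mem_iff_left (W.smul_mem _ hg)).1 this
  exact {
    li := h.li_of_span_eq hs
    span_eq := hs
    f_zero := h.f_zero
    f_odd := h.f_odd
    f_even := h.f_even
    g_mem := h.g_mem
    x_mem := fun i => Submodule.add_mem _ (h.x_mem i) (Submodule.smul_mem _ _ h.g_mem)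
    f_f := h.f_f
    g_f := h.g_f
    x_f := fun i => by simp [h.x_f, h.g_f, hα]
    f_one := h.f_one
    f_ge := h.f_ge
    f_g := h.f_g
    g_g := h.g_g
    x_g := fun i => by simp [h.x_g, h.g_g, hδ]
    f_x := fun k i => by rw [map_add, map_smul, h.f_g, smul_zero, add_zero, h.f_x, hα, ha]
    g_x := fun i => by simp [h.g_x, h.g_g, hβ]
    x_x := fun i j => by
      simp only [map_add, map_smul, LinearMap.add_apply, LinearMap.smul_apply, h.x_x, h.g_x, h.x_g,
        h.g_g, hε]
      module }

/-- Replacing the generator of the chain. -/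
theorem rechain {P : ChainParams 0} {x : Fin 0 → L} (h : HasChain S n P M f g x) {y : L}
    (hy : y ∈ M) (hyo : y ∈ S.part 1) (h1 : h.cf 0 y = 1) :
    HasChain S n P M (fun k => (S.bracket.flip (f 0) ^ k) y) g x := by
  set f' : ℕ → L := fun k => (S.bracket.flip (f 0) ^ k) y with hf'
  have hsucc : ∀ k, f' (k + 1) = S.bracket (f' k) (f 0) := by
    intro k
    simp only [hf']
    rw [pow_succ', Module.End.mul_apply, LinearMap.flip_apply]
  have h0 : f' 0 = y := rfl
  have hR : ∀ v ∈ M, S.bracket v (f 0) ∈ M := by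
    intro v hv
    refine h.le_of_mem (W := M.comap (S.bracket.flip (f 0))) (fun k => ?_) ?_
      (fun i => i.elim0) hv
    · rw [Submodule.mem_comap, LinearMap.flip_apply, h.f_f]; exact h.f_mem _
    · rw [Submodule.mem_comap, LinearMap.flip_apply, h.g_f]; exact M.zero_mem
  have hM : ∀ k, f' k ∈ M := by
    intro k
    induction k with
    | zero => exact hy
    | succ k ih => rw [hsucc]; exact hR _ ih
  -- On M, y and f_0 act identically from the right because their f_0-coordinates agree.
  have hb : ∀ v ∈ M, S.bracket v y = S.bracket v (f 0) := fun v hv => by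
    rw [h.bracket_odd hv hy hyo, h1, one_smul]
  -- The new chain is unitriangular with respect to the old one.
  have htail : ∀ k, f' k - f k ∈ chainTail f (k + 1) := by
    intro k
    induction k with
    | zero =>
      rw [h0]
      nth_rewrite 1 [h.expand_odd hy hyo]
      rcases n with _ | n
      · rw [h.f_zero 0 (by omega)]; simp
      · rw [Finset.sum_range_succ', mul_zero, h1, one_smul, add_sub_cancel_right]
        exact sum_mem fun j _ => Submodule.smul_mem _ _ (mem_chainTail (by omega))
    | succ k ih =>
      have : f' (k + 1) - f (k + 1) = S.bracket.flip (f 0) (f' k - f k) := by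
        rw [map_sub, LinearMap.flip_apply, LinearMap.flip_apply, hsucc, h.f_f]
      rw [this]
      refine chainTail_le (W := (chainTail f (k + 1 + 1)).comap (S.bracket.flip (f 0)))
        (fun j hj => ?_) ih
      rw [Submodule.mem_comap, LinearMap.flip_apply, h.f_f]
      exact mem_chainTail (by omega)
  have hzero : ∀ k, 2 * n - 1 ≤ k → f' k = 0 := by
    intro k hk
    have h2 := chainTail_anti (Nat.le_succ_of_le hk) (htail k)
    rw [h.chainTail_eq_bot, Submodule.mem_bot, h.f_zero k hk, sub_zero] at h2
    exact h2
  have hs : Submodule.span ℂ (Set.range (chainFamily n f' g x)) = M := by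
    refine le_antisymm (Submodule.span_le.2 ?_) ?_
    · rintro _ ⟨(i | i) | i, rfl⟩
      · exact hM i
      · exact h.g_mem'
      · exact i.elim0
    · set W := Submodule.span ℂ (Set.range (chainFamily n f' g x))
      have hW : ∀ k, f' k ∈ W := by
        intro k
        by_cases hk : k < 2 * n - 1
        · exact Submodule.subset_span ⟨.inl (.inl ⟨k, hk⟩), rfl⟩
        · rw [hzero k (by omega)]; exact W.zero_mem
      -- Induction from the end of the chain: f_k is f'_k minus a combination of later f_j.
      have hd : ∀ d k, 2 * n - 1 ≤ k + d → f k ∈ W := by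
        intro d
        induction d with
        | zero => intro k hk; rw [h.f_zero k hk]; exact W.zero_mem
        | succ d ih =>
          intro k hk
          have h2 : chainTail f (k + 1) ≤ W := chainTail_le fun j hj => ih j (by omega)
          have h3 := W.sub_mem (hW k) (h2 (htail k))
          rwa [sub_sub_cancel] at h3
      exact h.le_of_mem (fun k => hd (2 * n - 1) k (by omega))
        (Submodule.subset_span ⟨.inl (.inr ()), rfl⟩) (fun i => i.elim0)
  have hpar : ∀ j, f' (2 * j) ∈ S.part 1 ∧ f' (2 * j + 1) ∈ S.part 0 := by
    have hf0 : f 0 ∈ S.part 1 := h.f_odd 0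
    intro j
    induction j with
    | zero => exact ⟨hyo, by rw [hsucc]; exact S.bracket_odd_odd hyo hf0⟩
    | succ j ih =>
      have h2 : f' (2 * (j + 1)) ∈ S.part 1 := by
        rw [mul_add, hsucc]; exact S.bracket_even_odd ih.2 hf0
      exact ⟨h2, by rw [hsucc]; exact S.bracket_odd_odd h2 hf0⟩
  have hone : ∀ v ∈ M, S.bracket v (f' 1) = S.bracket v (f 1) ∧
      ∀ j, 2 ≤ j → S.bracket v (f' j) = 0 := by
    intro v hv
    have h2 : ∀ k, chainTail f (k + 2) ≤ LinearMap.ker (S.bracket v) := fun k =>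
      chainTail_le fun j hj => h.f_ge v hv j (by omega)
    constructor
    · have := h2 0 (htail 1)
      rwa [LinearMap.mem_ker, map_sub, sub_eq_zero] at this
    · intro j hj
      obtain ⟨j, rfl⟩ : ∃ i, j = i + 2 := ⟨j - 2, by omega⟩
      have h3 := h2 (j + 1) (htail (j + 2))
      rwa [LinearMap.mem_ker, map_sub, h.f_ge v hv _ hj, sub_zero] at h3
  exact {
    li := h.li_of_span_eq hs
    span_eq := hs
    f_zero := hzero
    f_odd := fun j => (hpar j).1
    f_even := fun j => (hpar j).2
    g_mem := h.g_mem
    x_mem := fun i => i.elim0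
    f_f := fun k => by rw [h0, hb _ (hM k), hsucc]
    g_f := by rw [h0, hb _ h.g_mem', h.g_f]
    x_f := fun i => i.elim0
    f_one := fun v hv => by
      rw [(hone v hv).1, h0, hb _ hv, hb _ (hR v hv), h.f_one v hv]
    f_ge := fun v hv => (hone v hv).2
    f_g := fun k => by rw [h.bracket_g (hM k)]; simp
    g_g := h.g_g
    x_g := fun i => i.elim0
    f_x := fun _ i => i.elim0
    g_x := fun i => i.elim0
    x_x := fun i => i.elim0 }

end HasChain

/-! ### Extensions of H: the action on the chain and on g -/

/-- A Leibniz superalgebra whose products lie in the span of a chain `f_k` and a vector `g`. -/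
structure ChainExtension {L : Type*} [AddCommGroup L] [Module ℂ L] (S : SuperAlgebra L) (n : ℕ)
    (N : Submodule ℂ L) (f : ℕ → L) (g : L) (z : Fin 0 → L) : Prop where
  leibniz : S.IsLeibniz
  bracket_mem : ∀ u v, S.bracket u v ∈ N
  two_le : 2 ≤ n
  chain : HasChain S n default N f g z

namespace ChainExtension

variable {L : Type*} [AddCommGroup L] [Module ℂ L] {S : SuperAlgebra L} {n : ℕ}
  {N : Submodule ℂ L} {f : ℕ → L} {g : L} {z : Fin 0 → L}

theorem f_zero_mem (E : ChainExtension S n N f g z) : f 0 ∈ S.part 1 := E.chain.f_odd 0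

/-- This is the odd-odd identity for f_1 = [f_0, f_0]; it holds for every v in L, not only in N. -/
theorem bracket_f_one (E : ChainExtension S n N f g z) (v : L) :
    S.bracket v (f 1) = (2 : ℂ) • S.bracket (S.bracket v (f 0)) (f 0) := by
  rw [← E.chain.f_f 0, E.leibniz.odd_odd v E.f_zero_mem E.f_zero_mem, two_smul]

/-- R_{f_2} is a commutator of R_{f_1} = 2R_{f_0}² and R_{f_0}, hence zero. Then [v, f_{j+1}] is
built from [v, f_j] and [[v, f_0], f_j], where [v, f_0] lies in N. -/
theorem bracket_f_ge (E : ChainExtension S n N f g z) (v : L) {j : ℕ} (hj : 2 ≤ j) :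
    S.bracket v (f j) = 0 := by
  induction j, hj using Nat.le_induction with
  | base =>
    have h1 : f 1 ∈ S.part 0 := E.chain.f_even 0
    rw [← E.chain.f_f 1, E.leibniz.even_mid v h1, E.bracket_f_one, E.bracket_f_one, map_smul,
      LinearMap.smul_apply, sub_self]
  | succ j hj ih =>
    have h0 := E.f_zero_mem
    rw [← E.chain.f_f j]
    rcases Nat.even_or_odd' j with ⟨i, rfl | rfl⟩
    · rw [E.leibniz.odd_odd v (E.chain.f_odd i) h0, ih, E.chain.f_ge _ (E.bracket_mem _ _) _ hj]
      simp
    · rw [E.leibniz.even_mid v (E.chain.f_even i), ih, E.chain.f_ge _ (E.bracket_mem _ _) _ hj]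
      simp

theorem g_bracket (E : ChainExtension S n N f g z) {w : L} (hw : w ∈ N) : S.bracket g w = 0 :=
  E.chain.eqOn (p := S.bracket g) (q := 0) (fun k _ => E.chain.g_bracket_f k) E.chain.g_g
    (fun i => i.elim0) hw

theorem bracket_g (E : ChainExtension S n N f g z) {w : L} (hw : w ∈ N) : S.bracket w g = 0 := by
  rw [E.chain.bracket_g hw]; simp

/-- Elements which are annihilated by the right multiplication by `f 0`. -/
theorem eq_smul_g (E : ChainExtension S n N f g z) {w : L} (hw : w ∈ N) (h0 : w ∈ S.part 0)
    (h : S.bracket w (f 0) = 0) : w = E.chain.cg w • g := by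
  have := (E.chain.eq_of_bracket_f_eq_zero (by have := E.two_le; omega) hw h0 h).1
  simpa using this

theorem cf_zero_bracket_f (E : ChainExtension S n N f g z) {w : L} (hw : w ∈ N) :
    E.chain.cf 0 (S.bracket w (f 0)) = 0 := by
  rw [E.chain.cf_zero_bracket_f (by have := E.two_le; omega) hw]; simp

/-- The identity for (f_k, f_0, v), in which the odd element [f_0, v] acts by its f_0-coordinate.
The recursion determines R_v on the chain from [f_0, v]. -/
theorem f_succ_bracket (E : ChainExtension S n N f g z) (k : ℕ) {v : L} (hv : v ∈ S.part 0) :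
    S.bracket (f (k + 1)) v = S.bracket (S.bracket (f k) v) (f 0) +
      E.chain.cf 0 (S.bracket (f 0) v) • f (k + 1) := by
  have h1 := E.leibniz.even_right (f k) (f 0) hv
  rw [E.chain.bracket_odd (E.chain.f_mem k) (E.bracket_mem _ _)
    (S.bracket_odd_even E.f_zero_mem hv), E.chain.f_f] at h1
  rw [h1]; abel

/-- Triangularity of the right multiplication by an even element. -/
theorem cf_f_bracket (E : ChainExtension S n N f g z) {v : L} (hv : v ∈ S.part 0) (k : ℕ) :
    (∀ i, i < k → E.chain.cf i (S.bracket (f k) v) = 0) ∧ (k < 2 * n - 1 →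
      E.chain.cf k (S.bracket (f k) v) = (k + 1) * E.chain.cf 0 (S.bracket (f 0) v)) := by
  induction k with
  | zero => simp
  | succ k ih =>
    rw [E.f_succ_bracket k hv]
    constructor
    · intro i hi
      rw [map_add, map_smul, HasChain.cf_f, if_neg (by omega), smul_zero, add_zero]
      rcases i with _ | i
      · exact E.cf_zero_bracket_f (E.bracket_mem _ _)
      · by_cases hi' : i + 1 < 2 * n - 1
        · rw [E.chain.cf_succ_bracket hi' (E.bracket_mem _ _)]
          exact ih.1 i (by omega)
        · simp [HasChain.cf, hi']
    · intro hk
      rw [map_add, map_smul, HasChain.cf_f, if_pos ⟨rfl, hk⟩,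
        E.chain.cf_succ_bracket hk (E.bracket_mem _ _), ih.2 (by omega)]
      push_cast; simp only [smul_eq_mul]; ring

theorem f_bracket (E : ChainExtension S n N f g z) {v : L} (hv : v ∈ S.part 0) {s : ℂ} {a : ℕ → ℂ}
    (h : S.bracket (f 0) v = s • f 0 + ∑ j ∈ Finset.Icc 1 (n - 1), a j • f (2 * j)) (k : ℕ) :
    S.bracket (f k) v = ((k + 1) * s) • f k +
      ∑ j ∈ Finset.Icc 1 (n - 1), a j • f (k + 2 * j) := by
  have hs : E.chain.cf 0 (S.bracket (f 0) v) = s := by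
    have := E.two_le
    have h0 : 1 < 2 * n := by omega
    rw [h, map_add, map_smul, map_sum, Finset.sum_eq_zero]
    · simp [h0]
    · intro j hj
      rw [Finset.mem_Icc] at hj
      rw [map_smul, HasChain.cf_f, if_neg (by omega), smul_zero]
  induction k with
  | zero => simpa using h
  | succ k ih =>
    rw [E.f_succ_bracket k hv, hs, ih]
    simp only [map_add, map_sum, map_smul, LinearMap.add_apply, LinearMap.sum_apply,
      LinearMap.smul_apply, E.chain.f_f]
    rw [add_right_comm, ← add_smul]
    congr 1
    · congr 1; push_cast; ring
    · exact Finset.sum_congr rfl fun j _ => by rw [add_right_comm]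

/-- [[g, v], f_0] = [g, [v, f_0]] lies in [g, N] = 0, and even elements of N killed by R_{f_0} are
multiples of g. -/
theorem g_bracket_even (E : ChainExtension S n N f g z) {v : L} (hv : v ∈ S.part 0) :
    S.bracket g v = E.chain.cg (S.bracket g v) • g := by
  refine E.eq_smul_g (E.bracket_mem _ _) (S.bracket_even_even E.chain.g_mem hv) ?_
  have h1 := E.leibniz.even_mid g hv (f 0)
  rw [E.chain.g_f, map_zero, LinearMap.zero_apply, sub_zero, E.g_bracket (E.bracket_mem _ _)] at h1
  exact h1.symm

theorem bracket_g_even (E : ChainExtension S n N f g z) {v : L} (hv : v ∈ S.part 0) :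
    S.bracket v g = E.chain.cg (S.bracket v g) • g := by
  refine E.eq_smul_g (E.bracket_mem _ _) (S.bracket_even_even hv E.chain.g_mem) ?_
  have h1 := E.leibniz.even_mid v E.chain.g_mem (f 0)
  rw [E.chain.g_f, map_zero, E.bracket_g (E.bracket_mem _ _), sub_zero] at h1
  exact h1.symm

/-- By the Leibniz identity the sum in the hypothesis is [[u, v], f_0]. -/
theorem bracket_even_even (E : ChainExtension S n N f g z) {u v : L} (hu : u ∈ S.part 0)
    (hv : v ∈ S.part 0)
    (h : S.bracket u (S.bracket v (f 0)) + S.bracket (S.bracket u (f 0)) v = 0) :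
    S.bracket u v = E.chain.cg (S.bracket u v) • g := by
  refine E.eq_smul_g (E.bracket_mem _ _) (S.bracket_even_even hu hv) ?_
  have h1 := E.leibniz.even_mid u hv (f 0)
  rw [h1] at h
  simpa using h

theorem cf_zero_bracket_of_mem (E : ChainExtension S n N f g z) {w : L} (hw : w ∈ N) :
    E.chain.cf 0 (S.bracket (f 0) w) = 0 := by
  have h1 : chainTail f 1 ≤ LinearMap.ker (E.chain.cf 0) := chainTail_le fun j hj => by
    rw [LinearMap.mem_ker, HasChain.cf_f, if_neg (by omega)]
  exact h1 (E.chain.f_bracket_mem E.chain 0 hw)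

/-- A chain basis of an extension by even elements. -/
theorem hasChain (E : ChainExtension S n N f g z) {c : ℕ} (P : ChainParams c) (x : Fin c → L)
    (hx : ∀ i, x i ∈ S.part 0) (htop : ∀ v, ∃ r : Fin c → ℂ, v - ∑ i, r i • x i ∈ N)
    (hP : ∀ r : Fin c → ℂ, ∑ i, P.α i * r i = 0 → ∑ i, P.β i * r i = 0 → r = 0)
    (hxf : ∀ i, S.bracket (x i) (f 0) = -P.α i • f 0)
    (hfx : ∀ i, S.bracket (f 0) (x i) =
      P.α i • f 0 + ∑ j ∈ Finset.Icc 1 (n - 1), P.a i j • f (2 * j))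
    (hgx : ∀ i, S.bracket g (x i) = P.β i • g) (hxg : ∀ i, S.bracket (x i) g = P.δ i • g)
    (hxx : ∀ i j, S.bracket (x i) (x j) = P.ε i j • g) : HasChain S n P ⊤ f g x := by
  have h := E.chain
  have hn := E.two_le
  have hα : ∀ i, h.cf 0 (S.bracket (f 0) (x i)) = P.α i := by
    intro i
    have h0 : 1 < 2 * n := by omega
    rw [hfx, map_add, map_smul, map_sum, Finset.sum_eq_zero]
    · simp [h0]
    · intro j hj
      rw [Finset.mem_Icc] at hj
      rw [map_smul, HasChain.cf_f, if_neg (by omega), smul_zero]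
  -- Elements of N have zero weight on f_0 and on g, so the x_i are independent modulo N.
  have hr : ∀ r : Fin c → ℂ, ∑ i, r i • x i ∈ N → r = 0 := by
    intro r hr
    apply hP
    · have := E.cf_zero_bracket_of_mem hr
      simpa [hα, mul_comm] using this
    · have := congrArg h.cg (E.g_bracket hr)
      simpa [hgx, mul_comm] using this
  have hc : chainFamily n f g x = Sum.elim (chainFamily n f g z ∘ Sum.inl) x := by
    funext i
    rcases i with i | i <;> rfl
  have hNs : Submodule.span ℂ (Set.range (chainFamily n f g z ∘ Sum.inl)) = N := by
    rw [← h.span_eq]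
    congr 1
    ext v
    constructor
    · rintro ⟨i, rfl⟩
      exact ⟨.inl i, rfl⟩
    · rintro ⟨i | i, rfl⟩
      · exact ⟨i, rfl⟩
      · exact i.elim0
  exact {
    li := by
      rw [hc]
      refine LinearIndependent.sum_type (h.li.comp _ Sum.inl_injective) ?_ ?_
      · rw [Fintype.linearIndependent_iff]
        intro r h0
        exact congrFun (hr r (by rw [h0]; exact N.zero_mem))
      · rw [hNs, Submodule.disjoint_def]
        intro w hw hw'
        obtain ⟨r, rfl⟩ := (Submodule.mem_span_range_iff_exists_fun ℂ).1 hw'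
        rw [hr r hw]
        simp
    span_eq := by
      rw [hc, Set.Sum.elim_range, Submodule.span_union, hNs, eq_top_iff]
      intro v _
      obtain ⟨r, hr⟩ := htop v
      rw [← sub_add_cancel v (∑ i, r i • x i)]
      exact Submodule.add_mem_sup hr ((Submodule.mem_span_range_iff_exists_fun ℂ).2 ⟨r, rfl⟩)
    f_zero := h.f_zero
    f_odd := h.f_odd
    f_even := h.f_even
    g_mem := h.g_mem
    x_mem := hx
    f_f := h.f_f
    g_f := h.g_f
    x_f := hxf
    f_one := fun v _ => E.bracket_f_one v
    f_ge := fun v _ j hj => E.bracket_f_ge v hj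
    f_g := h.f_g
    g_g := h.g_g
    x_g := hxg
    f_x := fun k i => E.f_bracket (hx i) (hfx i) k
    g_x := hgx
    x_x := hxx }

/-- The nilradical contains the homogeneous elements which act nilpotently from the right. -/
theorem mem_of_homogeneous {N : S.GradedIdeal} (E : ChainExtension S n N.carrier f g z)
    (hN : S.IsNilradical N) {v : L} {p : ZMod 2} (hv : v ∈ S.part p)
    (h0 : S.bracket (f 0) v ∈ Submodule.span ℂ {g} ⊔ chainTail f 1)
    (hg : S.bracket g v ∈ chainTail f 1) : v ∈ N.carrier := by
  -- N + ℂv is an ideal since all products lie in N. Once it is nilpotent, maximality gives v ∈ N.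
  let J : S.GradedIdeal :=
    { carrier := N.carrier ⊔ Submodule.span ℂ {v}
      graded := by
        refine sup_le ?_ ?_
        · refine N.graded.trans (sup_le_sup ?_ ?_) <;>
            exact inf_le_inf_right _ le_sup_left
        · rw [Submodule.span_singleton_le_iff_mem]
          have hv' : v ∈ N.carrier ⊔ Submodule.span ℂ {v} :=
            Submodule.mem_sup_right (Submodule.mem_span_singleton_self v)
          rcases ZMod.two_cases p with rfl | rfl
          · exact Submodule.mem_sup_left ⟨hv', hv⟩
          · exact Submodule.mem_sup_right ⟨hv', hv⟩
      mul_mem_left := fun u w _ => Submodule.mem_sup_left (E.bracket_mem u w)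
      mul_mem_right := fun u w _ => Submodule.mem_sup_left (E.bracket_mem u w) }
  have hk : ∀ k, S.bracket (f (k + 1)) v ∈ chainTail f (k + 2) := by
    have hR : ∀ k, Submodule.span ℂ {g} ⊔ chainTail f (k + 1) ≤
        (chainTail f (k + 2)).comap (S.bracket.flip (f 0)) := by
      intro k
      refine sup_le ?_ (chainTail_le fun j hj => ?_)
      · rw [Submodule.span_singleton_le_iff_mem, Submodule.mem_comap, LinearMap.flip_apply,
          E.chain.g_f]
        exact Submodule.zero_mem _
      · rw [Submodule.mem_comap, LinearMap.flip_apply, E.chain.f_f]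
        exact mem_chainTail (by omega)
    -- Of the components of [f_0, v] only f_1 acts on f_k, and it raises the index by two.
    have hF : ∀ k, S.bracket (f k) (S.bracket (f 0) v) ∈ chainTail f (k + 2) := by
      intro k
      have : Submodule.span ℂ {g} ⊔ chainTail f 1 ≤
          (chainTail f (k + 2)).comap (S.bracket (f k)) := by
        refine sup_le ?_ (chainTail_le fun j hj => ?_)
        · rw [Submodule.span_singleton_le_iff_mem, Submodule.mem_comap, E.chain.f_g]
          exact Submodule.zero_mem _
        · rw [Submodule.mem_comap]
          rcases hj.lt_or_eq with hj | rfl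
          · rw [E.bracket_f_ge _ hj]; exact Submodule.zero_mem _
          · rw [E.chain.f_bracket_one]; exact Submodule.smul_mem _ _ (mem_chainTail le_rfl)
      exact this h0
    -- [f_{k+1}, v] is [f_k, [f_0, v]] plus or minus [[f_k, v], f_0], and both lie in the tail from
    -- k + 2 on.
    have hrec : ∀ k, S.bracket (f k) v ∈ Submodule.span ℂ {g} ⊔ chainTail f (k + 1) →
        S.bracket (f (k + 1)) v ∈ chainTail f (k + 2) := by
      intro k h1
      have h2 := E.leibniz 1 p (f k) (f 0) v E.f_zero_mem hv
      rw [E.chain.f_f, eq_sub_iff_add_eq] at h2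
      rw [← h2]
      exact add_mem (hF k) (Submodule.smul_mem _ _ (hR k h1))
    intro k
    induction k with
    | zero => exact hrec 0 h0
    | succ k ih => exact hrec (k + 1) (Submodule.mem_sup_right ih)
  have hJ : (S.ofIdeal J).IsNilpotent := by
    refine E.chain.isNilpotent_of_lowering (fun u _ w _ => E.bracket_mem u w) ?_ ?_ ?_
    · refine fun w hw => (sup_le ?_ ?_ : J.carrier ≤
        (Submodule.span ℂ {g} ⊔ chainTail f 1).comap (S.bracket (f 0))) hw
      · exact fun w hw => Submodule.mem_sup_right (E.chain.f_bracket_mem E.chain 0 hw)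
      · rwa [Submodule.span_singleton_le_iff_mem]
    · refine fun w hw => (sup_le ?_ ?_ : J.carrier ≤ (chainTail f 1).comap (S.bracket g)) hw
      · intro w hw
        rw [Submodule.mem_comap, E.g_bracket hw]
        exact Submodule.zero_mem _
      · rwa [Submodule.span_singleton_le_iff_mem]
    · intro k
      refine fun w hw => (sup_le ?_ ?_ : J.carrier ≤
        (chainTail f (k + 2)).comap (S.bracket (f (k + 1)))) hw
      · exact fun w hw => E.chain.f_bracket_mem E.chain (k + 1) hw
      · rw [Submodule.span_singleton_le_iff_mem]
        exact hk k
  have := hN.2.2 J hJ (hN.2.1.trans le_sup_left) le_sup_left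
  rw [← this]
  exact Submodule.mem_sup_right (Submodule.mem_span_singleton_self v)

theorem mem_chainTail_of_odd (E : ChainExtension S n N f g z) {w : L} (hw : w ∈ N)
    (h1 : w ∈ S.part 1) (h0 : E.chain.cf 0 w = 0) : w ∈ chainTail f 1 := by
  rw [E.chain.expand_odd hw h1]
  refine sum_mem fun j _ => ?_
  rcases j with _ | j
  · rw [mul_zero, h0, zero_smul]; exact Submodule.zero_mem _
  · exact Submodule.smul_mem _ _ (mem_chainTail (by omega))

/-- The nilradical contains the odd part. -/
theorem odd_mem {N : S.GradedIdeal} (E : ChainExtension S n N.carrier f g z)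
    (hN : S.IsNilradical N) {v : L} (hv : v ∈ S.part 1) : v ∈ N.carrier := by
  refine E.mem_of_homogeneous hN hv ?_ ?_
  -- [f_0, v] is even, so it has no f_0-component.
  · rw [E.chain.expand_even (E.bracket_mem _ _) (S.bracket_odd_odd E.f_zero_mem hv)]
    refine add_mem (add_mem (sum_mem fun j _ => ?_) ?_) (sum_mem fun i _ => i.elim0)
    · exact Submodule.smul_mem _ _ (Submodule.mem_sup_right (mem_chainTail (by omega)))
    · exact Submodule.smul_mem _ _ (Submodule.mem_sup_left (Submodule.mem_span_singleton_self g))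
  · refine E.mem_chainTail_of_odd (E.bracket_mem _ _) (S.bracket_even_odd E.chain.g_mem hv) ?_
    -- This gives [[g, v], f_0] = 0, and its f_1-coordinate is the f_0-coordinate of [g, v].
    have h1 := E.leibniz.odd_odd g hv E.f_zero_mem
    rw [E.chain.g_f, map_zero, LinearMap.zero_apply, add_zero, E.g_bracket (E.bracket_mem _ _)] at h1
    have := E.two_le
    rw [← E.chain.cf_succ_bracket (by omega) (E.bracket_mem _ _), ← h1, map_zero]

/-- The two weights are thus injective on the even part modulo N, which bounds the codimension by
two. -/
theorem even_mem {N : S.GradedIdeal} (E : ChainExtension S n N.carrier f g z)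
    (hN : S.IsNilradical N) {v : L} (hv : v ∈ S.part 0)
    (hα : E.chain.cf 0 (S.bracket (f 0) v) = 0) (hβ : E.chain.cg (S.bracket g v) = 0) :
    v ∈ N.carrier := by
  refine E.mem_of_homogeneous hN hv (Submodule.mem_sup_right (E.mem_chainTail_of_odd (E.bracket_mem _ _)
    (S.bracket_odd_even E.f_zero_mem hv) hα)) ?_
  rw [E.g_bracket_even hv, hβ, zero_smul]
  exact Submodule.zero_mem _

end ChainExtension

/-! ### Normal forms of an even element -/

namespace ChainExtension

variable {L : Type*} [AddCommGroup L] [Module ℂ L] {S : SuperAlgebra L} {n : ℕ}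
  {N : Submodule ℂ L} {f : ℕ → L} {g : L} {z : Fin 0 → L}

theorem eq_zero_of_odd (E : ChainExtension S n N f g z) {w : L} (hw : w ∈ N) (h1 : w ∈ S.part 1)
    (h : ∀ j, j < n → E.chain.cf (2 * j) w = 0) : w = 0 := by
  rw [E.chain.expand_odd hw h1]
  refine Finset.sum_eq_zero fun j hj => ?_
  rw [h j (Finset.mem_range.1 hj), zero_smul]

/-- An even element which multiplies `f 0` by `1` modulo higher terms has an odd eigenvector. -/
theorem exists_eigenvector (E : ChainExtension S n N f g z) {x : L} (hx : x ∈ S.part 0)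
    (h1 : E.chain.cf 0 (S.bracket (f 0) x) = 1) :
    ∃ y ∈ N, y ∈ S.part 1 ∧ E.chain.cf 0 y = 1 ∧ S.bracket y x = y := by
  have hn := E.two_le
  -- Successive approximation: the error [y, x] - y is cleared in degrees 0, 2, …, 2k.
  have key : ∀ k : ℕ, ∃ y ∈ N, y ∈ S.part 1 ∧ E.chain.cf 0 y = 1 ∧
      ∀ j ≤ k, E.chain.cf (2 * j) (S.bracket y x - y) = 0 := by
    intro k
    induction k with
    | zero =>
      have h0 : E.chain.cf 0 (f 0) = 1 := by rw [HasChain.cf_f, if_pos (by omega)]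
      refine ⟨f 0, E.chain.f_mem 0, E.f_zero_mem, h0, fun j hj => ?_⟩
      obtain rfl : j = 0 := by omega
      rw [mul_zero, map_sub, h1, h0, sub_self]
    | succ k ih =>
      obtain ⟨y, hy, hyo, hy1, hyk⟩ := ih
      set u := E.chain.cf (2 * (k + 1)) (S.bracket y x - y) with hu
      have hodd := E.chain.f_odd (k + 1)
      -- f_{2(k+1)} has eigenvalue 2k + 3 modulo later terms, and (2k + 3) - 1 = 2(k + 1) is the
      -- divisor.
      refine ⟨y - (u / (2 * (k + 1))) • f (2 * (k + 1)),
        N.sub_mem hy (N.smul_mem _ (E.chain.f_mem _)),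
        Submodule.sub_mem _ hyo (Submodule.smul_mem _ _ hodd), ?_, fun j hj => ?_⟩
      · rw [map_sub, map_smul, HasChain.cf_f, if_neg (by omega), smul_zero, sub_zero, hy1]
      · have h2 : S.bracket (y - (u / (2 * (k + 1))) • f (2 * (k + 1))) x -
            (y - (u / (2 * (k + 1))) • f (2 * (k + 1))) = (S.bracket y x - y) -
            (u / (2 * (k + 1))) • (S.bracket (f (2 * (k + 1))) x - f (2 * (k + 1))) := by
          simp only [map_sub, map_smul, LinearMap.sub_apply, LinearMap.smul_apply]
          module
        rw [h2, map_sub, map_smul, map_sub _ (S.bracket (f (2 * (k + 1))) x)]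
        rcases hj.lt_or_eq with hj | rfl
        · rw [hyk j (by omega), (E.cf_f_bracket hx _).1 _ (by omega), HasChain.cf_f,
            if_neg (by omega)]
          simp
        · by_cases hk : 2 * (k + 1) < 2 * n - 1
          · rw [← hu, (E.cf_f_bracket hx _).2 hk, HasChain.cf_f, if_pos ⟨rfl, hk⟩, h1]
            have : (k + 1 : ℂ) ≠ 0 := Nat.cast_add_one_ne_zero k
            push_cast
            simp only [smul_eq_mul]
            field_simp
            ring
          · simp [HasChain.cf, hk]
  obtain ⟨y, hy, hyo, hy1, hyk⟩ := key n
  refine ⟨y, hy, hyo, hy1, sub_eq_zero.1 (E.eq_zero_of_odd (N.sub_mem (E.bracket_mem _ _) hy)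
    (Submodule.sub_mem _ (S.bracket_odd_even hyo hx) hyo) fun j hj => hyk j hj.le)⟩

/-- The left multiplication by an even element multiplies `f 0` by the negative weight. -/
theorem cf_bracket_f_zero (E : ChainExtension S n N f g z) {x : L} (hx : x ∈ S.part 0) :
    E.chain.cf 0 (S.bracket x (f 0)) = -E.chain.cf 0 (S.bracket (f 0) x) := by
  have hn := E.two_le
  have h1 := E.leibniz.even_mid (f 0) hx (f 0)
  rw [E.chain.bracket_odd (E.chain.f_mem 0) (E.bracket_mem _ _)
    (S.bracket_even_odd hx E.f_zero_mem), E.chain.f_f] at h1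
  -- With α the weight of x and d the f_0-coordinate of [x, f_0], degree one reads d = α - 2α.
  have h2 := congrArg (E.chain.cf 1) h1
  rw [map_sub, map_smul, HasChain.cf_f, if_pos ⟨rfl, by omega⟩,
    E.chain.cf_succ_bracket (by omega) (E.bracket_mem _ _),
    (E.cf_f_bracket hx 1).2 (by omega)] at h2
  simp only [smul_eq_mul, mul_one, Nat.cast_one] at h2
  rw [h2]; ring

/-- An even element of weight one acts diagonally after a change of the basis. -/
theorem exists_diagonal (E : ChainExtension S n N f g z) {x : L} (hx : x ∈ S.part 0)
    (h1 : E.chain.cf 0 (S.bracket (f 0) x) = 1) :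
    ∃ f' x', ChainExtension S n N f' g z ∧ x' ∈ S.part 0 ∧ x' - x ∈ N ∧
      S.bracket (f' 0) x' = f' 0 ∧ S.bracket x' (f' 0) = -f' 0 := by
  obtain ⟨y, hy, hyo, hy1, hyx⟩ := E.exists_eigenvector hx h1
  have E' : ChainExtension S n N _ g z :=
    ⟨E.leibniz, E.bracket_mem, E.two_le, E.chain.rechain hy hyo hy1⟩
  set f' : ℕ → L := fun k => (S.bracket.flip (f 0) ^ k) y with hf'
  have hy0 : f' 0 = y := rfl
  clear_value f'
  clear hf'
  subst hy0
  have hn := E.two_le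
  have hw : E'.chain.cf 0 (S.bracket (f' 0) x) = 1 := by
    rw [hyx, HasChain.cf_f, if_pos (by omega)]
  have hd0 : E'.chain.cf 0 (S.bracket x (f' 0)) = -1 := by rw [E'.cf_bracket_f_zero hx, hw]
  have hD := S.bracket_even_odd hx E'.f_zero_mem
  -- [f'_0, [x, x]] = 0 by the Leibniz identity, and of [x, x] only the f'_1-component acts on f'_0.
  have hxx : E'.chain.cf 1 (S.bracket x x) = 0 := by
    have h2 := E'.leibniz.even_mid (f' 0) hx x
    rw [sub_self] at h2
    have h3 : S.bracket (f' 0) (S.bracket x x) =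
        E'.chain.cf 1 (S.bracket x x) • S.bracket (f' 0) (f' 1) := by
      refine E'.chain.eqOn_even (p := S.bracket (f' 0))
        (q := (E'.chain.cf 1).smulRight (S.bracket (f' 0) (f' 1))) (fun j => ?_) ?_
        (fun i => i.elim0) (E'.bracket_mem x x) (S.bracket_even_even hx hx)
      · rcases j with _ | j
        · have : 1 < 2 * n - 1 := by omega
          simp [this]
        · rw [E'.bracket_f_ge _ (by omega), LinearMap.smulRight_apply, HasChain.cf_f,
            if_neg (by omega), zero_smul]
      · rw [E'.chain.f_g]; simp
    rw [h2, E'.chain.f_bracket_one, smul_smul] at h3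
    have h4 := (smul_eq_zero.1 h3.symm).resolve_right (E'.chain.f_ne_zero (by omega))
    simpa using h4
  -- The identity for (x, f'_0, x) gives d = 3d for the f'_2-coordinate d of [x, f'_0], as [x, x]
  -- has no f'_1-component.
  have hd1 : E'.chain.cf 2 (S.bracket x (f' 0)) = 0 := by
    have h2 := E'.leibniz.even_right x (f' 0) hx
    rw [hyx] at h2
    have h3 : E'.chain.cf 2 (S.bracket (S.bracket x (f' 0)) x) =
        3 * E'.chain.cf 2 (S.bracket x (f' 0)) := by
      refine E'.chain.eqOn_odd (p := E'.chain.cf 2 ∘ₗ S.bracket.flip x)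
        (q := (3 : ℂ) • E'.chain.cf 2) (fun j => ?_) (E'.bracket_mem _ _) hD
      have := E'.f_bracket hx (s := 1) (a := fun _ => 0) (by simp [hyx]) (2 * j)
      simp only [zero_smul, Finset.sum_const_zero, add_zero] at this
      simp only [LinearMap.comp_apply, LinearMap.flip_apply, this, map_smul, HasChain.cf_f,
        LinearMap.smul_apply, smul_eq_mul]
      split_ifs with hj
      · obtain rfl : j = 1 := by omega
        norm_num
      · simp
    have h4 := congrArg (E'.chain.cf 2) h2
    rw [map_sub, h3, E'.chain.cf_succ_bracket (k := 1) (by omega) (E'.bracket_mem _ _), hxx] at h4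
    linear_combination -1 / 2 * h4
  obtain ⟨m, rfl⟩ : ∃ m, n = m + 2 := ⟨n - 2, by omega⟩
  -- Only f'_3, f'_5, … occur; their right multiplications vanish, so [x, f'_0] is corrected without
  -- disturbing [f'_0, x]. An f'_1-term would disturb it, which is why degree two was treated
  -- separately.
  set w : L := ∑ j ∈ Finset.range m, E'.chain.cf (2 * (j + 2)) (S.bracket x (f' 0)) •
    f' (2 * (j + 1) + 1) with hwd
  have hwN : w ∈ N := sum_mem fun j _ => N.smul_mem _ (E'.chain.f_mem _)
  have hvw : ∀ v, S.bracket v w = 0 := by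
    intro v
    rw [hwd, map_sum, Finset.sum_eq_zero]
    intro j _
    rw [map_smul, E'.bracket_f_ge v (by omega : 2 ≤ 2 * (j + 1) + 1), smul_zero]
  refine ⟨f', x - w, E', Submodule.sub_mem _ hx
    (sum_mem fun j _ => Submodule.smul_mem _ _ (E'.chain.f_even _)), ?_, ?_, ?_⟩
  · rw [sub_sub_cancel_left]; exact N.neg_mem hwN
  · rw [map_sub, hvw, sub_zero, hyx]
  · have h2 : S.bracket w (f' 0) = ∑ j ∈ Finset.range m,
        E'.chain.cf (2 * (j + 2)) (S.bracket x (f' 0)) • f' (2 * (j + 2)) := by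
      simp only [hwd, map_sum, map_smul, LinearMap.sum_apply, LinearMap.smul_apply, E'.chain.f_f]
      rfl
    have h3 := E'.chain.expand_odd (E'.bracket_mem _ _) hD
    rw [Finset.sum_range_succ', Finset.sum_range_succ', mul_zero, zero_add, mul_one, hd0, hd1,
      zero_smul, add_zero, ← h2] at h3
    rw [map_sub, LinearMap.sub_apply, h3]
    simp

/-- An even element of weight zero annihilates `f 0` from the left after a shift. -/
theorem exists_shift (E : ChainExtension S n N f g z) {x : L} (hx : x ∈ S.part 0)
    (h0 : E.chain.cf 0 (S.bracket (f 0) x) = 0) :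
    ∃ x' ∈ S.part 0, x' - x ∈ N ∧ S.bracket x' (f 0) = 0 ∧
      S.bracket (f 0) x' = ∑ j ∈ Finset.Icc 1 (n - 1),
        E.chain.cf (2 * j) (S.bracket (f 0) x') • f (2 * j) := by
  have hn := E.two_le
  have hd0 : E.chain.cf 0 (S.bracket x (f 0)) = 0 := by
    rw [E.cf_bracket_f_zero hx, h0, neg_zero]
  have hD := S.bracket_even_odd hx E.f_zero_mem
  obtain ⟨m, rfl⟩ : ∃ m, n = m + 1 := ⟨n - 1, by omega⟩
  -- Here f_1 may occur: it alters [f_0, x] only in f_2, so the weight zero is kept.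
  set w : L := ∑ j ∈ Finset.range m, E.chain.cf (2 * (j + 1)) (S.bracket x (f 0)) •
    f (2 * j + 1) with hwd
  have hwN : w ∈ N := sum_mem fun j _ => N.smul_mem _ (E.chain.f_mem _)
  have hw0 : w ∈ S.part 0 := sum_mem fun j _ => Submodule.smul_mem _ _ (E.chain.f_even _)
  refine ⟨x - w, Submodule.sub_mem _ hx hw0, ?_, ?_, ?_⟩
  · rw [sub_sub_cancel_left]; exact N.neg_mem hwN
  · have h2 : S.bracket w (f 0) = ∑ j ∈ Finset.range m,
        E.chain.cf (2 * (j + 1)) (S.bracket x (f 0)) • f (2 * (j + 1)) := by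
      simp only [hwd, map_sum, map_smul, LinearMap.sum_apply, LinearMap.smul_apply, E.chain.f_f]
      rfl
    have h3 := E.chain.expand_odd (E.bracket_mem _ _) hD
    rw [Finset.sum_range_succ', mul_zero, hd0, zero_smul, add_zero, ← h2] at h3
    rw [map_sub, LinearMap.sub_apply, h3, sub_self]
  · have h4 : E.chain.cf 0 (S.bracket (f 0) (x - w)) = 0 := by
      rw [map_sub, map_sub, h0, E.cf_zero_bracket_of_mem hwN, sub_zero]
    have h3 := E.chain.expand_odd (E.bracket_mem (f 0) (x - w))
      (S.bracket_odd_even E.f_zero_mem (Submodule.sub_mem _ hx hw0))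
    rw [Finset.sum_range_succ', mul_zero, h4, zero_smul, add_zero] at h3
    conv_lhs => rw [h3]
    rw [Finset.range_eq_Ico,
      Finset.sum_Ico_add' (fun j => E.chain.cf (2 * j) (S.bracket (f 0) (x - w)) • f (2 * j)) 0 m 1]
    rfl

end ChainExtension

/-! ### Reduction of the structure constants to the list -/

namespace HasChain

variable {L : Type*} [AddCommGroup L] [Module ℂ L] {S : SuperAlgebra L} {n c : ℕ}
  {P : ChainParams c} {f : ℕ → L} {g : L} {x : Fin c → L}

/-- The g-coordinate of the Leibniz identity for (x_l, x_i, g); the term [[x_l, x_i], g] is zero. -/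
theorem δ_mul_δ_add_β (h : HasChain S n P ⊤ f g x) (hS : S.IsLeibniz) (i l : Fin c) :
    P.δ l * (P.δ i + P.β i) = 0 := by
  have h1 := hS.even_mid (x l) (h.x_mem i) g
  rw [h.x_g, h.x_x, h.x_g] at h1
  have h2 := congrArg h.cg h1
  simp only [map_smul, LinearMap.smul_apply, h.x_g, h.g_g, h.g_x, cg_g, smul_eq_mul, mul_one,
    smul_zero, zero_sub, map_neg] at h2
  linear_combination h2

theorem ε_identity (h : HasChain S n P ⊤ f g x) (hS : S.IsLeibniz) (i j l : Fin c) :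
    P.ε i j * P.δ l = P.ε l i * P.β j - P.ε l j * P.β i := by
  have h1 := hS.even_mid (x l) (h.x_mem i) (x j)
  rw [h.x_x, h.x_x, h.x_x] at h1
  have h2 := congrArg h.cg h1
  simpa [h.x_g, h.g_x] using h2

/-- The superalgebras of codimension one with a diagonal action. -/
theorem exists_label_of_diagonal {P : ChainParams 1} {x : Fin 1 → L} (h : HasChain S n P ⊤ f g x)
    (hn : 3 ≤ n) (hS : S.IsLeibniz) (hα : P.α = fun _ => 1) (ha : P.a = fun _ _ => 0) :
    ∃ l : HLabel, l.Admissible ∧ (∀ a, l ≠ .H5 1 a) ∧ l.codim = 1 ∧ S.Iso (l.alg n) := by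
  have h1 := h.δ_mul_δ_add_β hS 0 0
  have h2 := h.ε_mul_δ hS 0
  have h0 : ∀ i : Fin 1, i = 0 := fun i => Subsingleton.elim i 0
  -- By δ(δ + β) = 0 and ε δ = 0, either δ = 0, or δ = -β ≠ 0 and ε = 0.
  by_cases hδ : P.δ 0 = 0
  · by_cases hε : P.β 0 = 0 ∧ P.ε 0 0 ≠ 0
    -- With β = δ = 0 no shift changes ε, which is absorbed into g instead.
    · refine ⟨.H3, trivial, by simp, rfl, (h.rescale (P' := HLabel.H3.params) one_ne_zero hε.2
        hα.symm ?_ ?_ ?_ ?_).iso (HLabel.H3.hasChain hn)⟩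
      · funext i; rw [h0 i]; exact hε.1.symm
      · funext i; rw [h0 i]; exact hδ.symm
      · intro i j; rw [h0 i, h0 j]; exact (one_mul _).symm
      · intro i j _ _; rw [ha]; exact (mul_zero _).symm
    -- The shift makes ε + uβ zero. For β = 0 the quotient is 0 by convention, and ε = 0 already.
    · refine ⟨.H2 (P.β 0), trivial, by simp, rfl, (h.shift (P' := (HLabel.H2 (P.β 0)).params)
        (fun _ => -(P.ε 0 0 / P.β 0)) hα.symm ?_ ?_ ha.symm ?_).iso (HLabel.hasChain hn _)⟩
      · funext i; rw [h0 i]; rfl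
      · funext i; rw [h0 i]; exact hδ.symm
      · intro i j
        rw [h0 i, h0 j, hδ]
        change (0 : ℂ) = _
        by_cases hβ : P.β 0 = 0
        · have : P.ε 0 0 = 0 := by
            by_contra h3
            exact hε ⟨hβ, h3⟩
          simp [this]
        · field_simp; ring
  · have h3 : P.ε 0 0 = 0 := (mul_eq_zero.1 h2).resolve_right hδ
    have h4 : P.δ 0 = -P.β 0 := eq_neg_of_add_eq_zero_left ((mul_eq_zero.1 h1).resolve_left hδ)
    refine ⟨.H1 (P.β 0), fun h5 => hδ (by rw [h4, h5, neg_zero]), by simp, rfl,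
      (h.rescale (P' := (HLabel.H1 (P.β 0)).params) one_ne_zero one_ne_zero
        hα.symm ?_ ?_ ?_ ?_).iso (HLabel.hasChain hn _)⟩
    · funext i; rw [h0 i]; rfl
    · funext i; rw [h0 i]; exact h4.symm
    · intro i j; rw [h0 i, h0 j, h3]; exact (zero_mul _).symm
    · intro i j _ _; rw [ha]; exact (mul_zero _).symm

/-- The superalgebras of codimension one with a nilpotent action on the chain. -/
theorem exists_label_of_nilpotent {P : ChainParams 1} {x : Fin 1 → L} (h : HasChain S n P ⊤ f g x)
    (hn : 3 ≤ n) (hS : S.IsLeibniz) (hα : P.α = fun _ => 0) (hβ : P.β = fun _ => 1) :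
    ∃ l : HLabel, l.Admissible ∧ (∀ a, l ≠ .H5 1 a) ∧ l.codim = 1 ∧ S.Iso (l.alg n) := by
  have h1 := h.δ_mul_δ_add_β hS 0 0
  have h2 := h.ε_mul_δ hS 0
  have h0 : ∀ i : Fin 1, i = 0 := fun i => Subsingleton.elim i 0
  -- Dividing by powers of two recovers list parameters from an arbitrary sequence of structure
  -- constants.
  have ha : (fun (_ : Fin 1) (s : ℕ) => (2 : ℂ) ^ s * (P.a 0 (s + 1 - 1) / 2 ^ (s + 1 - 1))) =
      P.a := by
    funext i s
    rw [h0 i, Nat.add_sub_cancel, mul_div_cancel₀ _ (pow_ne_zero _ two_ne_zero)]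
  by_cases hδ : P.δ 0 = 0
  · refine ⟨.H4 fun k => P.a 0 (k - 1) / 2 ^ (k - 1), trivial, by simp, rfl,
      (h.shift (P' := (HLabel.H4 fun k => P.a 0 (k - 1) / 2 ^ (k - 1)).params)
        (fun _ => -P.ε 0 0) hα.symm hβ.symm ?_ ha ?_).iso (HLabel.hasChain hn _)⟩
    · funext i; rw [h0 i]; exact hδ.symm
    · intro i j
      rw [h0 i, h0 j, hδ, hβ]
      change (0 : ℂ) = _
      ring
  · have h3 : P.ε 0 0 = 0 := (mul_eq_zero.1 h2).resolve_right hδ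
    have h4 : P.δ 0 = -P.β 0 := eq_neg_of_add_eq_zero_left ((mul_eq_zero.1 h1).resolve_left hδ)
    rw [hβ] at h4
    refine ⟨.H5 0 fun k => P.a 0 (k - 1) / 2 ^ (k - 1), .inl rfl, by simp, rfl,
      (h.shift (P' := (HLabel.H5 0 fun k => P.a 0 (k - 1) / 2 ^ (k - 1)).params)
        (fun _ => 0) hα.symm hβ.symm ?_ ha ?_).iso (HLabel.hasChain hn _)⟩
    · funext i; rw [h0 i]; exact h4.symm
    · intro i j
      rw [h0 i, h0 j, h3]
      change (0 : ℂ) = _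
      ring

/-- The superalgebras of codimension two. -/
theorem exists_label_of_two {P : ChainParams 2} {x : Fin 2 → L} (h : HasChain S n P ⊤ f g x)
    (hn : 3 ≤ n) (hS : S.IsLeibniz) (hα : P.α = ![1, 0]) (hβ : P.β = ![0, 1])
    (ha : P.a = fun _ _ => 0) :
    ∃ l : HLabel, l.Admissible ∧ (∀ a, l ≠ .H5 1 a) ∧ l.codim = 2 ∧ S.Iso (l.alg n) := by
  have b0 : P.β 0 = 0 := by rw [hβ]; rfl
  have b1 : P.β 1 = 1 := by rw [hβ]; rfl
  -- Since β_0 = 0, the relation becomes δ_0² = 0.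
  have d0 : P.δ 0 = 0 := by
    have := h.δ_mul_δ_add_β hS 0 0
    rw [b0, add_zero] at this
    exact mul_self_eq_zero.1 this
  have d1 := h.δ_mul_δ_add_β hS 1 1
  have e00 : P.ε 0 0 = 0 := by
    have := h.ε_identity hS 0 1 0
    rw [d0, b0, b1] at this
    linear_combination -this
  have e10 : P.ε 1 0 = P.ε 0 1 * P.δ 1 := by
    have := h.ε_identity hS 0 1 1
    rw [b0, b1] at this
    linear_combination -this
  have e11 := h.ε_mul_δ hS 1
  rw [b1] at d1
  by_cases hδ : P.δ 1 = 0
  -- u_0 clears ε_01 and with it ε_10 = ε_01 δ_1; u_1 clears ε_11 because β_1 = 1.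
  · refine ⟨.MH1, trivial, by simp, rfl, (h.shift (P' := HLabel.MH1.params)
      ![-P.ε 0 1, -P.ε 1 1] hα.symm hβ.symm ?_ ha.symm ?_).iso (HLabel.hasChain hn _)⟩
    · funext i
      fin_cases i
      · exact d0.symm
      · exact hδ.symm
    · change ∀ i j : Fin 2, (0 : ℂ) = _
      simp only [Fin.forall_fin_two]
      simp [b0, b1, d0, hδ, e00, e10]
  · have h3 : P.ε 1 1 = 0 := (mul_eq_zero.1 e11).resolve_right hδ
    have h4 : P.δ 1 = -1 := eq_neg_of_add_eq_zero_left ((mul_eq_zero.1 d1).resolve_left hδ)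
    -- Now β_1 + δ_1 = 0, so shifts do not change ε_11, which is already zero.
    refine ⟨.MH2, trivial, by simp, rfl, (h.shift (P' := HLabel.MH2.params)
      ![-P.ε 0 1, 0] hα.symm hβ.symm ?_ ha.symm ?_).iso (HLabel.hasChain hn _)⟩
    · funext i
      fin_cases i
      · exact d0.symm
      · exact h4.symm
    · change ∀ i j : Fin 2, (0 : ℂ) = _
      simp only [Fin.forall_fin_two]
      simp [b0, b1, d0, h4, e00, e10, h3]

end HasChain

/-! ### The classification -/

namespace ChainExtension

variable {L : Type*} [AddCommGroup L] [Module ℂ L] {S : SuperAlgebra L} {n : ℕ}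
  {f : ℕ → L} {g : L} {z : Fin 0 → L}

/-- A complement of the nilradical of dimension one. -/
theorem exists_coeff {N : S.GradedIdeal} (E : ChainExtension S n N.carrier f g z)
    (hN : S.IsNilradical N) {x : L} (hx : x ∈ S.part 0)
    (h : ∀ v ∈ S.part 0, ∃ r : ℂ, E.chain.cf 0 (S.bracket (f 0) (v - r • x)) = 0 ∧
      E.chain.cg (S.bracket g (v - r • x)) = 0) (v : L) : ∃ r : ℂ, v - r • x ∈ N.carrier := by
  obtain ⟨a, ha, b, hb, rfl⟩ := S.exists_parts v
  obtain ⟨r, h1, h2⟩ := h a ha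
  refine ⟨r, ?_⟩
  rw [add_sub_right_comm]
  exact add_mem (E.even_mem hN (Submodule.sub_mem _ ha (Submodule.smul_mem _ _ hx)) h1 h2)
    (E.odd_mem hN hb)

theorem hasChain_diagonal {N : Submodule ℂ L} (E : ChainExtension S n N f g z) {x : L}
    (hx : x ∈ S.part 0) (hfx : S.bracket (f 0) x = f 0) (hxf : S.bracket x (f 0) = -f 0)
    (htop : ∀ v, ∃ r : ℂ, v - r • x ∈ N) :
    ∃ P : ChainParams 1, P.α = (fun _ => 1) ∧ P.a = (fun _ _ => 0) ∧
      HasChain S n P ⊤ f g (fun _ => x) := by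
  refine ⟨⟨fun _ => 1, fun _ => E.chain.cg (S.bracket g x), fun _ => E.chain.cg (S.bracket x g),
    fun _ _ => E.chain.cg (S.bracket x x), fun _ _ => 0⟩, rfl, rfl,
    E.hasChain _ _ (fun _ => hx) (fun v => ?_) (fun r h1 _ => ?_) (fun _ => ?_) (fun _ => ?_)
    (fun _ => E.g_bracket_even hx) (fun _ => E.bracket_g_even hx)
    (fun _ _ => E.bracket_even_even hx hx ?_)⟩
  · obtain ⟨r, hr⟩ := htop v
    exact ⟨fun _ => r, by simpa using hr⟩
  · funext i
    rw [Subsingleton.elim i 0]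
    simpa using h1
  · rw [hxf, neg_one_smul]
  · simp [hfx]
  · rw [hxf, map_neg, map_neg, LinearMap.neg_apply, hxf, hfx]; simp

theorem hasChain_nilpotent {N : Submodule ℂ L} (E : ChainExtension S n N f g z) {x : L}
    (hx : x ∈ S.part 0) (hβ : E.chain.cg (S.bracket g x) = 1) (hxf : S.bracket x (f 0) = 0)
    {a : ℕ → ℂ} (hfx : S.bracket (f 0) x = ∑ j ∈ Finset.Icc 1 (n - 1), a j • f (2 * j))
    (htop : ∀ v, ∃ r : ℂ, v - r • x ∈ N) :
    ∃ P : ChainParams 1, P.α = (fun _ => 0) ∧ P.β = (fun _ => 1) ∧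
      HasChain S n P ⊤ f g (fun _ => x) := by
  refine ⟨⟨fun _ => 0, fun _ => 1, fun _ => E.chain.cg (S.bracket x g),
    fun _ _ => E.chain.cg (S.bracket x x), fun _ => a⟩, rfl, rfl,
    E.hasChain _ _ (fun _ => hx) (fun v => ?_) (fun r _ h2 => ?_) (fun _ => ?_) (fun _ => ?_)
    (fun _ => ?_) (fun _ => E.bracket_g_even hx)
    (fun _ _ => E.bracket_even_even hx hx ?_)⟩
  · obtain ⟨r, hr⟩ := htop v
    exact ⟨fun _ => r, by simpa using hr⟩
  · funext i
    rw [Subsingleton.elim i 0]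
    simpa using h2
  · rw [hxf, neg_zero, zero_smul]
  · rw [hfx, zero_smul, zero_add]
  · rw [one_smul, E.g_bracket_even hx, hβ, one_smul]
  · rw [hxf, map_zero, map_zero, LinearMap.zero_apply, add_zero]

theorem hasChain_two {N : Submodule ℂ L} (E : ChainExtension S n N f g z) {x y : L}
    (hx : x ∈ S.part 0) (hfx : S.bracket (f 0) x = f 0) (hxf : S.bracket x (f 0) = -f 0)
    (hgx : S.bracket g x = 0) (hy : y ∈ S.part 0) (hfy : S.bracket (f 0) y = 0)
    (hyf : S.bracket y (f 0) = 0) (hgy : S.bracket g y = g)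
    (htop : ∀ v, ∃ r s : ℂ, v - r • x - s • y ∈ N) :
    ∃ P : ChainParams 2, P.α = ![1, 0] ∧ P.β = ![0, 1] ∧ P.a = (fun _ _ => 0) ∧
      HasChain S n P ⊤ f g ![x, y] := by
  have hxy : ∀ i, ![x, y] i ∈ S.part 0 := by
    intro i; fin_cases i
    · exact hx
    · exact hy
  refine ⟨⟨![1, 0], ![0, 1], fun i => E.chain.cg (S.bracket (![x, y] i) g),
    fun i j => E.chain.cg (S.bracket (![x, y] i) (![x, y] j)), fun _ _ => 0⟩, rfl, rfl, rfl,
    E.hasChain _ _ hxy (fun v => ?_) (fun r h1 h2 => ?_) (fun i => ?_) (fun i => ?_) (fun i => ?_)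
    (fun i => E.bracket_g_even (hxy i)) (fun i j => E.bracket_even_even (hxy i) (hxy j) ?_)⟩
  · obtain ⟨r, s, hr⟩ := htop v
    refine ⟨![r, s], ?_⟩
    rw [Fin.sum_univ_two, ← sub_sub]
    exact hr
  · rw [Fin.sum_univ_two] at h1 h2
    funext i
    fin_cases i
    · simpa using h1
    · simpa using h2
  · fin_cases i <;> simp [hxf, hyf]
  · fin_cases i <;> simp [hfx, hfy]
  · fin_cases i <;> simp [hgx, hgy]
  · fin_cases i <;> fin_cases j <;> simp [hfx, hfy, hxf, hyf]

end ChainExtension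

namespace ChainExtension

section

variable {L : Type*} [AddCommGroup L] [Module ℂ L] {S : SuperAlgebra L} {n : ℕ}
  {N : Submodule ℂ L} {f : ℕ → L} {g : L} {z : Fin 0 → L}

theorem g_bracket_congr (E : ChainExtension S n N f g z) {u v : L} (h : u - v ∈ N) :
    S.bracket g u = S.bracket g v := by
  have := E.g_bracket h
  rwa [map_sub, sub_eq_zero] at this

/-- An even element which commutes with `x` modulo the nilradical annihilates the chain. -/
theorem f_bracket_eq_zero (E : ChainExtension S n N f g z) {x y : L} (hx : x ∈ S.part 0)
    (hy : y ∈ S.part 0) (hfx : S.bracket (f 0) x = f 0) (hxf : S.bracket x (f 0) = -f 0)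
    (hyf : S.bracket y (f 0) = 0) (hfy : S.bracket (f 0) y = ∑ j ∈ Finset.Icc 1 (n - 1),
      E.chain.cf (2 * j) (S.bracket (f 0) y) • f (2 * j)) : S.bracket (f 0) y = 0 := by
  have h1 := E.bracket_even_even hy hx (by rw [hxf, map_neg, hyf]; simp)
  -- Since [y, x] is a multiple of g, this says [[f_0, y], x] = [[f_0, x], y] = [f_0, y].
  have h2 := E.leibniz.even_mid (f 0) hy x
  rw [h1, map_smul, E.bracket_g (E.chain.f_mem 0), smul_zero, hfx] at h2
  have h3 := sub_eq_zero.1 h2.symm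
  have hk := fun k => E.f_bracket hx (s := 1) (a := 0) (by simp [hfx]) k
  rw [hfy, map_sum, LinearMap.sum_apply] at h3
  set a : ℕ → ℂ := fun j => E.chain.cf (2 * j) (S.bracket (f 0) y) with ha
  rw [hfy]
  refine Finset.sum_eq_zero fun k hk' => ?_
  rw [Finset.mem_Icc] at hk'
  have hsum : ∀ b : ℕ → ℂ, E.chain.cf (2 * k)
      (∑ j ∈ Finset.Icc 1 (n - 1), b j • f (2 * j)) = b k := by
    intro b
    rw [map_sum, Finset.sum_eq_single k]
    · rw [map_smul, HasChain.cf_f, if_pos ⟨rfl, by omega⟩, smul_eq_mul, mul_one]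
    · intro j _ hj
      rw [map_smul, HasChain.cf_f, if_neg (by omega), smul_zero]
    · intro h; exact absurd (Finset.mem_Icc.2 hk') h
  -- R_x multiplies f_{2j} by 2j + 1 but fixes [f_0, y]; hence 2j a_j = 0.
  have h4 : ∑ j ∈ Finset.Icc 1 (n - 1), (a j * (2 * j + 1)) • f (2 * j) =
      ∑ j ∈ Finset.Icc 1 (n - 1), a j • f (2 * j) := by
    rw [← h3]
    refine Finset.sum_congr rfl fun j _ => ?_
    rw [map_smul, LinearMap.smul_apply, hk, mul_smul]
    simp [ha]
  have h5 := congrArg (E.chain.cf (2 * k)) h4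
  rw [hsum, hsum] at h5
  have h6 : a k * (2 * k) = 0 := by linear_combination h5
  have h7 : (2 * k : ℂ) ≠ 0 := mul_ne_zero two_ne_zero (Nat.cast_ne_zero.2 (by omega))
  change a k • _ = _
  rw [(mul_eq_zero.1 h6).resolve_right h7, zero_smul]

end

variable {L : Type*} [AddCommGroup L] [Module ℂ L] {S : SuperAlgebra L} {n : ℕ}
  {N : S.GradedIdeal} {f : ℕ → L} {g : L} {z : Fin 0 → L}

/-- The classification when some even element acts on `f 0` with a non-zero eigenvalue. -/
theorem exists_label_of_eigenvalue_ne_zero (E : ChainExtension S n N.carrier f g z) (hn : 3 ≤ n)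
    (hN : S.IsNilradical N) {x : L} (hx : x ∈ S.part 0)
    (h0 : E.chain.cf 0 (S.bracket (f 0) x) ≠ 0) :
    ∃ l : HLabel, l.Admissible ∧ (∀ a, l ≠ .H5 1 a) ∧
      Module.finrank ℂ (L ⧸ N.carrier) = l.codim ∧ S.Iso (l.alg n) := by
  obtain ⟨f', x', E', hx', -, hfx, hxf⟩ := E.exists_diagonal
    (Submodule.smul_mem _ (E.chain.cf 0 (S.bracket (f 0) x))⁻¹ hx)
    (by rw [map_smul, map_smul, smul_eq_mul, inv_mul_cancel₀ h0])
  clear hx h0 E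
  have h1 : E'.chain.cf 0 (f' 0) = 1 := by rw [HasChain.cf_f, if_pos ⟨rfl, by omega⟩]
  -- This decides the codimension: it is two if the weights on f_0 and on g are independent.
  by_cases hv : ∃ v ∈ S.part 0, E'.chain.cf 0 (S.bracket (f' 0) v) = 0 ∧
      E'.chain.cg (S.bracket g v) ≠ 0
  · obtain ⟨v, hv, hv0, hvg⟩ := hv
    obtain ⟨y, hy, hyv, hyf, hfy⟩ := E'.exists_shift
      (Submodule.smul_mem _ (E'.chain.cg (S.bracket g v))⁻¹ hv)
      (by rw [map_smul, map_smul, hv0, smul_zero])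
    have hgy : S.bracket g y = g := by
      rw [E'.g_bracket_even hy, E'.g_bracket_congr hyv, map_smul, map_smul, smul_eq_mul,
        inv_mul_cancel₀ hvg, one_smul]
    have hfy0 := E'.f_bracket_eq_zero hx' hy hfx hxf hyf hfy
    -- A multiple of y is subtracted to make the weights of the two vectors (1, 0) and (0, 1).
    obtain ⟨x'', hx'', hfx'', hxf'', hgx''⟩ : ∃ x'' ∈ S.part 0, S.bracket (f' 0) x'' = f' 0 ∧
        S.bracket x'' (f' 0) = -f' 0 ∧ S.bracket g x'' = 0 :=
      ⟨x' - E'.chain.cg (S.bracket g x') • y, Submodule.sub_mem _ hx' (Submodule.smul_mem _ _ hy),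
        by rw [map_sub, map_smul, hfy0, hfx, smul_zero, sub_zero],
        by rw [map_sub, map_smul, LinearMap.sub_apply, LinearMap.smul_apply, hyf, hxf, smul_zero,
          sub_zero],
        by rw [map_sub, map_smul, hgy, ← E'.g_bracket_even hx', sub_self]⟩
    obtain ⟨P, hα, hβ, ha, h⟩ := E'.hasChain_two hx'' hfx'' hxf'' hgx'' hy hfy0 hyf hgy
      (fun w => by
        obtain ⟨a, ha, b, hb, rfl⟩ := S.exists_parts w
        refine ⟨E'.chain.cf 0 (S.bracket (f' 0) a), E'.chain.cg (S.bracket g a), ?_⟩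
        rw [add_sub_right_comm, add_sub_right_comm]
        refine add_mem (E'.even_mem hN (Submodule.sub_mem _ (Submodule.sub_mem _ ha
          (Submodule.smul_mem _ _ hx'')) (Submodule.smul_mem _ _ hy)) ?_ ?_) (E'.odd_mem hN hb)
        · simp only [map_sub, map_smul, hfx'', hfy0, h1, smul_eq_mul, mul_one, smul_zero, map_zero,
            sub_self]
        · simp only [map_sub, map_smul, hgx'', hgy, HasChain.cg_g, smul_eq_mul, mul_one, smul_zero,
            sub_zero, sub_self])
    obtain ⟨l, h2, h3, h4, h5⟩ := h.exists_label_of_two hn E'.leibniz hα hβ ha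
    exact ⟨l, h2, h3, by rw [h.finrank_quotient E'.chain, h4], h5⟩
  · push Not at hv
    obtain ⟨P, hα, ha, h⟩ := E'.hasChain_diagonal hx' hfx hxf (E'.exists_coeff hN hx'
      fun v hv' => by
        have h2 : E'.chain.cf 0 (S.bracket (f' 0)
            (v - E'.chain.cf 0 (S.bracket (f' 0) v) • x')) = 0 := by
          rw [map_sub, map_smul, hfx, map_sub, map_smul, h1, smul_eq_mul, mul_one, sub_self]
        exact ⟨_, h2, hv _ (Submodule.sub_mem _ hv' (Submodule.smul_mem _ _ hx')) h2⟩)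
    obtain ⟨l, h2, h3, h4, h5⟩ := h.exists_label_of_diagonal hn E'.leibniz hα ha
    exact ⟨l, h2, h3, by rw [h.finrank_quotient E'.chain, h4], h5⟩

/-- The classification when all even elements act nilpotently on the chain. -/
theorem exists_label_of_eigenvalue_eq_zero (E : ChainExtension S n N.carrier f g z) (hn : 3 ≤ n)
    (hN : S.IsNilradical N) (hS : ¬ S.IsNilpotent)
    (h0 : ∀ x ∈ S.part 0, E.chain.cf 0 (S.bracket (f 0) x) = 0) :
    ∃ l : HLabel, l.Admissible ∧ (∀ a, l ≠ .H5 1 a) ∧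
      Module.finrank ℂ (L ⧸ N.carrier) = l.codim ∧ S.Iso (l.alg n) := by
  obtain ⟨v, hv, hvg⟩ : ∃ v ∈ S.part 0, E.chain.cg (S.bracket g v) ≠ 0 := by
    -- If all weights on g vanished as well, N would be all of L and L would be nilpotent.
    by_contra! hg
    refine hS (SuperAlgebra.isNilpotent_of_ideal_eq_top hN.1 (eq_top_iff.2 fun v _ => ?_))
    obtain ⟨a, ha, b, hb, rfl⟩ := S.exists_parts v
    exact add_mem (E.even_mem hN ha (h0 a ha) (hg a ha)) (E.odd_mem hN hb)
  have hv' := Submodule.smul_mem (S.part 0) (E.chain.cg (S.bracket g v))⁻¹ hv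
  obtain ⟨y, hy, hyv, hyf, hfy⟩ := E.exists_shift hv' (h0 _ hv')
  have hgy : E.chain.cg (S.bracket g y) = 1 := by
    rw [E.g_bracket_congr hyv, map_smul, map_smul, smul_eq_mul, inv_mul_cancel₀ hvg]
  obtain ⟨P, hα, hβ, h⟩ := E.hasChain_nilpotent hy hgy hyf hfy (E.exists_coeff hN hy
    fun v hv => ⟨E.chain.cg (S.bracket g v),
      h0 _ (Submodule.sub_mem _ hv (Submodule.smul_mem _ _ hy)), by
        rw [map_sub, map_smul, map_sub, map_smul, hgy, smul_eq_mul, mul_one, sub_self]⟩)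
  obtain ⟨l, h2, h3, h4, h5⟩ := h.exists_label_of_nilpotent hn E.leibniz hα hβ
  exact ⟨l, h2, h3, by rw [h.finrank_quotient E.chain, h4], h5⟩

end ChainExtension

/-- The classification of the non-nilpotent solvable extensions of `H(0, …, 0)`. -/
theorem exists_label {n : ℕ} (hn : 3 ≤ n) {L : Type*} [AddCommGroup L] [Module ℂ L]
    {S : SuperAlgebra L} {N : S.GradedIdeal} (hL : S.IsLeibniz) (hS : ¬ S.IsNilpotent)
    (hN : S.IsNilradical N) (e : (S.ofIdeal N).Iso (algH0 n)) :
    ∃ l : HLabel, l.Admissible ∧ l.Normalized n ∧ (∀ a, l ≠ .H5 1 a) ∧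
      Module.finrank ℂ (L ⧸ N.carrier) = l.codim ∧ S.Iso (l.alg n) := by
  obtain ⟨f, g, z, h⟩ := (algH0_hasChain hn).exists_of_iso e.symm
  have E : ChainExtension S n N.carrier (fun k => (f k : L)) g (fun i => (z i : L)) :=
    ⟨hL, fun u v => hN.2.1 (Submodule.apply_mem_map₂ _ Submodule.mem_top Submodule.mem_top),
      by omega, h.ofIdeal⟩
  obtain ⟨l, h1, h2, h3, h4⟩ : ∃ l : HLabel, l.Admissible ∧ (∀ a, l ≠ .H5 1 a) ∧
      Module.finrank ℂ (L ⧸ N.carrier) = l.codim ∧ S.Iso (l.alg n) := by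
    by_cases h0 : ∀ x ∈ S.part 0, E.chain.cf 0 (S.bracket (f 0 : L) x) = 0
    · exact E.exists_label_of_eigenvalue_eq_zero hn hN hS h0
    · push Not at h0
      obtain ⟨x, hx, h0⟩ := h0
      exact E.exists_label_of_eigenvalue_ne_zero hn hN hx h0
  obtain ⟨l', h5, h6, h7, h8, h9⟩ := HLabel.exists_normalized hn l h1 h2
  exact ⟨l', h5, h6, h7, h3.trans h8, h4.trans h9⟩

theorem mainTheorem1 (n : ℕ) (hn : 3 ≤ n) :
    -- every superalgebra in question is isomorphic to one from the list
    (∀ (L : Type*) [AddCommGroup L] [Module ℂ L] (S : SuperAlgebra L) (N : S.GradedIdeal),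
      S.IsLeibniz → S.IsSolvable → ¬ S.IsNilpotent → S.IsNilradical N →
      (S.ofIdeal N).Iso (algH0 n) →
      ∃ l : HLabel, l.Admissible ∧ l.Normalized n ∧ (∀ a, l ≠ .H5 1 a) ∧
        Module.finrank ℂ (L ⧸ N.carrier) = l.codim ∧ S.Iso (l.alg n)) ∧
    -- the superalgebras in the list other than `H₅(1)` are of the kind in question
    (∀ l : HLabel, l.Admissible → (∀ a, l ≠ .H5 1 a) →
      (l.alg n).IsLeibniz ∧ (l.alg n).IsSolvable ∧ ¬ (l.alg n).IsNilpotent ∧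
      ∃ N : (l.alg n).GradedIdeal, (l.alg n).IsNilradical N ∧
        ((l.alg n).ofIdeal N).Iso (algH0 n) ∧
        Module.finrank ℂ (HVec n l.codim ⧸ N.carrier) = l.codim) ∧
    -- the superalgebras `H₅(1)` do not satisfy the Leibniz superidentity
    (∀ a : ℕ → ℂ, ¬ (HLabel.alg n (.H5 1 a)).IsLeibniz) ∧
    -- the superalgebras in the list are pairwise non-isomorphic
    (∀ l l' : HLabel, l.Admissible → l'.Admissible →
      ((l.alg n).Iso (l'.alg n) ↔ HLabel.Same n l l')) := by

  exact ⟨fun L _ _ S N h1 _ h3 h4 h5 => exists_label hn h1 h3 h4 h5,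
    fun l hl h5 => ⟨l.isLeibniz hn hl h5, l.exists_nilradical hn⟩,
    HLabel.H5_one_not_isLeibniz hn,
    fun l l' hl hl' => ⟨HLabel.same_of_iso hn hl hl', HLabel.iso_of_same hn⟩⟩
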